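/- For an abelian group $B$ and $m\ge 0$ let $SP^m(B)$, $\Lambda^m(B)$, $\Gamma_m(B)$ be the $m$-th symmetric, exterior and divided powers ($\Gamma_m=0$ for $m<0$), with divided power generators $\gamma_k(b)$. For $n\ge 1$ let $C^n(A)$ be the dual de Rham complex: $C^n_i(A)=\Lambda^i(A)\otimes\Gamma_{n-i}(A)$ with $$d_i(b_1\wedge\dots\wedge b_i\otimes X)=\sum_{k=1}^i(-1)^k\,b_1\wedge\dots\wedge\hat b_k\wedge\dots\wedge b_i\otimes b_kX .$$ Let $L_iSP^m(B)=\pi_i(SP^m K(P_*))$ be the Dold–Puppe derived functors, where $P_*\to B$ is a projective resolution and $K$ is the Dold–Kan functor. If $hx_k=0$ in $B$ for all $k$, then $\beta_h(x_1,\dots,x_{i+1})\in L_iSP^{i+1}(B)$ is the image, under shuffles and the projection from the tensor power to $SP^{i+1}$, of the class of $\sum_t(-1)^{t-1}e_1\otimes\dots\otimes a_t\otimes\dots\otimes e_{i+1}$, where $a_k\in P_0$ lifts $x_k$ and $e_k\in P_1$ satisfies $\partial e_k=ha_k$; write $\beta_h(x_1,\dots,x_{i+1})\otimes y_1\cdots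 y_r\in L_iSP^{i+1+r}(B)$ for its product with $y_1,\dots,y_r\in B$. **Proposition.** Let $A$ be a free abelian group, $p$ a prime, $n\ge 1$ divisible by $p$, $m=n/p$ and $i\ge 0$. For $r\ge 0$ with $i+1+r=m$ and $x_1,\dots,x_m\in A$ put $$\eta_i(x_1,\dots,x_m)=\sum_{t=1}^{i+1}(-1)^t\,x_1\wedge\dots\wedge\hat x_t\wedge\dots\wedge x_{i+1}\otimes\Big(\prod_{s\le i+1,\ s\ne t}\gamma_{p-1}(x_s)\Big)\gamma_p(x_t)\,\gamma_p(x_{i+2})\cdots\gamma_p(x_m)\in\Lambda^i(A)\otimes\Gamma_{n-i}(A).$$ Let $\bar x$ denote the image of $x\in A$ in $A\otimes\mathbb Z/p$, and compute $L_iSP^m(A\otimes\mathbb Z/p)$ with the resolution $A\xrightarrow{\,p\,}A$, taking $a_k=e_k=x_k$ in the symbols. Then: 1. the class $\beta_p(\bar x_1,\dots,\bar x_{i+1})\otimes\bar x_{i+2}\cdots\bar x_m$ depends only on $\bar x_1,\dots,\bar x_m$; 2. $d_i\eta_i(x_1,\dots,x_m)=0$; 3. if $\bar x_k=\bar x_k'$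 for all $k$, then $\eta_i(x_1,\dots,x_m)-\eta_i(x_1',\dots,x_m')\in\operatorname{im} d_{i+1}$; 4. if $i+2\le m$, then $\sum_{k=1}^{i+2}(-1)^k\,\eta_i(x_1,\dots,\hat x_k,\dots,x_{i+2},x_k,y_1,\dots,y_{m-i-2})=0$ for all $x_j,y_j\in A$; 5. there is a unique homomorphism $f_i^{n,p}\colon L_iSP^{m}(A\otimes\mathbb Z/p)\to H_iC^n(A)$ with $$f_i^{n,p}\big(\beta_p(\bar x_1,\dots,\bar x_{i+1})\otimes\bar x_{i+2}\cdots\bar x_m\big)=[\eta_i(x_1,\dots,x_m)]$$ for all $x_1,\dots,x_m\in A$ (when $i\ge m$ there are no symbols, and the only homomorphism is zero). -/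

import Mathlib

set_option maxSynthPendingDepth 3

open scoped TensorProduct

universe u

namespace DualDeRham

noncomputable section

open CategoryTheory

/-! ### Divided powers and the dual de Rham complex

The constructions are written over a commutative ring `R`; they are used for `R = ℤ`. -/

section DeRham

variable (R : Type) [CommRing R] (A : Type u) [AddCommGroup A] [Module R A]

/-- `Γ_d(A)`: the degree `d` part of the divided power algebra, spanned by the monomials
`γ_{c₁}(a₁) ⋯ γ_{c_s}(a_s)` with `c₁ + ⋯ + c_s = d`. The degree is an integer, and
`Γ_d(A) = 0` for `d < 0`. -/
def gammaPow (d : ℤ) : Submodule R (DividedPowerAlgebra R A) :=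
  Submodule.span R {X | ∃ s : Multiset (ℕ × A), (((s.map Prod.fst).sum : ℕ) : ℤ) = d ∧
    X = (s.map fun q => DividedPowerAlgebra.dp R q.1 q.2).prod}

variable {R A}

lemma dp_mem (c : ℕ) (a : A) : DividedPowerAlgebra.dp R c a ∈ gammaPow R A c :=
  Submodule.subset_span ⟨{(c, a)}, by simp, by simp⟩

lemma one_mem_gammaPow : (1 : DividedPowerAlgebra R A) ∈ gammaPow R A 0 :=
  Submodule.subset_span ⟨0, by simp, by simp⟩

lemma mul_mem_gammaPow {d e : ℤ} {X Y : DividedPowerAlgebra R A}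
    (hX : X ∈ gammaPow R A d) (hY : Y ∈ gammaPow R A e) : X * Y ∈ gammaPow R A (d + e) := by
  have h : gammaPow R A d * gammaPow R A e ≤ gammaPow R A (d + e) := by
    rw [gammaPow, gammaPow, Submodule.span_mul_span]
    refine Submodule.span_le.2 ?_
    rintro _ ⟨_, ⟨s, hs, rfl⟩, _, ⟨t, ht, rfl⟩, rfl⟩
    exact Submodule.subset_span ⟨s + t, by simp [← hs, ← ht], by simp⟩
  exact h (Submodule.mul_mem_mul hX hY)

lemma prod_mem_gammaPow {k : ℕ} {c : ℤ} {X : Fin k → DividedPowerAlgebra R A}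
    (h : ∀ j, X j ∈ gammaPow R A c) : ∏ j, X j ∈ gammaPow R A (k * c) := by
  induction k with
  | zero => simpa using one_mem_gammaPow
  | succ k ih =>
    rw [Fin.prod_univ_succ]
    have := mul_mem_gammaPow (h 0) (ih fun j => h j.succ)
    rwa [show c + k * c = ((k + 1 : ℕ) : ℤ) * c by push_cast; ring] at this

/-- Multiplication `(b, X) ↦ b X = γ₁(b) X`, from `A × Γ_d(A)` to `Γ_{d+1}(A)`. -/
def gammaMul {d e : ℤ} (h : d + 1 = e) : A →ₗ[R] gammaPow R A d →ₗ[R] gammaPow R A e :=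
  LinearMap.mk₂ R
    (fun b X => ⟨DividedPowerAlgebra.embed R A b * X, by
      rw [← h, add_comm]; exact mul_mem_gammaPow (dp_mem 1 b) X.2⟩)
    (fun b b' X => by ext; simp [add_mul])
    (fun c b X => by ext; simp)
    (fun b X X' => by ext; simp [mul_add])
    (fun c b X => by ext; simp)

lemma gammaMul_comm {d e f : ℤ} (h : d + 1 = e) (h' : e + 1 = f) (b b' : A)
    (X : gammaPow R A d) :
    gammaMul h' b (gammaMul h b' X) = gammaMul h' b' (gammaMul h b X) := by
  ext
  exact mul_left_comm _ _ _

/-- The bilinear map sending `(b, w)` to the linear map `X ↦ w ⊗ b X`. -/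
def contractAux (i : ℕ) {d e : ℤ} (h : d + 1 = e) :
    A →ₗ[R] ⋀[R]^i A →ₗ[R] (gammaPow R A d →ₗ[R] ⋀[R]^i A ⊗[R] gammaPow R A e) :=
  LinearMap.mk₂ R
    (fun b w => (TensorProduct.mk R (⋀[R]^i A) (gammaPow R A e) w).comp (gammaMul h b))
    (fun b b' w => by ext; simp [TensorProduct.tmul_add])
    (fun c b w => by ext; simp)
    (fun b w w' => by ext; simp)
    (fun c b w => by ext; simp [TensorProduct.smul_tmul'])

/-- The alternating map in `b₁, …, b_{i+1}` with values
`X ↦ ∑ k, (-1)^k b₁ ∧ ⋯ ∧ b̂_k ∧ ⋯ ∧ b_{i+1} ⊗ b_k X` (with `k` counted from `1`). -/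
def contractAlt (i : ℕ) {d e : ℤ} (h : d + 1 = e) :
    A [⋀^Fin (i + 1)]→ₗ[R] (gammaPow R A d →ₗ[R] ⋀[R]^i A ⊗[R] gammaPow R A e) :=
  -AlternatingMap.alternatizeUncurryFin (R := R) (M := A)
    (N := gammaPow R A d →ₗ[R] ⋀[R]^i A ⊗[R] gammaPow R A e)
    { toFun := fun b => (contractAux i h b).compAlternatingMap (exteriorPower.ιMulti R i)
      map_add' := fun b b' => by ext; simp
      map_smul' := fun c b => by ext; simp }

/-- The differential `Λ^{i+1}(A) ⊗ Γ_d(A) → Λ^i(A) ⊗ Γ_{d+1}(A)`. -/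
def diff (i : ℕ) {d e : ℤ} (h : d + 1 = e) :
    ⋀[R]^(i + 1) A ⊗[R] gammaPow R A d →ₗ[R] ⋀[R]^i A ⊗[R] gammaPow R A e :=
  TensorProduct.lift (exteriorPower.alternatingMapLinearEquiv (R := R) (M := A)
    (N := gammaPow R A d →ₗ[R] ⋀[R]^i A ⊗[R] gammaPow R A e) (contractAlt i h))

/-- `d(b₁ ∧ ⋯ ∧ b_{i+1} ⊗ X) = ∑ k, (-1)^k b₁ ∧ ⋯ ∧ b̂_k ∧ ⋯ ∧ b_{i+1} ⊗ b_k X`, with `k`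
counted from `1` in this formula and from `0` in the code. -/
lemma diff_apply (i : ℕ) {d e : ℤ} (h : d + 1 = e) (b : Fin (i + 1) → A)
    (X : gammaPow R A d) :
    diff i h (exteriorPower.ιMulti R (i + 1) b ⊗ₜ X) =
      ∑ k : Fin (i + 1), (-1 : ℤ) ^ ((k : ℕ) + 1) •
        (exteriorPower.ιMulti R i (fun j => b (k.succAbove j)) ⊗ₜ[R] gammaMul h (b k) X) := by
  rw [diff, TensorProduct.lift.tmul, exteriorPower.alternatingMapLinearEquiv_apply_ιMulti,
    contractAlt, AlternatingMap.neg_apply, AlternatingMap.alternatizeUncurryFin_apply,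
    ← Finset.sum_neg_distrib, LinearMap.sum_apply]
  refine Finset.sum_congr rfl fun k _ => ?_
  rw [pow_succ, mul_neg_one, neg_smul]
  rfl

lemma diff_diff (i : ℕ) {d e f : ℤ} (h : d + 1 = e) (h' : e + 1 = f) :
    (diff (R := R) (A := A) i h').comp (diff (i + 1) h) = 0 := by
  refine TensorProduct.ext (exteriorPower.linearMap_ext (R := R) (M := A)
    (N := gammaPow R A d →ₗ[R] ⋀[R]^i A ⊗[R] gammaPow R A f) (AlternatingMap.ext fun b => ?_))
  refine LinearMap.ext fun X => ?_
  change diff i h' (diff (i + 1) h (exteriorPower.ιMulti R (i + 2) b ⊗ₜ X)) = 0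
  let g : A →ₗ[R] A →ₗ[R] A [⋀^Fin i]→ₗ[R] ⋀[R]^i A ⊗[R] gammaPow R A f :=
    LinearMap.mk₂ R
      (fun a a' => ((TensorProduct.mk R (⋀[R]^i A) (gammaPow R A f)).flip
        (gammaMul h' a (gammaMul h a' X))).compAlternatingMap (exteriorPower.ιMulti R i))
      (fun a a' a'' => by ext; simp)
      (fun c a a' => by ext; simp)
      (fun a a' a'' => by ext; simp)
      (fun c a a' => by ext; simp)
  have hg := congrArg (fun φ => φ b)
    (AlternatingMap.alternatizeUncurryFin_alternatizeUncurryFinLM_comp_of_symmetric (f := g)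
      (fun x y => by
        ext v
        exact congrArg (fun Y => exteriorPower.ιMulti R i v ⊗ₜ[R] Y) (gammaMul_comm h h' x y X)))
  simp only [AlternatingMap.alternatizeUncurryFin_apply, AlternatingMap.zero_apply,
    LinearMap.comp_apply, AlternatingMap.alternatizeUncurryFinLM_apply] at hg
  rw [diff_apply, map_sum, ← hg]
  refine Finset.sum_congr rfl fun k _ => ?_
  rw [map_zsmul, diff_apply, pow_succ, mul_neg_one, neg_smul, ← smul_neg,
    ← Finset.sum_neg_distrib]
  congr 1
  refine Finset.sum_congr rfl fun l _ => ?_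
  rw [pow_succ, mul_neg_one, neg_smul, neg_neg, gammaMul_comm]
  rfl

variable (R A) in
/-- The dual de Rham complex `C^n(A)`, with `C^n_i(A) = Λ^i(A) ⊗ Γ_{n-i}(A)`. -/
def dualDeRham (n : ℕ) : ChainComplex (ModuleCat.{u} R) ℕ :=
  ChainComplex.of (fun i => ModuleCat.of R (⋀[R]^i A ⊗[R] gammaPow R A ((n : ℤ) - i)))
    (fun i => ModuleCat.ofHom (diff i (by push_cast; ring)))
    (fun i => by rw [← ModuleCat.ofHom_comp, diff_diff]; rfl)

lemma eta_degree {p n m i r : ℕ} (hp : 0 < p) (hn : n = p * m) (h : m = i + 1 + r) :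
    (i : ℤ) * ((p - 1 : ℕ) : ℤ) + p + r * p = n - i := by
  rw [hn, h, Nat.cast_sub hp]
  push_cast
  ring

/-- The element `η_i(x, y) ∈ Λ^i(A) ⊗ Γ_{n-i}(A)`, for `x = (x_1, …, x_{i+1})`,
`y = (y_1, …, y_r)`, `m = i + 1 + r` and `n = p m`: the sum over `t` of the terms `(-1)^t`
times `x_1 ∧ ⋯ ∧ x̂_t ∧ ⋯ ∧ x_{i+1}` tensor
`(∏_{s ≠ t} γ_{p-1}(x_s)) γ_p(x_t) γ_p(y_1) ⋯ γ_p(y_r)`, with `t` counted from `1` in this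
formula and from `0` in the code. -/
def eta {p n m i r : ℕ} (hp : 0 < p) (hn : n = p * m) (h : m = i + 1 + r)
    (x : Fin (i + 1) → A) (y : Fin r → A) : (dualDeRham R A n).X i :=
  show ⋀[R]^i A ⊗[R] gammaPow R A ((n : ℤ) - i) from
  ∑ t : Fin (i + 1), (-1 : ℤ) ^ ((t : ℕ) + 1) •
    (exteriorPower.ιMulti R i (fun j => x (t.succAbove j)) ⊗ₜ[R]
      (⟨(∏ j : Fin i, DividedPowerAlgebra.dp R (p - 1) (x (t.succAbove j))) *
          DividedPowerAlgebra.dp R p (x t) * ∏ j : Fin r, DividedPowerAlgebra.dp R p (y j), by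
        have := mul_mem_gammaPow (mul_mem_gammaPow
          (prod_mem_gammaPow fun j : Fin i => dp_mem (R := R) (p - 1) (x (t.succAbove j)))
          (dp_mem p (x t))) (prod_mem_gammaPow fun j : Fin r => dp_mem p (y j))
        rwa [eta_degree hp hn h] at this⟩ : gammaPow R A ((n : ℤ) - i)))

end DeRham

/-! ### Symmetric powers and their derived functors -/

section Derived

open Opposite AlgebraicTopology.DoldKan Simplicial

variable {R : Type} [CommRing R]

variable (R) in
/-- `SP^m(M)`: the degree `m` part of the symmetric algebra. -/
def symPow (m : ℕ) (M : Type u) [AddCommGroup M] [Module R M] :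
    Submodule R (SymmetricAlgebra R M) :=
  LinearMap.range (SymmetricAlgebra.ι R M) ^ m

/-- The map of symmetric algebras induced by a linear map. -/
def symMap {M N : Type u} [AddCommGroup M] [Module R M] [AddCommGroup N] [Module R N]
    (f : M →ₗ[R] N) : SymmetricAlgebra R M →ₐ[R] SymmetricAlgebra R N :=
  SymmetricAlgebra.lift (SymmetricAlgebra.ι R N ∘ₗ f)

@[simp]
lemma symMap_ι {M N : Type u} [AddCommGroup M] [Module R M] [AddCommGroup N] [Module R N]
    (f : M →ₗ[R] N) (a : M) :
    symMap f (SymmetricAlgebra.ι R M a) = SymmetricAlgebra.ι R N (f a) := by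
  simp [symMap]

lemma symMap_mem {m : ℕ} {M N : Type u} [AddCommGroup M] [Module R M] [AddCommGroup N]
    [Module R N] (f : M →ₗ[R] N) {z : SymmetricAlgebra R M} (hz : z ∈ symPow R m M) :
    symMap f z ∈ symPow R m N := by
  have h : (symPow R m M).map (symMap f).toLinearMap ≤ symPow R m N := by
    rw [symPow, Submodule.map_pow]
    refine pow_le_pow_left' ?_ m
    rintro _ ⟨_, ⟨a, rfl⟩, rfl⟩
    exact ⟨f a, by simp⟩
  exact h ⟨z, hz, rfl⟩

variable (R) in
/-- The functor `SP^m` on `R`-modules. -/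
def SP (m : ℕ) : ModuleCat.{u} R ⥤ ModuleCat.{u} R where
  obj M := ModuleCat.of R (symPow R m M)
  map f := ModuleCat.ofHom ((symMap f.hom).toLinearMap.restrict fun _ hz => symMap_mem f.hom hz)
  map_id M := by
    have h : symMap (LinearMap.id : M →ₗ[R] M) = AlgHom.id R _ :=
      SymmetricAlgebra.algHom_ext (by ext; simp)
    refine ModuleCat.hom_ext (LinearMap.ext fun z => Subtype.ext ?_)
    exact congrArg (fun φ => φ z.1) h
  map_comp {M N L} f g := by
    have h : symMap (g.hom ∘ₗ f.hom) = (symMap g.hom).comp (symMap f.hom) :=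
      SymmetricAlgebra.algHom_ext (by ext; simp)
    refine ModuleCat.hom_ext (LinearMap.ext fun z => Subtype.ext ?_)
    exact congrArg (fun φ => φ z.1) h

/-- The chain complex associated to the simplicial module `F(K C)`, where `K` is the Dold-Kan
functor, from chain complexes to simplicial modules. -/
def doldPuppe (F : ModuleCat.{u} R ⥤ ModuleCat.{u} R) (C : ChainComplex (ModuleCat.{u} R) ℕ) :
    ChainComplex (ModuleCat.{u} R) ℕ :=
  (AlgebraicTopology.alternatingFaceMapComplex (ModuleCat.{u} R)).obj
    (((SimplicialObject.whiskering _ _).obj F).obj (Γ₀.obj C))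

/-- The derived functor `L_i F(Z) = π_i(F(K P))` of Dold and Puppe, computed with a projective
resolution `P` of `Z`. The functor `F` need not be additive. -/
def derived (F : ModuleCat.{u} R ⥤ ModuleCat.{u} R) {Z : ModuleCat.{u} R}
    (P : ProjectiveResolution Z) (i : ℕ) : ModuleCat.{u} R :=
  (doldPuppe F P.complex).homology i

/-! The symbols `β_h`. -/

variable (C : ChainComplex (ModuleCat.{u} R) ℕ)

/-- The inclusion of `C_n` as the nondegenerate summand of `(K C)_n`. -/
def incl (n : ℕ) : C.X n ⟶ Γ₀.obj C _⦋n⦌ :=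
  (Γ₀.splitting C).ι n

/-- The map `C_0 → (K C)_i` given by the iterated degeneracy. -/
def degZero (i : ℕ) : C.X 0 ⟶ Γ₀.obj C _⦋i⦌ :=
  incl C 0 ≫ (Γ₀.obj C).map (SimplexCategory.const ⦋i⦌ ⦋0⦌ 0).op

/-- The monotone map `[i] → [1]` sending `j` to `0` if `j < b` and to `1` otherwise. -/
def cut (i b : ℕ) : ⦋i⦌ ⟶ ⦋1⦌ :=
  SimplexCategory.mkHom
    { toFun := fun j => if (j : ℕ) < b then 0 else 1
      monotone' := fun j k hjk => by
        have : (j : ℕ) ≤ k := hjk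
        dsimp only
        split_ifs <;> first | omega | simp }

/-- The `b`-th iterated degeneracy `C_1 → (K C)_i`, for `1 ≤ b ≤ i`: the degeneracy along the
map `[i] → [1]` that jumps from `b - 1` to `b`. -/
def degOne (i b : ℕ) : C.X 1 ⟶ Γ₀.obj C _⦋i⦌ :=
  incl C 1 ≫ (Γ₀.obj C).map (cut i b).op

variable {C}

/-- The matrix with rows indexed by `k`, whose column `0` is the image of `a_k` under the iterated
degeneracy, and whose column `b ≥ 1` is the image of `e_k` under the `b`-th degeneracy. -/
def betaMatrix {i : ℕ} (a : Fin (i + 1) → C.X 0) (e : Fin (i + 1) → C.X 1) :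
    Matrix (Fin (i + 1)) (Fin (i + 1)) (SymmetricAlgebra R (Γ₀.obj C _⦋i⦌)) :=
  Matrix.of fun k => Fin.cons (SymmetricAlgebra.ι R _ ((degZero C i).hom (a k)))
    (fun b : Fin i => SymmetricAlgebra.ι R _ ((degOne C i (b + 1)).hom (e k)))

lemma betaMatrix_mem {i : ℕ} (a : Fin (i + 1) → C.X 0) (e : Fin (i + 1) → C.X 1)
    (k l : Fin (i + 1)) :
    betaMatrix a e k l ∈ LinearMap.range (SymmetricAlgebra.ι R (Γ₀.obj C _⦋i⦌)) := by
  refine Fin.cases ?_ (fun b => ?_) l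
  · exact ⟨_, rfl⟩
  · exact ⟨_, rfl⟩

lemma prod_mem_pow {S : Type u} [CommRing S] [Algebra R S] (V : Submodule R S) {k : ℕ}
    (z : Fin k → S) (hz : ∀ j, z j ∈ V) : ∏ j, z j ∈ V ^ k := by
  induction k with
  | zero => simpa using ⟨1, map_one _⟩
  | succ k ih =>
    rw [Fin.prod_univ_succ, pow_succ']
    exact Submodule.mul_mem_mul (hz 0) (ih _ fun j => hz j.succ)

/-- The chain representing `β_h(x_1, …, x_{i+1}) ⊗ y_1 ⋯ y_r`. Let `C` be a projective resolution
of `B`, and let `x_k ∈ B` with `h x_k = 0`. Choose `a_k ∈ C_0` over `x_k` and `e_k ∈ C_1` with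
`∂ e_k = h a_k`. The element `τ_h(x_1, …, x_{i+1})` of `H_i(C ⊗ ⋯ ⊗ C)` is the class of the cycle
`h⁻¹ ∂(e_1 ⊗ ⋯ ⊗ e_{i+1}) = ∑ t, (-1)^{t-1} e_1 ⊗ ⋯ ⊗ a_t ⊗ ⋯ ⊗ e_{i+1}`, and
`β_h(x_1, …, x_{i+1}) ∈ L_i SP^{i+1}(B)` is its image under the shuffle map followed by the
projection from the tensor power to `SP^{i+1}`. The shuffle of `i` elements of degree `1` is the
alternating sum over all orders of the degeneracies, so this image is the determinant of
`betaMatrix a e`, expanded along column `0`. It is then multiplied by the degeneracies of the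
elements `a'_j ∈ C_0` over `y_j ∈ B`; here `m = i + 1 + r`. -/
def betaChain {m i r : ℕ} (h : m = i + 1 + r) (a : Fin (i + 1) → C.X 0)
    (e : Fin (i + 1) → C.X 1) (a' : Fin r → C.X 0) : (doldPuppe (SP R m) C).X i :=
  show symPow R m (Γ₀.obj C _⦋i⦌) from
  ⟨(betaMatrix a e).det * ∏ j, SymmetricAlgebra.ι R _ ((degZero C i).hom (a' j)), by
    rw [h, symPow, pow_add]
    refine Submodule.mul_mem_mul ?_ (prod_mem_pow _ _ fun j => ⟨_, rfl⟩)
    rw [Matrix.det_apply]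
    exact Submodule.sum_mem _ fun σ _ => Submodule.smul_of_tower_mem _ _
      (prod_mem_pow _ _ fun j => betaMatrix_mem a e _ _)⟩

lemma cut_zero (i : ℕ) :
    cut i 0 = SimplexCategory.const ⦋i⦌ ⦋0⦌ 0 ≫ SimplexCategory.δ 0 := by
  ext j
  simp [cut, SimplexCategory.δ]

lemma cut_last (i : ℕ) :
    cut i (i + 1) = SimplexCategory.const ⦋i⦌ ⦋0⦌ 0 ≫ SimplexCategory.δ 1 := by
  ext j
  have : (j : ℕ) < i + 1 := j.is_lt
  simp [cut, SimplexCategory.δ]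
  omega

lemma δ_cut (i b : ℕ) (k : Fin (i + 2)) :
    SimplexCategory.δ k ≫ cut (i + 1) b = cut i (if b ≤ k then b else b - 1) := by
  ext j
  have h : ((k.succAbove j : Fin (i + 2)) : ℕ) < b ↔
      (j : ℕ) < (if b ≤ k then b else b - 1) := by
    rw [Fin.succAbove]
    split_ifs with h1 h2 h2 <;> rw [Fin.lt_def] at h1 <;> simp at h1 ⊢ <;> omega
  change ((if ((k.succAbove j : Fin (i + 2)) : ℕ) < b then (0 : Fin 2) else 1 : Fin 2) : ℕ) =
    ((if (j : ℕ) < (if b ≤ k then b else b - 1) then (0 : Fin 2) else 1 : Fin 2) : ℕ)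
  simp only [h]

lemma incl_zero : incl C 1 ≫ (Γ₀.obj C).map (SimplexCategory.δ (0 : Fin 2)).op =
    C.d 1 0 ≫ incl C 0 := by
  have h := Γ₀.Obj.mapMono_on_summand_id C (SimplexCategory.δ (0 : Fin 2))
  rw [Γ₀.Obj.Termwise.mapMono_δ₀, SimplicialObject.Splitting.cofan_inj_id,
    SimplicialObject.Splitting.cofan_inj_id] at h
  exact h

lemma incl_one : incl C 1 ≫ (Γ₀.obj C).map (SimplexCategory.δ (1 : Fin 2)).op = 0 := by
  have h := Γ₀.Obj.mapMono_on_summand_id C (SimplexCategory.δ (1 : Fin 2))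
  rw [Γ₀.Obj.Termwise.mapMono_eq_zero _ _ (by
      intro h; simpa using congrArg SimplexCategory.len h) (by rw [Isδ₀.iff]; decide),
    SimplicialObject.Splitting.cofan_inj_id] at h
  exact h.trans Limits.zero_comp

lemma degZero_face (i : ℕ) (k : Fin (i + 2)) :
    degZero C (i + 1) ≫ (Γ₀.obj C).δ k = degZero C i := by
  rw [degZero, Category.assoc, SimplicialObject.δ, ← Functor.map_comp]
  rfl

lemma degOne_face (i b : ℕ) (k : Fin (i + 2)) :
    degOne C (i + 1) b ≫ (Γ₀.obj C).δ k = degOne C i (if b ≤ k then b else b - 1) := by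
  rw [degOne, Category.assoc, SimplicialObject.δ, ← Functor.map_comp, ← op_comp, δ_cut]
  rfl

lemma degOne_zero (i : ℕ) : degOne C i 0 = C.d 1 0 ≫ degZero C i := by
  rw [degOne, degZero, cut_zero, op_comp, Functor.map_comp, ← Category.assoc, ← Category.assoc,
    incl_zero]

lemma degOne_last (i : ℕ) : degOne C i (i + 1) = 0 := by
  rw [degOne, cut_last, op_comp, Functor.map_comp, ← Category.assoc, incl_one, Limits.zero_comp]

/-- If `∂ e_k = c a_k` for all `k`, then all faces of `betaChain` vanish. -/
lemma betaChain_face {m i r : ℕ} (h : m = (i + 1) + 1 + r) (a : Fin (i + 1 + 1) → C.X 0)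
    (e : Fin (i + 1 + 1) → C.X 1) (a' : Fin r → C.X 0) (c : R)
    (he : ∀ k, (C.d 1 0).hom (e k) = c • a k) (k : Fin (i + 2)) :
    ((((SimplicialObject.whiskering _ _).obj (SP R m)).obj (Γ₀.obj C)).δ k).hom
      (betaChain h a e a') = 0 := by
  let φ := symMap ((Γ₀.obj C).δ k).hom
  have h0 (x : C.X 0) : φ (SymmetricAlgebra.ι R _ ((degZero C (i + 1)).hom x)) =
      SymmetricAlgebra.ι R _ ((degZero C i).hom x) := by
    rw [symMap_ι, ← degZero_face i k]; rfl
  have h1 (b : ℕ) (x : C.X 1) : φ (SymmetricAlgebra.ι R _ ((degOne C (i + 1) b).hom x)) =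
      SymmetricAlgebra.ι R _ ((degOne C i (if b ≤ k then b else b - 1)).hom x) := by
    rw [symMap_ι, ← degOne_face i b k]; rfl
  let N := φ.mapMatrix (betaMatrix a e)
  have hN0 (q) : N q 0 = SymmetricAlgebra.ι R _ ((degZero C i).hom (a q)) := h0 _
  have hN1 (q) (b : Fin (i + 1)) : N q b.succ = SymmetricAlgebra.ι R _
      ((degOne C i (if (b : ℕ) + 1 ≤ k then (b : ℕ) + 1 else b)).hom (e q)) := h1 _ _
  have hdet : φ (betaMatrix a e).det = 0 := by
    rw [AlgHom.map_det]
    change N.det = 0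
    rcases Nat.eq_zero_or_pos (k : ℕ) with hk | hk
    · have hcol (q) : N q (Fin.succ 0) = c • N q 0 := by
        rw [hN0, hN1, if_neg (by simp [hk]), ← map_smul, ← map_smul, ← he q]
        refine congrArg _ ?_
        exact congrArg (fun f => f.hom (e q)) (degOne_zero i)
      have hN : N = N.updateCol (Fin.succ 0) (algebraMap R (SymmetricAlgebra R (Γ₀.obj C _⦋i⦌)) c • fun q => N q 0) := by
        ext q l
        rw [Matrix.updateCol_apply]
        split_ifs with hl
        · rw [hl, hcol, Pi.smul_apply, algebraMap_smul]
        · rfl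
      rw [hN, Matrix.det_updateCol_smul,
        Matrix.det_zero_of_column_eq (i := Fin.succ 0) (j := 0) (Fin.succ_ne_zero _), mul_zero]
      intro q
      rw [Matrix.updateCol_self, Matrix.updateCol_ne (Fin.succ_ne_zero _).symm]
    · rcases Nat.lt_or_ge (k : ℕ) (i + 1) with hk' | hk'
      · refine Matrix.det_zero_of_column_eq (i := Fin.succ ⟨k - 1, by omega⟩)
          (j := Fin.succ ⟨k, hk'⟩) (by simp [Fin.ext_iff]; omega) fun q => ?_
        rw [hN1, hN1, if_pos (by dsimp only; omega), if_neg (by dsimp only; omega)]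
        dsimp only
        rw [Nat.sub_add_cancel hk]
      · refine Matrix.det_eq_zero_of_column_eq_zero (Fin.succ (Fin.last i)) fun q => ?_
        rw [hN1, if_pos (by simpa using hk'), Fin.val_last, degOne_last]
        exact map_zero _
  refine Subtype.ext ?_
  change φ ((betaMatrix a e).det * _) = 0
  rw [map_mul, hdet, zero_mul]

lemma alternating_sum_eq_zero {M N : ModuleCat.{u} R} {n : ℕ} (f : Fin n → (M ⟶ N)) (z : M)
    (hz : ∀ k, (f k).hom z = 0) : (∑ k : Fin n, (-1 : ℤ) ^ (k : ℕ) • f k).hom z = 0 := by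
  rw [ModuleCat.hom_sum, LinearMap.sum_apply]
  refine Finset.sum_eq_zero fun k _ => ?_
  rw [ModuleCat.hom_zsmul, LinearMap.smul_apply, hz, smul_zero]

/-- If `∂ e_k = c a_k` for all `k`, then `betaChain` is a cycle. -/
lemma betaChain_cycle {m i r : ℕ} (h : m = i + 1 + r) (a : Fin (i + 1) → C.X 0)
    (e : Fin (i + 1) → C.X 1) (a' : Fin r → C.X 0) (c : R)
    (he : ∀ k, (C.d 1 0).hom (e k) = c • a k) (j : ℕ) :
    ((doldPuppe (SP R m) C).d i j).hom (betaChain h a e a') = 0 := by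
  by_cases hij : j + 1 = i
  · subst hij
    have hd : (doldPuppe (SP R m) C).d (j + 1) j = _ :=
      AlgebraicTopology.alternatingFaceMapComplex_obj_d _ j
    exact (congrArg (fun g => g.hom (betaChain h a e a')) hd).trans
      (alternating_sum_eq_zero _ _ (betaChain_face h a e a' c he))
  · rw [(doldPuppe (SP R m) C).shape i j hij]
    rfl

/-- The homology class of a cycle. -/
def homologyClass (C : ChainComplex (ModuleCat.{u} R) ℕ) {i : ℕ} (z : C.X i)
    (hz : ∀ j, (C.d i j).hom z = 0) : C.homology i :=
  (C.homologyπ i).hom (C.cyclesMk z ((ComplexShape.down ℕ).next i) rfl (hz _))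

end Derived

/-! ### The standard resolution of `A ⊗ ℤ/p` -/

section Resolution

variable (A : Type u) [AddCommGroup A] (p : ℕ)

/-- The complex `⋯ → 0 → A → A`, with `A` in degrees `0` and `1` and differential multiplication
by `p`. -/
def mulComplex : ChainComplex (ModuleCat.{u} ℤ) ℕ :=
  ChainComplex.of
    (fun | 0 => ModuleCat.of ℤ A | 1 => ModuleCat.of ℤ A | _ + 2 => ModuleCat.of ℤ PUnit.{u + 1})
    (fun | 0 => ModuleCat.ofHom ((p : ℤ) • LinearMap.id) | _ + 1 => 0)
    (fun _ => Limits.zero_comp)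

/-- Reduction modulo `p`, as a map `A → A ⊗ ℤ/p`. -/
def red : A →ₗ[ℤ] A ⊗[ℤ] ZMod p :=
  (TensorProduct.mk ℤ A (ZMod p)).flip 1

variable {A p}

lemma mulComplex_d (e : A) : ((mulComplex A p).d 1 0).hom e = (p : ℤ) • e := by
  have h : (mulComplex A p).d 1 0 = ModuleCat.ofHom ((p : ℤ) • LinearMap.id) := by
    dsimp only [mulComplex, ChainComplex.of]
    exact ChainComplex.of_d _ _ 0
  rw [h]
  rfl

lemma red_surjective : Function.Surjective (red A p) := by
  intro z
  induction z with
  | zero => exact ⟨0, map_zero _⟩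
  | add z w hz hw =>
    obtain ⟨a, rfl⟩ := hz
    obtain ⟨b, rfl⟩ := hw
    exact ⟨a + b, map_add _ _ _⟩
  | tmul a c =>
    obtain ⟨c, rfl⟩ := ZMod.intCast_surjective c
    refine ⟨c • a, ?_⟩
    rw [map_smul]
    change c • (a ⊗ₜ[ℤ] (1 : ZMod p)) = _
    rw [← TensorProduct.tmul_smul, zsmul_one]

lemma red_eq_zero_iff (a : A) : red A p a = 0 ↔ ∃ b : A, (p : ℤ) • b = a := by
  constructor
  · intro h
    let f : ℤ →ₗ[ℤ] ℤ := (p : ℤ) • LinearMap.id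
    let g : ℤ →ₗ[ℤ] ZMod p := (Int.castAddHom (ZMod p)).toIntLinearMap
    have hfg : Function.Exact f g := fun z => by
      change ((z : ZMod p) = 0) ↔ ∃ y : ℤ, (p : ℤ) • y = z
      rw [ZMod.intCast_zmod_eq_zero_iff_dvd]
      exact ⟨fun ⟨y, hy⟩ => ⟨y, hy.symm⟩, fun ⟨y, hy⟩ => ⟨y, hy.symm⟩⟩
    have hex := lTensor_exact A hfg ZMod.intCast_surjective
    have h' : LinearMap.lTensor A g (a ⊗ₜ 1) = 0 := by
      rw [LinearMap.lTensor_tmul]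
      exact (congrArg (fun c => a ⊗ₜ[ℤ] c) (Int.cast_one (R := ZMod p))).trans h
    obtain ⟨t, ht⟩ := (hex _).1 h'
    refine ⟨TensorProduct.rid ℤ A t, ?_⟩
    have ht' : LinearMap.lTensor A f t = (p : ℤ) • t := by
      simp only [f, LinearMap.lTensor_smul, LinearMap.lTensor_id, LinearMap.smul_apply,
        LinearMap.id_apply]
    rw [← map_smul, ← ht', ht]
    simp
  · rintro ⟨b, rfl⟩
    rw [map_smul]
    change (p : ℤ) • (b ⊗ₜ[ℤ] (1 : ZMod p)) = _
    rw [← TensorProduct.tmul_smul, zsmul_one]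
    simp

variable (A p) in
/-- For `A` free, the complex `A → A` given by multiplication by `p` is a projective resolution
of `A ⊗ ℤ/p`. -/
def resolution [Module.Free ℤ A] [NeZero p] :
    ProjectiveResolution (ModuleCat.of ℤ (A ⊗[ℤ] ZMod p)) where
  complex := mulComplex A p
  projective
    | 0 => show Projective (ModuleCat.of ℤ A) from
        (IsProjective.iff_projective A).1 inferInstance
    | 1 => show Projective (ModuleCat.of ℤ A) from
        (IsProjective.iff_projective A).1 inferInstance
    | _ + 2 => show Projective (ModuleCat.of ℤ PUnit.{u + 1}) from
        (IsProjective.iff_projective PUnit.{u + 1}).1 inferInstance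
  π := ((mulComplex A p).toSingle₀Equiv _).symm ⟨ModuleCat.ofHom (red A p), by
    refine ModuleCat.hom_ext (LinearMap.ext fun a => ?_)
    exact (congrArg (red A p) (mulComplex_d a)).trans ((red_eq_zero_iff _).2 ⟨a, rfl⟩)⟩
  quasiIso := ⟨fun n => by
    cases n with
    | zero =>
      rw [ChainComplex.quasiIsoAt₀_iff, ShortComplex.quasiIso_iff_of_zeros' _ rfl rfl rfl]
      constructor
      · rw [ShortComplex.moduleCat_exact_iff]
        intro a ha
        obtain ⟨b, hb⟩ := (red_eq_zero_iff (p := p) (A := A) a).1 ha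
        exact ⟨b, (mulComplex_d b).trans hb⟩
      · rw [ModuleCat.epi_iff_surjective]
        exact red_surjective
    | succ n =>
      rw [quasiIsoAt_iff_exactAt' (hL := ChainComplex.exactAt_succ_single_obj ..),
          HomologicalComplex.exactAt_iff' _ (n + 2) (n + 1) n (by simp) (by simp)]
      rw [ShortComplex.moduleCat_exact_iff]
      intro a ha
      cases n with
      | zero =>
        have : Module.IsTorsionFree ℤ A := inferInstance
        have ha' : (p : ℤ) • (show A from a) = 0 := (mulComplex_d a).symm.trans ha
        refine ⟨0, (map_zero _).trans ?_⟩
        exact ((smul_eq_zero.1 ha').resolve_left (by exact_mod_cast NeZero.ne p)).symm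
      | succ n => exact ⟨0, (map_zero _).trans (Subsingleton.elim (α := PUnit) _ _)⟩⟩

variable (p) in
/-- The class `β_p(x̄_1, …, x̄_{i+1}) ⊗ ȳ_1 ⋯ ȳ_r` in `L_i SP^m(A ⊗ ℤ/p)`, for `m = i + 1 + r`,
written with lifts `x_k`, `y_j` to `A` of the elements `x̄_k`, `ȳ_j` of `A ⊗ ℤ/p`. -/
def betaClass [Module.Free ℤ A] [NeZero p] {m i r : ℕ} (h : m = i + 1 + r)
    (x : Fin (i + 1) → A) (y : Fin r → A) : derived (SP ℤ m) (resolution A p) i :=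
  homologyClass (doldPuppe (SP ℤ m) (mulComplex A p))
    (betaChain (C := mulComplex A p) h x x y)
    (betaChain_cycle (C := mulComplex A p) h x x y (p : ℤ) fun k => mulComplex_d (x k))

end Resolution
end
end DualDeRham

open DualDeRham

/-! The classes of η are Bocksteins. Put ω(x; y) = x_1 ∧ ⋯ ∧ x_i ⊗ ∏ γ_{p-1}(x_s) ∏ γ_p(y_t). Since
x γ_{p-1}(x) = p γ_p(x), one has dω = p η (`diff_omega`). For A free, Λ ⊗ Γ is torsion-free, so p
may be cancelled: p dη = ddω = 0 gives the cycle condition, and p times the Jacobi combination is dη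
in the next degree, hence zero. Moreover ω is additive in every variable modulo p and boundaries
(`omega_add_left_mem`, `omega_add_right_mem`), and if a combination of ω's is dw + pθ, then the same
combination of η's is dθ. So [η] is multilinear, alternating in x, symmetric in y and killed by p.
With S = Sym(A), a polynomial ring, it extends to a map `etaHom` on S ⊗ Λ^{i+1}(A) which kills
multiples of p and, by Jacobi, Koszul boundaries.

It remains to see that these are all the relations among the symbols. The simplicial ring Sym K(A →
A) is the polynomial model `PolyLevel` with faces `polyFace p`. Determinants of linear forms give a
chain map `koszulToPoly` to it from the Koszul complex S ⊗ Λ(A), whose differential ∂ is replaced by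
p∂. If p is replaced by 1, both complexes are resolutions of ℤ, so the mapping cone is an exact
complex of free S-modules, hence contractible. The cone for p is the base change of that one along x
↦ px on S, and a contraction survives base change, although the two complexes are no longer exact.

Consequently every cycle is, up to a boundary, the image of some w with p∂w = 0; then ∂w = 0, and in
positive weight w = ∂t. So t ↦ [image of ∂t], which takes tensors of linear forms and wedges to
symbols β_p, is surjective (`betaHom_surjective`); this gives uniqueness. If the class of ∂t
vanishes, then ∂t = p∂v, so t is a Koszul boundary plus pv, and `etaHom` kills t
(`etaHom_eq_zero_of_betaHom_eq_zero`); this gives existence. Both maps kill multiples of p, whence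
the independence of lifts. -/

namespace DualDeRham

noncomputable section

open CategoryTheory

/-! ### Homology of a complex of modules as cycles modulo boundaries. -/

section Homology

variable {R : Type} [CommRing R] (C : ChainComplex (ModuleCat.{u} R) ℕ)

/-- The submodule of cycles of degree `i`. -/
def cycleSubmodule (i : ℕ) : Submodule R (C.X i) :=
  ⨅ j, LinearMap.ker (C.d i j).hom

variable {C}

lemma mem_cycleSubmodule {i : ℕ} {z : C.X i} :
    z ∈ cycleSubmodule C i ↔ ∀ j, (C.d i j).hom z = 0 := by
  simp [cycleSubmodule]

lemma iCycles_cyclesMk {i j : ℕ} (z : C.X i) (hj : (ComplexShape.down ℕ).next i = j)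
    (hz : (C.d i j).hom z = 0) : (C.iCycles i).hom (C.cyclesMk z j hj hz) = z :=
  C.i_cyclesMk z j hj hz

lemma iCycles_injective (i : ℕ) : Function.Injective (C.iCycles i).hom :=
  (ModuleCat.mono_iff_injective _).1 inferInstance

variable (C) in
/-- The homology class as a linear map on the submodule of cycles. -/
def classMap (i : ℕ) : cycleSubmodule C i →ₗ[R] C.homology i where
  toFun z := homologyClass C z.1 (mem_cycleSubmodule.1 z.2)
  map_add' z w := by
    rw [homologyClass, homologyClass, homologyClass, ← map_add]
    congr 1
    apply iCycles_injective
    rw [map_add, iCycles_cyclesMk, iCycles_cyclesMk, iCycles_cyclesMk]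
    rfl
  map_smul' c z := by
    rw [homologyClass, homologyClass, RingHom.id_apply, ← map_smul]
    congr 1
    apply iCycles_injective
    rw [map_smul, iCycles_cyclesMk, iCycles_cyclesMk]
    rfl

lemma classMap_apply {i : ℕ} (z : C.X i) (hz : ∀ j, (C.d i j).hom z = 0) :
    classMap C i ⟨z, mem_cycleSubmodule.2 hz⟩ = homologyClass C z hz := rfl

lemma classMap_surjective (i : ℕ) : Function.Surjective (classMap C i) := by
  intro c
  have hsurj : Function.Surjective (C.homologyπ i).hom :=
    (ModuleCat.epi_iff_surjective _).1 inferInstance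
  obtain ⟨x, rfl⟩ := hsurj c
  have hz : ∀ j, (C.d i j).hom ((C.iCycles i).hom x) = 0 := fun j => by
    rw [← LinearMap.comp_apply, ← ModuleCat.hom_comp, C.iCycles_d]
    rfl
  refine ⟨⟨_, mem_cycleSubmodule.2 hz⟩, ?_⟩
  rw [classMap_apply _ hz, homologyClass]
  congr 1
  apply iCycles_injective
  rw [iCycles_cyclesMk]

/-- Needed in both directions: boundaries give relations between classes, and a vanishing class must
yield an actual bounding chain. -/
lemma classMap_eq_zero_iff {i : ℕ} (z : cycleSubmodule C i) :
    classMap C i z = 0 ↔ ∃ w : C.X (i + 1), (C.d (i + 1) i).hom w = z.1 := by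
  have h1 : ∀ x : C.cycles i, (C.homologyπ i).hom x = 0 ↔
      ∃ w : C.X (i + 1), (C.d (i + 1) i).hom w = (C.iCycles i).hom x := by
    intro x
    have hp : (ComplexShape.down ℕ).prev i = i + 1 := by simp
    constructor
    · intro hx
      have h := congrArg (fun f => f.hom x) (C.sc i).π_moduleCatCyclesIso_hom
      have h2 : Submodule.Quotient.mk (p := LinearMap.range (C.sc i).moduleCatToCycles)
          ((C.sc i).moduleCatCyclesIso.hom.hom x) = 0 := by
        refine h.symm.trans ?_
        exact (congrArg (C.sc i).moduleCatHomologyIso.hom.hom hx).trans (map_zero _)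
      obtain ⟨w, hw⟩ := (Submodule.Quotient.mk_eq_zero _).1 h2
      have h3 : (C.iCycles i).hom x = ((C.sc i).moduleCatCyclesIso.hom.hom x).1 :=
        (congrArg (fun f => f.hom x) (C.sc i).moduleCatCyclesIso_hom_i).symm
      rw [h3, ← hw]
      -- The incoming term of the short complex sits at `prev i`, which equals i + 1 only up to a
      -- proved equation; generalising the index allows substitution.
      have : ∀ (j : ℕ) (_ : j = i + 1) (w : C.X j), ∃ w' : C.X (i + 1),
          (C.d (i + 1) i).hom w' = (C.d j i).hom w := by
        rintro _ rfl w
        exact ⟨w, rfl⟩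
      exact this _ hp w
    · rintro ⟨w, hw⟩
      have : x = (C.toCycles (i + 1) i).hom w := by
        apply iCycles_injective
        rw [← hw]
        exact (congrArg (fun f => f.hom w) (C.toCycles_i (i + 1) i)).symm
      rw [this]
      exact congrArg (fun f => f.hom w) (C.toCycles_comp_homologyπ (i + 1) i)
  obtain ⟨z, hz⟩ := z
  change (C.homologyπ i).hom _ = 0 ↔ _
  rw [h1, iCycles_cyclesMk]

end Homology

/-! ### Torsion-freeness of Λ ⊗ Γ. -/

section Torsion

open MvPolynomial

variable {A : Type u} [AddCommGroup A] [Module.Free ℤ A]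

/-- The divided power algebra of a free abelian group has no torsion: it embeds into a polynomial
ring over `ℚ`, by `γ_n(a) ↦ a^n / n!`. -/
lemma dividedPowerAlgebra_smul_eq_zero {c : ℤ} (hc : c ≠ 0) {X : DividedPowerAlgebra ℤ A}
    (hX : c • X = 0) : X = 0 := by
  classical
  let κ := Module.Free.ChooseBasisIndex ℤ A
  let b : Module.Basis κ ℤ A := Module.Free.chooseBasis ℤ A
  let g : A →ₗ[ℤ] MvPolynomial κ ℚ := b.constr ℤ fun i => MvPolynomial.X i
  have hg (i : κ) : g (b i) = MvPolynomial.X i := b.constr_basis ℤ _ i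
  let φ : DividedPowerAlgebra ℤ A →ₐ[ℤ] MvPolynomial κ ℚ :=
    DividedPowerAlgebra.lift (DividedPowers.RatAlgebra.dividedPowers (⊤ : Ideal (MvPolynomial κ ℚ)))
      g fun _ => Submodule.mem_top
  have hφ (n : ℕ) (a : A) :
      φ (DividedPowerAlgebra.dp ℤ n a) = ((n.factorial : ℚ)⁻¹) • g a ^ n := by
    rw [DividedPowerAlgebra.lift_apply_dp,
      DividedPowers.RatAlgebra.dpow_eq_inv_fact_smul _ _ Submodule.mem_top, Ring.inverse_eq_inv']
  let v (s : κ →₀ ℕ) : DividedPowerAlgebra ℤ A :=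
    s.prod fun i k => DividedPowerAlgebra.dp ℤ k (b i)
  have hv (s : κ →₀ ℕ) : φ (v s) = (∏ i ∈ s.support, ((s i).factorial : ℚ)⁻¹) •
      monomial s (1 : ℚ) := by
    rw [monomial_eq, map_one, one_mul]
    simp only [v, Finsupp.prod, map_prod, hφ, hg, Finset.prod_smul]
  have hX' : X ∈ Submodule.span ℤ (Set.range v) := by
    rw [DividedPowerAlgebra.submodule_span_prod_dp_eq_top b.span_eq]
    exact Submodule.mem_top
  -- The divided monomials `v s` span the algebra, and φ sends them to nonzero rational multiples of
  -- distinct monomials; hence φ is injective.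
  have hinj : LinearMap.ker (φ.toLinearMap.domRestrict (Submodule.span ℤ (Set.range v))) = ⊥ := by
    rw [LinearMap.ker_eq_bot']
    rintro ⟨Y, hY⟩ h0
    obtain ⟨l, rfl⟩ := (Finsupp.mem_span_range_iff_exists_finsupp).1 hY
    have h1 : (l.sum fun s a => a • φ (v s)) = 0 := by
      have h1 : φ (l.sum fun s a => a • v s) = 0 := h0
      rw [Finsupp.sum, map_sum] at h1
      simpa only [map_zsmul, Finsupp.sum] using h1
    have : l = 0 := by
      ext t
      have h2 := congrArg (coeff t) h1
      rw [Finsupp.sum, coeff_sum, coeff_zero, Finset.sum_eq_single t] at h2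
      · rw [hv, ← Int.cast_smul_eq_zsmul ℚ, coeff_smul, coeff_smul, coeff_monomial, if_pos rfl,
          smul_eq_mul, smul_eq_mul, mul_one, mul_eq_zero] at h2
        have h3 := h2.resolve_right
          (Finset.prod_ne_zero_iff.2 fun i _ => inv_ne_zero (by positivity))
        exact_mod_cast h3
      · intro s _ hst
        rw [hv, ← Int.cast_smul_eq_zsmul ℚ, coeff_smul, coeff_smul, coeff_monomial, if_neg hst,
          smul_zero, smul_zero]
      · intro ht
        rw [Finsupp.notMem_support_iff.1 ht, zero_smul, coeff_zero]
    subst this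
    simp
  have h0 : φ X = 0 := by
    have h : c • φ X = 0 := by rw [← map_zsmul, hX, map_zero]
    exact (smul_eq_zero.1 h).resolve_left hc
  have := LinearMap.ker_eq_bot'.1 hinj ⟨X, hX'⟩ h0
  exact congrArg Subtype.val this

/-- Multiplication by c is injective on Γ_d(A), and tensoring with the flat module Λ^i(A) preserves
injectivity. -/
lemma tensor_gammaPow_smul_eq_zero {i : ℕ} {d : ℤ} {c : ℤ} (hc : c ≠ 0)
    {z : ⋀[ℤ]^i A ⊗[ℤ] gammaPow ℤ A d} (hz : c • z = 0) : z = 0 := by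
  have hinj : Function.Injective (c • (LinearMap.id : gammaPow ℤ A d →ₗ[ℤ] gammaPow ℤ A d)) := by
    rw [← LinearMap.ker_eq_bot, LinearMap.ker_eq_bot']
    intro X hX
    exact Subtype.ext (dividedPowerAlgebra_smul_eq_zero hc (congrArg Subtype.val hX))
  have h := Module.Flat.lTensor_preserves_injective_linearMap (M := ⋀[ℤ]^i A) _ hinj
  refine h ?_
  rw [map_zero, LinearMap.lTensor_smul, LinearMap.lTensor_id]
  exact hz

end Torsion

/-! ### Additivity of x ⊗ γ_{p-1}(x) and of γ_p modulo p and boundaries. -/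

section Decomposable

variable {A : Type u} [AddCommGroup A]

open DividedPowerAlgebra

/-- The element `v_1 ∧ ⋯ ∧ v_i ⊗ X` of `Λ^i(A) ⊗ Γ_d(A)`. -/
def wedgeTmul {i : ℕ} {d : ℤ} (v : Fin i → A) (X : DividedPowerAlgebra ℤ A)
    (hX : X ∈ gammaPow ℤ A d) : ⋀[ℤ]^i A ⊗[ℤ] gammaPow ℤ A d :=
  exteriorPower.ιMulti ℤ i v ⊗ₜ ⟨X, hX⟩

lemma embed_mul_mem {d e : ℤ} (h : d + 1 = e) (a : A) {X : DividedPowerAlgebra ℤ A}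
    (hX : X ∈ gammaPow ℤ A d) : embed ℤ A a * X ∈ gammaPow ℤ A e := by
  rw [← h, add_comm]
  exact mul_mem_gammaPow (dp_mem 1 a) hX

lemma diff_wedgeTmul {i : ℕ} {d e : ℤ} (h : d + 1 = e) (v : Fin (i + 1) → A)
    (X : DividedPowerAlgebra ℤ A) (hX : X ∈ gammaPow ℤ A d) :
    diff i h (wedgeTmul v X hX) = ∑ k : Fin (i + 1), (-1 : ℤ) ^ ((k : ℕ) + 1) •
      wedgeTmul (fun j => v (k.succAbove j)) (embed ℤ A (v k) * X) (embed_mul_mem h _ hX) :=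
  diff_apply i h v ⟨X, hX⟩

variable {i : ℕ} {d : ℤ}

lemma wedgeTmul_congr (v : Fin i → A) {X Y : DividedPowerAlgebra ℤ A} (h : X = Y)
    (hX : X ∈ gammaPow ℤ A d) : wedgeTmul v X hX = wedgeTmul v Y (h ▸ hX) := by
  subst h; rfl

lemma wedgeTmul_smul (c : ℤ) (v : Fin i → A) {X : DividedPowerAlgebra ℤ A}
    (hX : X ∈ gammaPow ℤ A d) :
    wedgeTmul v (c • X) (Submodule.smul_mem _ c hX) = c • wedgeTmul v X hX :=
  TensorProduct.tmul_smul c _ (⟨X, hX⟩ : gammaPow ℤ A d)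

lemma wedgeTmul_sum {ι : Type*} (s : Finset ι) (v : Fin i → A) (X : ι → DividedPowerAlgebra ℤ A)
    (hX : ∀ k, X k ∈ gammaPow ℤ A d) :
    wedgeTmul v (∑ k ∈ s, X k) (sum_mem fun k _ => hX k) = ∑ k ∈ s, wedgeTmul v (X k) (hX k) := by
  simp only [wedgeTmul, ← TensorProduct.tmul_sum]
  congr 1
  exact Subtype.ext (by simp)

lemma wedgeTmul_cons_add (a b : A) (v : Fin i → A) {X : DividedPowerAlgebra ℤ A}
    (hX : X ∈ gammaPow ℤ A d) :
    wedgeTmul (Fin.cons (a + b) v : Fin (i + 1) → A) X hX =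
      wedgeTmul (Fin.cons a v : Fin (i + 1) → A) X hX +
        wedgeTmul (Fin.cons b v : Fin (i + 1) → A) X hX := by
  rw [wedgeTmul, wedgeTmul, wedgeTmul, ← TensorProduct.add_tmul]
  congr 1
  exact (exteriorPower.ιMulti ℤ (i + 1)).toMultilinearMap.cons_add v a b

/-- Boundaries plus multiples of `p` in `Λ^i(A) ⊗ Γ_d(A)`. -/
def boundaryMod (A : Type u) [AddCommGroup A] (p i : ℕ) (d : ℤ) :
    Submodule ℤ (⋀[ℤ]^i A ⊗[ℤ] gammaPow ℤ A d) :=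
  LinearMap.range (diff (R := ℤ) (A := A) i (sub_add_cancel d 1)) ⊔
    LinearMap.range ((p : ℤ) • (LinearMap.id : ⋀[ℤ]^i A ⊗[ℤ] gammaPow ℤ A d →ₗ[ℤ] _))

lemma smul_mem_boundaryMod (p : ℕ) (z : ⋀[ℤ]^i A ⊗[ℤ] gammaPow ℤ A d) :
    (p : ℤ) • z ∈ boundaryMod A p i d :=
  Submodule.mem_sup_right ⟨z, rfl⟩

lemma diff_mem_boundaryMod (p : ℕ) {e : ℤ} (h : e + 1 = d)
    (z : ⋀[ℤ]^(i + 1) A ⊗[ℤ] gammaPow ℤ A e) : diff i h z ∈ boundaryMod A p i d := by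
  obtain rfl : e = d - 1 := by omega
  exact Submodule.mem_sup_left ⟨z, rfl⟩

/-- Bézout: multiples of p already lie in the submodule, so an integer prime to p acts invertibly
modulo it. -/
lemma mem_boundaryMod_of_smul_mem {p k : ℕ} (hk : k.Coprime p)
    {z : ⋀[ℤ]^i A ⊗[ℤ] gammaPow ℤ A d} (hz : (k : ℤ) • z ∈ boundaryMod A p i d) :
    z ∈ boundaryMod A p i d := by
  have h : z = (k.gcdA p) • (k : ℤ) • z + (k.gcdB p) • (p : ℤ) • z := by
    rw [smul_smul, smul_smul, ← add_smul, mul_comm _ (k : ℤ), mul_comm _ (p : ℤ),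
      ← Nat.gcd_eq_gcd_ab, hk.gcd_eq_one, Nat.cast_one, one_smul]
  rw [h]
  exact add_mem (Submodule.smul_mem _ _ hz) (Submodule.smul_mem _ _ (smul_mem_boundaryMod p z))

/-- Disposes of the terms of a differential in which a passive variable x_s is contracted: Y
contains γ_{p-1}(x_s), so x_s Y is a multiple of p. -/
lemma wedgeTmul_mem_boundaryMod {p : ℕ} (v : Fin i → A) (a : A) (G Y : DividedPowerAlgebra ℤ A)
    {e f : ℤ} (hG : G ∈ gammaPow ℤ A f) (hf : f + (e + 1) = d)
    (hY : ∃ Y' ∈ gammaPow ℤ A (e + 1), embed ℤ A a * Y = (p : ℤ) • Y')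
    (h : embed ℤ A a * (G * Y) ∈ gammaPow ℤ A d) :
    wedgeTmul v (embed ℤ A a * (G * Y)) h ∈ boundaryMod A p i d := by
  obtain ⟨Y', hY', h1⟩ := hY
  have h2 : embed ℤ A a * (G * Y) = (p : ℤ) • (G * Y') := by
    rw [mul_left_comm, h1, mul_smul_comm]
  have h3 : G * Y' ∈ gammaPow ℤ A d := hf ▸ mul_mem_gammaPow hG hY'
  rw [wedgeTmul_congr v h2, wedgeTmul_smul _ _ h3]
  exact smul_mem_boundaryMod _ _

lemma embed_mul_dp (a : A) (k : ℕ) :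
    embed ℤ A a * dp ℤ k a = ((k + 1 : ℕ) : ℤ) • dp ℤ (k + 1) a := by
  rw [embed_def, dp_mul, add_comm 1 k, Nat.choose_one_right, natCast_zsmul]

lemma dp_mul_dp_mul_mem (a b : A) (j l : ℕ) {e : ℤ} {Y : DividedPowerAlgebra ℤ A}
    (hY : Y ∈ gammaPow ℤ A e) (h : (j : ℤ) + l + e = d) :
    dp ℤ j a * dp ℤ l b * Y ∈ gammaPow ℤ A d :=
  h ▸ mul_mem_gammaPow (mul_mem_gammaPow (dp_mem j a) (dp_mem l b)) hY

/-- The element `v_1 ∧ ⋯ ∧ v_i ⊗ γ_j(a) γ_l(b) Y` of `Λ^i(A) ⊗ Γ_d(A)`, and `0` if the degrees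
do not match. -/
def mixedTmul (d : ℤ) (v : Fin i → A) (a b : A) (Y : DividedPowerAlgebra ℤ A) (j l : ℕ) :
    ⋀[ℤ]^i A ⊗[ℤ] gammaPow ℤ A d :=
  open Classical in
  if h : dp ℤ j a * dp ℤ l b * Y ∈ gammaPow ℤ A d then wedgeTmul v _ h else 0

lemma mixedTmul_eq {v : Fin i → A} {a b : A} {Y : DividedPowerAlgebra ℤ A} {j l : ℕ}
    (h : dp ℤ j a * dp ℤ l b * Y ∈ gammaPow ℤ A d) :
    mixedTmul d v a b Y j l = wedgeTmul v _ h :=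
  dif_pos h

lemma wedgeTmul_eq_smul_mixedTmul {v : Fin i → A} {a b : A} {Y Z : DividedPowerAlgebra ℤ A}
    {j l : ℕ} {c : ℤ} (hZ : Z ∈ gammaPow ℤ A d) (h : dp ℤ j a * dp ℤ l b * Y ∈ gammaPow ℤ A d)
    (hc : Z = c • (dp ℤ j a * dp ℤ l b * Y)) :
    wedgeTmul v Z hZ = c • mixedTmul d v a b Y j l := by
  rw [wedgeTmul_congr _ hc, wedgeTmul_smul _ _ h, mixedTmul_eq h]

lemma wedgeTmul_dp_add (v : Fin i → A) (a b : A) {e : ℤ} {Y : DividedPowerAlgebra ℤ A}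
    (hYe : Y ∈ gammaPow ℤ A e) (n : ℕ) (hd : (n : ℤ) + e = d)
    (h : dp ℤ n (a + b) * Y ∈ gammaPow ℤ A d) :
    wedgeTmul v (dp ℤ n (a + b) * Y) h =
      ∑ q ∈ Finset.HasAntidiagonal.antidiagonal n, mixedTmul d v a b Y q.1 q.2 := by
  -- The terms have the right degree only because the two exponents add up to n, so the sum runs
  -- over the attached antidiagonal, which carries that equation.
  have h1 : dp ℤ n (a + b) * Y = ∑ q ∈ (Finset.HasAntidiagonal.antidiagonal n).attach,
      dp ℤ q.1.1 a * dp ℤ q.1.2 b * Y := by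
    rw [dp_add, Finset.sum_mul,
      Finset.sum_attach _ (fun q : ℕ × ℕ => dp ℤ q.1 a * dp ℤ q.2 b * Y)]
  have h2 (q : {q // q ∈ Finset.HasAntidiagonal.antidiagonal n}) :
      dp ℤ q.1.1 a * dp ℤ q.1.2 b * Y ∈ gammaPow ℤ A d := by
    refine dp_mul_dp_mul_mem a b _ _ hYe ?_
    have := Finset.HasAntidiagonal.mem_antidiagonal.1 q.2
    omega
  rw [wedgeTmul_congr _ h1, wedgeTmul_sum _ _ _ h2,
    ← Finset.sum_attach (Finset.HasAntidiagonal.antidiagonal n)]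
  exact Finset.sum_congr rfl fun q _ => (mixedTmul_eq (h2 q)).symm

/-- `x ⊗ γ_{p-1}(x)` is additive in `x`, modulo `p` and boundaries: the correction terms. -/
lemma mixedTmul_add_mixedTmul_mem {p : ℕ} (hp : p.Prime) (x : Fin i → A) {e : ℤ}
    {Y : DividedPowerAlgebra ℤ A} (hYe : Y ∈ gammaPow ℤ A e)
    (hY : ∀ s, ∃ Y' ∈ gammaPow ℤ A (e + 1), embed ℤ A (x s) * Y = (p : ℤ) • Y')
    (a b : A) {j l : ℕ} (h : j + 1 + (l + 1) = p) (hd : (j : ℤ) + (l + 1) + e = d) :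
    mixedTmul d (Fin.cons a x : Fin (i + 1) → A) a b Y j (l + 1) +
      mixedTmul d (Fin.cons b x : Fin (i + 1) → A) a b Y (j + 1) l ∈
        boundaryMod A p (i + 1) d := by
  refine mem_boundaryMod_of_smul_mem (k := j + 1)
    (Nat.coprime_of_lt_prime (by omega) (by omega) hp).symm ?_
  -- Differentiating a ∧ b ∧ x ⊗ γ_j(a) γ_l(b) Y gives, modulo p, −(j+1) V + (l+1) U, where U and V
  -- are the two terms of the claim. As l + 1 = p − (j+1), this is −(j+1)(U + V) modulo p, and j + 1
  -- is prime to p.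
  have hW : dp ℤ j a * dp ℤ l b * Y ∈ gammaPow ℤ A (d - 1) :=
    dp_mul_dp_mul_mem a b j l hYe (by rw [← hd]; ring)
  have h1 := diff_wedgeTmul (sub_add_cancel d 1)
    (Fin.cons a (Fin.cons b x) : Fin (i + 2) → A) _ hW
  rw [Fin.sum_univ_succ, Fin.sum_univ_succ,
    wedgeTmul_eq_smul_mixedTmul (a := a) (b := b) (Y := Y) (j := j + 1) (l := l) (d := d)
      (Z := embed ℤ A ((Fin.cons a (Fin.cons b x) : Fin (i + 2) → A) 0) * _)
      (c := ((j + 1 : ℕ) : ℤ)) _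
      (dp_mul_dp_mul_mem a b _ _ hYe (by rw [← hd]; push_cast; ring)) (by
        rw [Fin.cons_zero, ← mul_assoc, ← mul_assoc, embed_mul_dp, smul_mul_assoc,
          smul_mul_assoc]),
    wedgeTmul_eq_smul_mixedTmul (a := a) (b := b) (Y := Y) (j := j) (l := l + 1) (d := d)
      (Z := embed ℤ A ((Fin.cons a (Fin.cons b x) : Fin (i + 2) → A) (Fin.succ 0)) * _)
      (c := ((l + 1 : ℕ) : ℤ)) _
      (dp_mul_dp_mul_mem a b _ _ hYe (by rw [← hd]; push_cast; ring)) (by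
        rw [Fin.cons_succ, Fin.cons_zero, ← mul_assoc, mul_left_comm, embed_mul_dp,
          mul_smul_comm, smul_mul_assoc])] at h1
  have h5 : (fun t => (Fin.cons a (Fin.cons b x) : Fin (i + 2) → A)
      ((0 : Fin (i + 1)).succ.succAbove t)) = Fin.cons a x := by
    funext t
    refine Fin.cases ?_ (fun t => ?_) t <;> simp
  have h6 : (fun t => (Fin.cons a (Fin.cons b x) : Fin (i + 2) → A)
      ((0 : Fin (i + 2)).succAbove t)) = Fin.cons b x := by
    funext t
    simp
  rw [h5, h6] at h1
  generalize mixedTmul d (Fin.cons a x : Fin (i + 1) → A) a b Y j (l + 1) = U at h1 ⊢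
  generalize mixedTmul d (Fin.cons b x : Fin (i + 1) → A) a b Y (j + 1) l = V at h1 ⊢
  have h7 : ((j + 1 : ℕ) : ℤ) • (U + V) = (p : ℤ) • U -
      ((-1 : ℤ) ^ (((0 : Fin (i + 2)) : ℕ) + 1) • ((j + 1 : ℕ) : ℤ) • V +
        (-1 : ℤ) ^ (((0 : Fin (i + 1)).succ : ℕ) + 1) • ((l + 1 : ℕ) : ℤ) • U) := by
    rw [← h]
    simp only [Fin.val_zero, Fin.val_succ]
    push_cast
    module
  rw [h7]
  refine sub_mem (smul_mem_boundaryMod _ _) ?_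
  rw [← sub_eq_of_eq_add (h1.trans (add_assoc _ _ _).symm)]
  refine sub_mem (diff_mem_boundaryMod _ (sub_add_cancel d 1) _)
    (Submodule.sum_mem _ fun s _ => ?_)
  refine Submodule.smul_mem _ _ (wedgeTmul_mem_boundaryMod _ _ _ _
    (mul_mem_gammaPow (dp_mem j a) (dp_mem l b)) (e := e) ?_ (hY s) _)
  rw [← hd]; ring

/-- `x ⊗ γ_{p-1}(x)` is additive in `x`, modulo `p` and boundaries. -/
lemma wedgeTmul_add_left_mem {p q : ℕ} (hp : p.Prime) (hq : q + 1 = p) (x : Fin i → A) {e : ℤ}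
    {Y : DividedPowerAlgebra ℤ A} (hYe : Y ∈ gammaPow ℤ A e)
    (hY : ∀ s, ∃ Y' ∈ gammaPow ℤ A (e + 1), embed ℤ A (x s) * Y = (p : ℤ) • Y')
    (a b : A) (hm : ∀ c : A, dp ℤ q c * Y ∈ gammaPow ℤ A d) (hd : (q : ℤ) + e = d) :
    wedgeTmul (Fin.cons (a + b) x : Fin (i + 1) → A) (dp ℤ q (a + b) * Y) (hm _) -
      wedgeTmul (Fin.cons a x : Fin (i + 1) → A) (dp ℤ q a * Y) (hm _) -
      wedgeTmul (Fin.cons b x : Fin (i + 1) → A) (dp ℤ q b * Y) (hm _) ∈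
        boundaryMod A p (i + 1) d := by
  obtain ⟨n, rfl⟩ : ∃ n, q = n + 1 := ⟨q - 1, by have := hp.two_le; omega⟩
  -- Both sums of γ_j(a) γ_l(b) are expanded. In the one with a in the wedge the term l = 0 cancels,
  -- in the one with b the term j = 0; the rest is paired as (j, l+1) with (j+1, l).
  rw [wedgeTmul_cons_add, wedgeTmul_dp_add _ _ _ hYe _ hd, wedgeTmul_dp_add _ _ _ hYe _ hd,
    Finset.Nat.sum_antidiagonal_succ', Finset.Nat.sum_antidiagonal_succ,
    wedgeTmul_eq_smul_mixedTmul (a := a) (b := b) (Y := Y) (j := n + 1) (l := 0) (c := 1)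
      (hm a) (by rw [dp_zero, mul_one]; exact hm a) (by rw [dp_zero, mul_one, one_smul]),
    wedgeTmul_eq_smul_mixedTmul (a := a) (b := b) (Y := Y) (j := 0) (l := n + 1) (c := 1)
      (hm b) (by rw [dp_zero, one_mul]; exact hm b) (by rw [dp_zero, one_mul, one_smul]),
    one_smul, one_smul, show ∀ s t P Q : ⋀[ℤ]^(i + 1) A ⊗[ℤ] gammaPow ℤ A d,
    s + P + (t + Q) - s - t = P + Q by intros; abel, ← Finset.sum_add_distrib]
  refine Submodule.sum_mem _ fun t ht => ?_
  have ht' := Finset.HasAntidiagonal.mem_antidiagonal.1 ht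
  refine mixedTmul_add_mixedTmul_mem hp x hYe hY a b (by omega) ?_
  rw [← hd, ← ht']
  push_cast
  ring

/-- `γ_p` is additive modulo `p` and boundaries: the correction terms. -/
lemma mixedTmul_mem {p : ℕ} (hp : p.Prime) (x : Fin i → A) {e : ℤ}
    {Y : DividedPowerAlgebra ℤ A} (hYe : Y ∈ gammaPow ℤ A e)
    (hY : ∀ s, ∃ Y' ∈ gammaPow ℤ A (e + 1), embed ℤ A (x s) * Y = (p : ℤ) • Y')
    (a b : A) {j l : ℕ} (h : j + 1 + (l + 1) = p) (hd : (j : ℤ) + 1 + (l + 1) + e = d) :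
    mixedTmul d x a b Y (j + 1) (l + 1) ∈ boundaryMod A p i d := by
  refine mem_boundaryMod_of_smul_mem (k := j + 1)
    (Nat.coprime_of_lt_prime (by omega) (by omega) hp).symm ?_
  -- Modulo p, the differential of a ∧ x ⊗ γ_j(a) γ_{l+1}(b) Y is −(j+1) times the term in question,
  -- with j + 1 < p.
  have hW : dp ℤ j a * dp ℤ (l + 1) b * Y ∈ gammaPow ℤ A (d - 1) :=
    dp_mul_dp_mul_mem a b j (l + 1) hYe (by rw [← hd]; push_cast; ring)
  have h1 := diff_wedgeTmul (sub_add_cancel d 1) (Fin.cons a x : Fin (i + 1) → A) _ hW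
  rw [Fin.sum_univ_succ,
    wedgeTmul_eq_smul_mixedTmul (a := a) (b := b) (Y := Y) (j := j + 1) (l := l + 1) (d := d)
      (Z := embed ℤ A ((Fin.cons a x : Fin (i + 1) → A) 0) * _)
      (c := ((j + 1 : ℕ) : ℤ)) _
      (dp_mul_dp_mul_mem a b _ _ hYe (by rw [← hd]; push_cast; ring)) (by
        rw [Fin.cons_zero, ← mul_assoc, ← mul_assoc, embed_mul_dp, smul_mul_assoc,
          smul_mul_assoc])] at h1
  have h6 : (fun t => (Fin.cons a x : Fin (i + 1) → A) ((0 : Fin (i + 1)).succAbove t)) = x := by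
    funext t
    simp
  rw [h6] at h1
  generalize mixedTmul d x a b Y (j + 1) (l + 1) = U at h1 ⊢
  have h7 : (-1 : ℤ) ^ (((0 : Fin (i + 1)) : ℕ) + 1) • ((j + 1 : ℕ) : ℤ) • U =
      -(((j + 1 : ℕ) : ℤ) • U) := by
    simp
  rw [h7] at h1
  rw [← neg_mem_iff, ← sub_eq_of_eq_add h1]
  refine sub_mem (diff_mem_boundaryMod _ (sub_add_cancel d 1) _)
    (Submodule.sum_mem _ fun s _ => ?_)
  refine Submodule.smul_mem _ _ (wedgeTmul_mem_boundaryMod _ _ _ _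
    (mul_mem_gammaPow (dp_mem j a) (dp_mem (l + 1) b)) (e := e) ?_ (hY s) _)
  rw [← hd]; push_cast; ring

/-- `γ_p` is additive modulo `p` and boundaries. -/
lemma wedgeTmul_add_right_mem {p : ℕ} (hp : p.Prime) (x : Fin i → A) {e : ℤ}
    {Y : DividedPowerAlgebra ℤ A} (hYe : Y ∈ gammaPow ℤ A e)
    (hY : ∀ s, ∃ Y' ∈ gammaPow ℤ A (e + 1), embed ℤ A (x s) * Y = (p : ℤ) • Y')
    (a b : A) (hm : ∀ c : A, dp ℤ p c * Y ∈ gammaPow ℤ A d) (hd : (p : ℤ) + e = d) :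
    wedgeTmul x (dp ℤ p (a + b) * Y) (hm _) - wedgeTmul x (dp ℤ p a * Y) (hm _) -
      wedgeTmul x (dp ℤ p b * Y) (hm _) ∈ boundaryMod A p i d := by
  obtain ⟨n, rfl⟩ : ∃ n, p = n + 2 := ⟨p - 2, by have := hp.two_le; omega⟩
  rw [wedgeTmul_dp_add _ _ _ hYe _ hd,
    Finset.Nat.sum_antidiagonal_succ', Finset.Nat.sum_antidiagonal_succ,
    wedgeTmul_eq_smul_mixedTmul (a := a) (b := b) (Y := Y) (j := n + 2) (l := 0) (c := 1)
      (hm a) (by rw [dp_zero, mul_one]; exact hm a) (by rw [dp_zero, mul_one, one_smul]),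
    wedgeTmul_eq_smul_mixedTmul (a := a) (b := b) (Y := Y) (j := 0) (l := n + 2) (c := 1)
      (hm b) (by rw [dp_zero, one_mul]; exact hm b) (by rw [dp_zero, one_mul, one_smul]),
    one_smul, one_smul, show ∀ s t P : ⋀[ℤ]^i A ⊗[ℤ] gammaPow ℤ A d,
    s + (t + P) - s - t = P by intros; abel]
  refine Submodule.sum_mem _ fun t ht => ?_
  have ht' := Finset.HasAntidiagonal.mem_antidiagonal.1 ht
  refine mixedTmul_mem hp x hYe hY a b (by omega) ?_
  rw [← hd, ← ht']
  push_cast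
  ring

end Decomposable

/-! ### The elements ω, and η as (1/p) dω. -/

section Eta

variable {A : Type u} [AddCommGroup A]

open DividedPowerAlgebra

/-- The product `∏ γ_{p-1}(x_s) ∏ γ_p(y_t)`. -/
def dpProd (p : ℕ) {i s : ℕ} (x : Fin i → A) (y : Fin s → A) : DividedPowerAlgebra ℤ A :=
  (∏ j, dp ℤ (p - 1) (x j)) * ∏ j, dp ℤ p (y j)

lemma dpProd_mem {p i s : ℕ} (x : Fin i → A) (y : Fin s → A) {d : ℤ}
    (h : (i : ℤ) * ((p - 1 : ℕ) : ℤ) + s * p = d) : dpProd p x y ∈ gammaPow ℤ A d :=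
  h ▸ mul_mem_gammaPow (prod_mem_gammaPow fun j => dp_mem (p - 1) (x j))
    (prod_mem_gammaPow fun j => dp_mem p (y j))

lemma dpProd_insertNth_left {p i s : ℕ} (k : Fin (i + 1)) (c : A) (x : Fin i → A)
    (y : Fin s → A) : dpProd p (k.insertNth c x : Fin (i + 1) → A) y =
      dp ℤ (p - 1) c * dpProd p x y := by
  rw [dpProd, Fin.prod_univ_succAbove _ k, Fin.insertNth_apply_same, dpProd, mul_assoc]
  simp only [Fin.insertNth_apply_succAbove]

lemma dpProd_insertNth_right {p i s : ℕ} (k : Fin (s + 1)) (c : A) (x : Fin i → A)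
    (y : Fin s → A) : dpProd p x (k.insertNth c y : Fin (s + 1) → A) =
      dp ℤ p c * dpProd p x y := by
  rw [dpProd, Fin.prod_univ_succAbove _ k, Fin.insertNth_apply_same, dpProd, mul_left_comm]
  simp only [Fin.insertNth_apply_succAbove]

/-- x γ_{p-1}(x) = p γ_p(x): contracting x_k moves it from the x-family to the y-family and yields
the factor p. -/
lemma embed_mul_dpProd {p i s : ℕ} (hp : 0 < p) (k : Fin (i + 1)) (x : Fin (i + 1) → A)
    (y : Fin s → A) : embed ℤ A (x k) * dpProd p x y =
      (p : ℤ) • dpProd p (fun j => x (k.succAbove j)) (Fin.cons (x k) y : Fin (s + 1) → A) := by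
  have h1 : x = k.insertNth (x k) fun j => x (k.succAbove j) := by
    rw [Fin.eq_insertNth_iff]; exact ⟨rfl, rfl⟩
  have h2 : (Fin.cons (x k) y : Fin (s + 1) → A) = (0 : Fin (s + 1)).insertNth (x k) y :=
    (Fin.insertNth_zero' _ _).symm
  conv_lhs => rw [h1]
  rw [Fin.insertNth_apply_same, dpProd_insertNth_left, h2, dpProd_insertNth_right, ← mul_assoc,
    embed_mul_dp, Nat.sub_add_cancel hp, smul_mul_assoc]

lemma exists_embed_mul_dpProd {p i s : ℕ} (hp : 0 < p) (x : Fin i → A) (y : Fin s → A) {e : ℤ}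
    (h : (i : ℤ) * ((p - 1 : ℕ) : ℤ) + s * p = e) (k : Fin i) :
    ∃ Y' ∈ gammaPow ℤ A (e + 1), embed ℤ A (x k) * dpProd p x y = (p : ℤ) • Y' := by
  cases i with
  | zero => exact k.elim0
  | succ i =>
    refine ⟨_, dpProd_mem _ _ ?_, embed_mul_dpProd hp k x y⟩
    rw [← h, Nat.cast_sub hp]
    push_cast
    ring

variable {p n m i s : ℕ}

lemma omega_degree (hp : 0 < p) (hn : n = p * m) (h : m = i + s) :
    (i : ℤ) * ((p - 1 : ℕ) : ℤ) + s * p = n - i := by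
  rw [hn, h, Nat.cast_sub hp]
  push_cast
  ring

/-- The element `x_1 ∧ ⋯ ∧ x_i ⊗ ∏ γ_{p-1}(x_s) ∏ γ_p(y_t)`. -/
def omega (hp : 0 < p) (hn : n = p * m) (h : m = i + s) (x : Fin i → A) (y : Fin s → A) :
    ⋀[ℤ]^i A ⊗[ℤ] gammaPow ℤ A ((n : ℤ) - i) :=
  wedgeTmul x (dpProd p x y) (dpProd_mem x y (omega_degree hp hn h))

/-- The element `η_i` as a combination of elements `ω_i`. -/
def etaSum (hp : 0 < p) (hn : n = p * m) (h : m = i + 1 + s) (x : Fin (i + 1) → A)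
    (y : Fin s → A) : ⋀[ℤ]^i A ⊗[ℤ] gammaPow ℤ A ((n : ℤ) - i) :=
  ∑ t : Fin (i + 1), (-1 : ℤ) ^ ((t : ℕ) + 1) •
    omega hp hn (show m = i + (s + 1) by omega) (fun j => x (t.succAbove j))
      (Fin.cons (x t) y : Fin (s + 1) → A)

lemma eta_eq_etaSum (hp : 0 < p) (hn : n = p * m) (h : m = i + 1 + s) (x : Fin (i + 1) → A)
    (y : Fin s → A) : eta (R := ℤ) hp hn h x y = etaSum hp hn h x y := by
  refine Finset.sum_congr rfl fun t _ => congrArg _ ?_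
  refine congrArg (fun X => exteriorPower.ιMulti ℤ i (fun j => x (t.succAbove j)) ⊗ₜ[ℤ] X)
    (Subtype.ext ?_)
  change _ * _ * _ = dpProd p _ _
  rw [dpProd, Fin.prod_univ_succ, mul_assoc]
  simp only [Fin.cons_zero, Fin.cons_succ]

lemma wedgeTmul_eq_smul {d : ℤ} {v : Fin i → A} {X Z : DividedPowerAlgebra ℤ A} {c : ℤ}
    (hZ : Z ∈ gammaPow ℤ A d) (hX : X ∈ gammaPow ℤ A d) (hc : Z = c • X) :
    wedgeTmul v Z hZ = c • wedgeTmul v X hX := by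
  rw [wedgeTmul_congr _ hc, wedgeTmul_smul _ _ hX]

/-- Each contraction of ω produces a factor p and leaves exactly one term of η. All algebraic
properties of η are read off from ω through this identity. -/
lemma diff_omega (hp : 0 < p) (hn : n = p * m) (h : m = i + 1 + s) (x : Fin (i + 1) → A)
    (y : Fin s → A) (hd : (n : ℤ) - ((i + 1 : ℕ) : ℤ) + 1 = n - i) :
    diff i hd (omega hp hn h x y) = (p : ℤ) • etaSum hp hn h x y := by
  rw [etaSum, Finset.smul_sum, omega, diff_wedgeTmul]
  refine Finset.sum_congr rfl fun k _ => ?_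
  have hm : dpProd p (fun j => x (k.succAbove j)) (Fin.cons (x k) y : Fin (s + 1) → A) ∈
      gammaPow ℤ A ((n : ℤ) - i) :=
    dpProd_mem _ _ (omega_degree hp hn (by omega))
  have h1 := wedgeTmul_eq_smul (v := fun j => x (k.succAbove j))
    (embed_mul_mem hd _ (dpProd_mem x y (omega_degree hp hn h))) hm (embed_mul_dpProd hp k x y)
  exact (congrArg _ h1).trans (smul_comm _ _ _)

lemma sub_succ_add_one (n i : ℕ) : (n : ℤ) - ((i + 1 : ℕ) : ℤ) + 1 = n - i := by
  push_cast; ring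

lemma dualDeRham_d (n i : ℕ) : (dualDeRham ℤ A n).d (i + 1) i =
    ModuleCat.ofHom (diff (R := ℤ) (A := A) i (sub_succ_add_one n i)) := by
  dsimp only [dualDeRham, ChainComplex.of]
  exact ChainComplex.of_d _ _ i

lemma dualDeRham_d_apply (n i : ℕ) (w : (dualDeRham ℤ A n).X (i + 1)) :
    ((dualDeRham ℤ A n).d (i + 1) i).hom w =
      diff (R := ℤ) (A := A) i (sub_succ_add_one n i) w := by
  rw [dualDeRham_d]
  rfl

lemma omega_insertNth_left (hp : 0 < p) (hn : n = p * m) (h : m = i + 1 + s) (k : Fin (i + 1))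
    (c : A) (x : Fin i → A) (y : Fin s → A)
    (hm : dp ℤ (p - 1) c * dpProd p x y ∈ gammaPow ℤ A ((n : ℤ) - ((i + 1 : ℕ) : ℤ))) :
    omega hp hn h (k.insertNth c x : Fin (i + 1) → A) y =
      (-1 : ℤ) ^ (k : ℕ) • wedgeTmul (Fin.cons c x : Fin (i + 1) → A) _ hm := by
  -- Only the wedge sees the position of c, at the price of a sign; the divided power factor is
  -- commutative.
  rw [omega, wedgeTmul_congr _ (dpProd_insertNth_left k c x y), wedgeTmul,
    AlternatingMap.map_insertNth, ← TensorProduct.smul_tmul']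
  rfl

/-- `ω` is additive in each of its first variables, modulo `p` and boundaries. -/
lemma omega_add_left_mem (hp : p.Prime) (hn : n = p * m) (h : m = i + 1 + s) (k : Fin (i + 1))
    (a b : A) (x : Fin i → A) (y : Fin s → A) :
    omega hp.pos hn h (k.insertNth (a + b) x : Fin (i + 1) → A) y -
      omega hp.pos hn h (k.insertNth a x : Fin (i + 1) → A) y -
      omega hp.pos hn h (k.insertNth b x : Fin (i + 1) → A) y ∈
        boundaryMod A p (i + 1) ((n : ℤ) - ((i + 1 : ℕ) : ℤ)) := by
  have hY := dpProd_mem x y (d := (i : ℤ) * ((p - 1 : ℕ) : ℤ) + s * p) rfl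
  have hd : ((p - 1 : ℕ) : ℤ) + ((i : ℤ) * ((p - 1 : ℕ) : ℤ) + s * p) =
      (n : ℤ) - ((i + 1 : ℕ) : ℤ) := by
    rw [← omega_degree hp.pos hn h]; push_cast; ring
  have hm (c : A) : dp ℤ (p - 1) c * dpProd p x y ∈ gammaPow ℤ A ((n : ℤ) - ((i + 1 : ℕ) : ℤ)) :=
    hd ▸ mul_mem_gammaPow (dp_mem _ c) hY
  rw [omega_insertNth_left hp.pos hn h k _ x y (hm _),
    omega_insertNth_left hp.pos hn h k _ x y (hm _),
    omega_insertNth_left hp.pos hn h k _ x y (hm _), ← smul_sub, ← smul_sub]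
  exact Submodule.smul_mem _ _ (wedgeTmul_add_left_mem hp (Nat.sub_add_cancel hp.pos) x hY
    (exists_embed_mul_dpProd hp.pos x y rfl) a b hm hd)

/-- `ω` is additive in each of its last variables, modulo `p` and boundaries. -/
lemma omega_add_right_mem (hp : p.Prime) (hn : n = p * m) (h : m = i + (s + 1)) (k : Fin (s + 1))
    (a b : A) (x : Fin i → A) (y : Fin s → A) :
    omega hp.pos hn h x (k.insertNth (a + b) y : Fin (s + 1) → A) -
      omega hp.pos hn h x (k.insertNth a y : Fin (s + 1) → A) -
      omega hp.pos hn h x (k.insertNth b y : Fin (s + 1) → A) ∈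
        boundaryMod A p i ((n : ℤ) - i) := by
  have hY := dpProd_mem x y (d := (i : ℤ) * ((p - 1 : ℕ) : ℤ) + s * p) rfl
  have hd : (p : ℤ) + ((i : ℤ) * ((p - 1 : ℕ) : ℤ) + s * p) = (n : ℤ) - i := by
    rw [← omega_degree hp.pos hn h]; push_cast; ring
  have hm (c : A) : dp ℤ p c * dpProd p x y ∈ gammaPow ℤ A ((n : ℤ) - i) :=
    hd ▸ mul_mem_gammaPow (dp_mem _ c) hY
  have h1 (c : A) : omega hp.pos hn h x (k.insertNth c y : Fin (s + 1) → A) =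
      wedgeTmul x _ (hm c) :=
    wedgeTmul_congr _ (dpProd_insertNth_right k c x y) _
  rw [h1, h1, h1]
  exact wedgeTmul_add_right_mem hp x hY (exists_embed_mul_dpProd hp.pos x y rfl) a b hm hd

lemma omega_eq_zero_of_eq (hp : 0 < p) (hn : n = p * m) (h : m = i + s) (x : Fin i → A)
    (y : Fin s → A) {k l : Fin i} (hkl : x k = x l) (hne : k ≠ l) : omega hp hn h x y = 0 := by
  rw [omega, wedgeTmul, AlternatingMap.map_eq_zero_of_eq _ _ hkl hne, TensorProduct.zero_tmul]

lemma omega_comp_perm (hp : 0 < p) (hn : n = p * m) (h : m = i + s) (x : Fin i → A)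
    (y : Fin s → A) (σ : Equiv.Perm (Fin s)) :
    omega hp hn h x (y ∘ σ) = omega hp hn h x y :=
  wedgeTmul_congr _ (by
    rw [dpProd, dpProd]; congr 1
    exact Equiv.prod_comp σ fun j => dp ℤ p (y j)) _

/-- The cycles of degree `i` in the dual de Rham complex. -/
def deRhamCycles (A : Type u) [AddCommGroup A] (n i : ℕ) :
    Submodule ℤ (⋀[ℤ]^i A ⊗[ℤ] gammaPow ℤ A ((n : ℤ) - i)) :=
  cycleSubmodule (dualDeRham ℤ A n) i

/-- The homology class of a cycle in the dual de Rham complex. -/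
def deRhamClass (A : Type u) [AddCommGroup A] (n i : ℕ) :
    deRhamCycles A n i →ₗ[ℤ] (dualDeRham ℤ A n).homology i :=
  classMap (dualDeRham ℤ A n) i

lemma deRhamClass_eq_zero {z : deRhamCycles A n i}
    {w : ⋀[ℤ]^(i + 1) A ⊗[ℤ] gammaPow ℤ A ((n : ℤ) - ((i + 1 : ℕ) : ℤ))}
    (hw : diff i (sub_succ_add_one n i) w = z.1) : deRhamClass A n i z = 0 :=
  (classMap_eq_zero_iff _).2 ⟨w, (dualDeRham_d_apply n i w).trans hw⟩

section Free

variable [Module.Free ℤ A]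

/-- Torsion-freeness in the form in which it is used: an identity between η's may be checked after
multiplication by p, where η becomes dω. -/
lemma tensor_gammaPow_smul_injective (hp : 0 < p) {d : ℤ} {z w : ⋀[ℤ]^i A ⊗[ℤ] gammaPow ℤ A d}
    (h : (p : ℤ) • z = (p : ℤ) • w) : z = w := by
  rw [← sub_eq_zero] at h ⊢
  rw [← smul_sub] at h
  exact tensor_gammaPow_smul_eq_zero (by exact_mod_cast hp.ne') h

/-- p dη = d(dω) = 0, and p cancels. -/
lemma diff_etaSum (hp : 0 < p) (hn : n = p * m) (h : m = i + 1 + 1 + s) (x : Fin (i + 1 + 1) → A)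
    (y : Fin s → A) (hd : (n : ℤ) - ((i + 1 : ℕ) : ℤ) + 1 = n - i) :
    diff i hd (etaSum hp hn h x y) = 0 := by
  refine tensor_gammaPow_smul_injective hp ?_
  rw [← map_smul, ← diff_omega hp hn h x y (sub_succ_add_one n (i + 1)), smul_zero]
  exact congrArg (fun f => f (omega hp hn h x y)) (diff_diff (R := ℤ) (A := A) i _ hd)

lemma eta_cycle (hp : 0 < p) (hn : n = p * m) (h : m = i + 1 + s) (x : Fin (i + 1) → A)
    (y : Fin s → A) (j : ℕ) : ((dualDeRham ℤ A n).d i j).hom (eta hp hn h x y) = 0 := by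
  by_cases hij : j + 1 = i
  · subst hij
    rw [eta_eq_etaSum]
    exact (dualDeRham_d_apply n j _).trans (diff_etaSum hp hn h x y _)
  · rw [(dualDeRham ℤ A n).shape i j hij]
    rfl

/-- ω vanishes on a repeated argument because its wedge does, and p η = dω. The alternating property
of η thus holds exactly, not only up to boundaries. -/
lemma etaSum_eq_zero_of_eq (hp : 0 < p) (hn : n = p * m) (h : m = i + 1 + s) (x : Fin (i + 1) → A)
    (y : Fin s → A) {k l : Fin (i + 1)} (hkl : x k = x l) (hne : k ≠ l) :
    etaSum hp hn h x y = 0 := by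
  refine tensor_gammaPow_smul_injective hp ?_
  rw [← diff_omega hp hn h x y (sub_succ_add_one n i), omega_eq_zero_of_eq hp hn h x y hkl hne,
    smul_zero, map_zero]

lemma etaSum_comp_perm (hp : 0 < p) (hn : n = p * m) (h : m = i + 1 + s) (x : Fin (i + 1) → A)
    (y : Fin s → A) (σ : Equiv.Perm (Fin s)) :
    etaSum hp hn h x (y ∘ σ) = etaSum hp hn h x y := by
  refine tensor_gammaPow_smul_injective hp ?_
  rw [← diff_omega hp hn h x _ (sub_succ_add_one n i),
    ← diff_omega hp hn h x y (sub_succ_add_one n i), omega_comp_perm]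

lemma jacobi_degree (h : m = i + 2 + s) : m = i + 1 + (s + 1) := by
  omega

/-- Up to the factor p this is dη = 0 one degree higher: that η is the same alternating sum of
elements ω, each with differential p times the corresponding term here. -/
lemma etaSum_jacobi (hp : 0 < p) (hn : n = p * m) (h : m = i + 2 + s) (x : Fin (i + 2) → A)
    (y : Fin s → A) :
    ∑ k : Fin (i + 2), (-1 : ℤ) ^ ((k : ℕ) + 1) •
      etaSum hp hn (jacobi_degree h)
        (fun j => x (k.succAbove j)) (Fin.cons (x k) y : Fin (s + 1) → A) = 0 := by
  refine tensor_gammaPow_smul_injective hp ?_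
  have h1 := diff_etaSum hp hn (show m = i + 1 + 1 + s by omega) x y (sub_succ_add_one n i)
  rw [etaSum, map_sum] at h1
  rw [smul_zero, Finset.smul_sum, ← h1]
  refine Finset.sum_congr rfl fun k _ => ?_
  rw [map_zsmul, diff_omega, smul_comm]

/-- The Jacobi-type relation between the elements `η_i`. -/
lemma eta_jacobi (hp : 0 < p) (hn : n = p * m) (h : m = i + 2 + s) (x : Fin (i + 2) → A)
    (y : Fin s → A) :
    ∑ k : Fin (i + 2), (-1 : ℤ) ^ ((k : ℕ) + 1) •
      eta (R := ℤ) hp hn (jacobi_degree h)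
        (fun j => x (k.succAbove j)) (Fin.cons (x k) y : Fin (s + 1) → A) = 0 := by
  simp only [eta_eq_etaSum]
  exact etaSum_jacobi hp hn h x y

/-- The Bockstein is well defined: if z = dw + pθ and dz = pv, then p dθ = pv, so v = dθ. -/
lemma exists_diff_eq_of_mem_boundaryMod (hp : 0 < p)
    {z : ⋀[ℤ]^(i + 1) A ⊗[ℤ] gammaPow ℤ A ((n : ℤ) - ((i + 1 : ℕ) : ℤ))}
    (hz : z ∈ boundaryMod A p (i + 1) ((n : ℤ) - ((i + 1 : ℕ) : ℤ)))
    {v : ⋀[ℤ]^i A ⊗[ℤ] gammaPow ℤ A ((n : ℤ) - i)}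
    (hv : diff i (sub_succ_add_one n i) z = (p : ℤ) • v) :
    ∃ w, diff (R := ℤ) (A := A) i (sub_succ_add_one n i) w = v := by
  obtain ⟨_, ⟨w, rfl⟩, _, ⟨θ, rfl⟩, rfl⟩ := Submodule.mem_sup.1 hz
  refine ⟨θ, tensor_gammaPow_smul_injective hp ?_⟩
  have h0 := congrArg (fun f => f w) (diff_diff (R := ℤ) (A := A) i
    (sub_add_cancel ((n : ℤ) - ((i + 1 : ℕ) : ℤ)) 1) (sub_succ_add_one n i))
  rw [LinearMap.comp_apply, LinearMap.zero_apply] at h0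
  rw [← hv, ← map_smul]
  exact ((map_add _ _ _).trans ((congrArg (· + _) h0).trans (zero_add _))).symm

lemma etaSum_mem_deRhamCycles (hp : 0 < p) (hn : n = p * m) (h : m = i + 1 + s)
    (x : Fin (i + 1) → A) (y : Fin s → A) : etaSum hp hn h x y ∈ deRhamCycles A n i := by
  rw [← eta_eq_etaSum]
  exact mem_cycleSubmodule.2 (eta_cycle hp hn h x y)

variable (hp : p.Prime) (hn : n = p * m) (h : m = i + 1 + s)

/-- The homology class of `η_i`. -/
def etaClass (x : Fin (i + 1) → A) (y : Fin s → A) : (dualDeRham ℤ A n).homology i :=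
  deRhamClass A n i ⟨etaSum hp.pos hn h x y, etaSum_mem_deRhamCycles hp.pos hn h x y⟩

lemma homologyClass_eta (x : Fin (i + 1) → A) (y : Fin s → A)
    (hz : ∀ j, ((dualDeRham ℤ A n).d i j).hom (eta hp.pos hn h x y) = 0) :
    homologyClass (dualDeRham ℤ A n) (eta hp.pos hn h x y) hz = etaClass hp hn h x y :=
  congrArg (deRhamClass A n i) (Subtype.ext (eta_eq_etaSum hp.pos hn h x y) :
    (⟨eta hp.pos hn h x y, mem_cycleSubmodule.2 hz⟩ : deRhamCycles A n i) = ⟨_, _⟩)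

lemma etaClass_add_of_mem {x x' x'' : Fin (i + 1) → A} {y y' y'' : Fin s → A}
    (hz : omega hp.pos hn h x y - omega hp.pos hn h x' y' - omega hp.pos hn h x'' y'' ∈
      boundaryMod A p (i + 1) ((n : ℤ) - ((i + 1 : ℕ) : ℤ))) :
    etaClass hp hn h x y = etaClass hp hn h x' y' + etaClass hp hn h x'' y'' := by
  rw [← sub_eq_iff_eq_add', ← sub_eq_zero, etaClass, etaClass, etaClass, ← map_sub, ← map_sub]
  have h1 : diff i (sub_succ_add_one n i) (omega hp.pos hn h x y - omega hp.pos hn h x' y' -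
      omega hp.pos hn h x'' y'') = (p : ℤ) • (etaSum hp.pos hn h x y - etaSum hp.pos hn h x' y' -
      etaSum hp.pos hn h x'' y'') := by
    rw [map_sub, map_sub, diff_omega, diff_omega, diff_omega, smul_sub, smul_sub]
  obtain ⟨w, hw⟩ := exists_diff_eq_of_mem_boundaryMod hp.pos hz h1
  exact deRhamClass_eq_zero (w := w) hw

lemma smul_etaClass (x : Fin (i + 1) → A) (y : Fin s → A) :
    (p : ℤ) • etaClass hp hn h x y = 0 := by
  rw [etaClass, ← map_zsmul]
  exact deRhamClass_eq_zero (w := omega hp.pos hn h x y) (diff_omega hp.pos hn h x y _)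

lemma etaClass_update_add_left (x : Fin (i + 1) → A) (y : Fin s → A) (k : Fin (i + 1)) (a b : A) :
    etaClass hp hn h (Function.update x k (a + b)) y =
      etaClass hp hn h (Function.update x k a) y + etaClass hp hn h (Function.update x k b) y := by
  simp only [← Fin.insertNth_removeNth]
  exact etaClass_add_of_mem hp hn h (omega_add_left_mem hp hn h k a b _ y)

lemma etaClass_update_add_right (x : Fin (i + 1) → A) (y : Fin s → A) (k : Fin s) (a b : A) :
    etaClass hp hn h x (Function.update y k (a + b)) =
      etaClass hp hn h x (Function.update y k a) + etaClass hp hn h x (Function.update y k b) := by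
  cases s with
  | zero => exact k.elim0
  | succ s =>
    simp only [← Fin.insertNth_removeNth]
    exact etaClass_add_of_mem hp hn h (omega_add_right_mem hp hn h k a b x _)

lemma etaClass_eq_zero_of_eq (x : Fin (i + 1) → A) (y : Fin s → A) {k l : Fin (i + 1)}
    (hkl : x k = x l) (hne : k ≠ l) : etaClass hp hn h x y = 0 :=
  deRhamClass_eq_zero (w := 0)
    ((map_zero _).trans (etaSum_eq_zero_of_eq hp.pos hn h x y hkl hne).symm)

lemma etaClass_comp_perm (x : Fin (i + 1) → A) (y : Fin s → A) (σ : Equiv.Perm (Fin s)) :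
    etaClass hp hn h x (y ∘ σ) = etaClass hp hn h x y := by
  simp only [etaClass, etaSum_comp_perm]

end Free

section Jacobi

variable [Module.Free ℤ A] (hp : p.Prime) (hn : n = p * m)

lemma etaClass_jacobi (hJ : m = i + 2 + s) (x : Fin (i + 2) → A) (y : Fin s → A) :
    ∑ k : Fin (i + 2), (-1 : ℤ) ^ (k : ℕ) •
      etaClass hp hn (jacobi_degree hJ)
        (fun j => x (k.succAbove j)) (Fin.cons (x k) y : Fin (s + 1) → A) = 0 := by
  simp only [etaClass, ← map_zsmul]
  rw [← map_sum]
  refine deRhamClass_eq_zero (w := 0) ?_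
  rw [map_zero, ← neg_eq_zero.2 (etaSum_jacobi hp.pos hn hJ x y), ← Finset.sum_neg_distrib,
    AddSubmonoidClass.coe_finsetSum]
  refine Finset.sum_congr rfl fun k _ => ?_
  rw [pow_succ, mul_neg_one, neg_smul, neg_neg]
  rfl

end Jacobi

end Eta

/-! ### The Koszul complex of a polynomial ring over ℤ and its contraction. -/

section Koszul

variable {A : Type u} [AddCommGroup A] {κ : Type u}

open MvPolynomial

/-- The linear form of the polynomial ring `S = ℤ[κ]` attached to an element of `A = ℤ^κ`. -/
def linForm (b : Module.Basis κ ℤ A) : A →ₗ[ℤ] MvPolynomial κ ℤ :=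
  b.constr ℤ fun x => X x

@[simp]
lemma linForm_basis (b : Module.Basis κ ℤ A) (x : κ) : linForm b (b x) = X x :=
  b.constr_basis ℤ _ x

/-- The alternating map giving the Koszul differential. -/
def koszulAlt (b : Module.Basis κ ℤ A) (i : ℕ) :
    A [⋀^Fin (i + 1)]→ₗ[ℤ] MvPolynomial κ ℤ ⊗[ℤ] ⋀[ℤ]^i A :=
  AlternatingMap.alternatizeUncurryFin (R := ℤ) (M := A)
    (N := MvPolynomial κ ℤ ⊗[ℤ] ⋀[ℤ]^i A)
    { toFun := fun a => (TensorProduct.mk ℤ (MvPolynomial κ ℤ) (⋀[ℤ]^i A)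
        (linForm b a)).compAlternatingMap (exteriorPower.ιMulti ℤ i)
      map_add' := fun a a' => AlternatingMap.ext fun w => by
        change linForm b (a + a') ⊗ₜ[ℤ] exteriorPower.ιMulti ℤ i w = linForm b a ⊗ₜ[ℤ] exteriorPower.ιMulti ℤ i w + linForm b a' ⊗ₜ[ℤ] exteriorPower.ιMulti ℤ i w
        rw [map_add, TensorProduct.add_tmul]
      map_smul' := fun c a => AlternatingMap.ext fun w => by
        change linForm b (c • a) ⊗ₜ[ℤ] exteriorPower.ιMulti ℤ i w = c • (linForm b a ⊗ₜ[ℤ] exteriorPower.ιMulti ℤ i w)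
        rw [map_smul, TensorProduct.smul_tmul'] }

/-- The Koszul differential `S ⊗ Λ^{i+1}(A) → S ⊗ Λ^i(A)`. -/
def koszul (b : Module.Basis κ ℤ A) (i : ℕ) :
    MvPolynomial κ ℤ ⊗[ℤ] ⋀[ℤ]^(i + 1) A →ₗ[MvPolynomial κ ℤ]
      MvPolynomial κ ℤ ⊗[ℤ] ⋀[ℤ]^i A :=
  LinearMap.liftBaseChange (MvPolynomial κ ℤ)
    (exteriorPower.alternatingMapLinearEquiv (R := ℤ) (M := A) (koszulAlt b i))

lemma koszul_apply (b : Module.Basis κ ℤ A) (i : ℕ) (s : MvPolynomial κ ℤ)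
    (v : Fin (i + 1) → A) :
    koszul b i (s ⊗ₜ exteriorPower.ιMulti ℤ (i + 1) v) =
      ∑ k : Fin (i + 1), (-1 : ℤ) ^ (k : ℕ) •
        ((s * linForm b (v k)) ⊗ₜ[ℤ] exteriorPower.ιMulti ℤ i fun j => v (k.succAbove j)) := by
  rw [koszul, LinearMap.liftBaseChange_tmul,
    exteriorPower.alternatingMapLinearEquiv_apply_ιMulti, koszulAlt,
    AlternatingMap.alternatizeUncurryFin_apply, Finset.smul_sum]
  refine Finset.sum_congr rfl fun k _ => ?_
  rw [smul_comm]
  rfl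

/-- Linear maps on `S ⊗ Λ^i(A)` agree if they agree on decomposable elements. -/
lemma koszul_hom_ext {N : Type*} [AddCommGroup N] {i : ℕ}
    {f g : MvPolynomial κ ℤ ⊗[ℤ] ⋀[ℤ]^i A →+ N}
    (h : ∀ s v, f (s ⊗ₜ exteriorPower.ιMulti ℤ i v) = g (s ⊗ₜ exteriorPower.ιMulti ℤ i v)) :
    f = g := by
  have h1 : f.toIntLinearMap = g.toIntLinearMap := by
    refine TensorProduct.ext (LinearMap.ext fun s => ?_)
    refine exteriorPower.linearMap_ext (R := ℤ) (M := A) (AlternatingMap.ext fun v => ?_)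
    exact h s v
  ext z
  exact congrArg (fun φ => φ z) h1

lemma koszul_koszul (b : Module.Basis κ ℤ A) (i : ℕ)
    (z : MvPolynomial κ ℤ ⊗[ℤ] ⋀[ℤ]^(i + 2) A) : koszul b i (koszul b (i + 1) z) = 0 := by
  refine congrArg (fun φ : _ →+ _ => φ z) (koszul_hom_ext
    (f := ((koszul b i).comp (koszul b (i + 1))).toAddMonoidHom) (g := 0) fun s v => ?_)
  change koszul b i (koszul b (i + 1) (s ⊗ₜ exteriorPower.ιMulti ℤ (i + 2) v)) = 0
  -- Two successive contractions multiply by two linear forms, symmetrically in the two vectors, so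
  -- their double alternation vanishes.
  let g : A →ₗ[ℤ] A →ₗ[ℤ] A [⋀^Fin i]→ₗ[ℤ] MvPolynomial κ ℤ ⊗[ℤ] ⋀[ℤ]^i A :=
    LinearMap.mk₂ ℤ
      (fun a a' => (TensorProduct.mk ℤ (MvPolynomial κ ℤ) (⋀[ℤ]^i A)
        (s * linForm b a * linForm b a')).compAlternatingMap (exteriorPower.ιMulti ℤ i))
      (fun a a' a'' => AlternatingMap.ext fun w => by
        change (s * linForm b (a + a') * linForm b a'') ⊗ₜ[ℤ] exteriorPower.ιMulti ℤ i w =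
          (s * linForm b a * linForm b a'') ⊗ₜ[ℤ] exteriorPower.ιMulti ℤ i w + (s * linForm b a' * linForm b a'') ⊗ₜ[ℤ] exteriorPower.ιMulti ℤ i w
        rw [map_add, mul_add, add_mul, TensorProduct.add_tmul])
      (fun c a a' => AlternatingMap.ext fun w => by
        change (s * linForm b (c • a) * linForm b a') ⊗ₜ[ℤ] exteriorPower.ιMulti ℤ i w =
          c • ((s * linForm b a * linForm b a') ⊗ₜ[ℤ] exteriorPower.ιMulti ℤ i w)
        rw [map_smul, mul_smul_comm, smul_mul_assoc, TensorProduct.smul_tmul'])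
      (fun a a' a'' => AlternatingMap.ext fun w => by
        change (s * linForm b a * linForm b (a' + a'')) ⊗ₜ[ℤ] exteriorPower.ιMulti ℤ i w =
          (s * linForm b a * linForm b a') ⊗ₜ[ℤ] exteriorPower.ιMulti ℤ i w + (s * linForm b a * linForm b a'') ⊗ₜ[ℤ] exteriorPower.ιMulti ℤ i w
        rw [map_add, mul_add, TensorProduct.add_tmul])
      (fun c a a' => AlternatingMap.ext fun w => by
        change (s * linForm b a * linForm b (c • a')) ⊗ₜ[ℤ] exteriorPower.ιMulti ℤ i w =
          c • ((s * linForm b a * linForm b a') ⊗ₜ[ℤ] exteriorPower.ιMulti ℤ i w)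
        rw [map_smul, mul_smul_comm, TensorProduct.smul_tmul'])
  have hg := congrArg (fun φ => φ v)
    (AlternatingMap.alternatizeUncurryFin_alternatizeUncurryFinLM_comp_of_symmetric (f := g)
      (fun x y => by
        ext w
        exact congrArg (fun t => t ⊗ₜ[ℤ] exteriorPower.ιMulti ℤ i w) (mul_right_comm _ _ _)))
  simp only [AlternatingMap.alternatizeUncurryFin_apply, AlternatingMap.zero_apply,
    LinearMap.comp_apply, AlternatingMap.alternatizeUncurryFinLM_apply] at hg
  rw [koszul_apply, map_sum, ← hg]
  refine Finset.sum_congr rfl fun k _ => ?_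
  rw [map_zsmul, koszul_apply]
  rfl

/-- The tensor of a monomial and a wedge of basis elements. -/
def koszulMonomial (b : Module.Basis κ ℤ A) {i : ℕ} (a : κ →₀ ℕ) (e : Fin i → κ) :
    MvPolynomial κ ℤ ⊗[ℤ] ⋀[ℤ]^i A :=
  monomial a 1 ⊗ₜ exteriorPower.ιMulti ℤ i fun j => b (e j)

lemma koszul_koszulMonomial (b : Module.Basis κ ℤ A) {i : ℕ} (a : κ →₀ ℕ) (e : Fin (i + 1) → κ) :
    koszul b i (koszulMonomial b a e) = ∑ k : Fin (i + 1), (-1 : ℤ) ^ (k : ℕ) •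
      koszulMonomial b (a + Finsupp.single (e k) 1) fun j => e (k.succAbove j) := by
  rw [koszulMonomial, koszul_apply]
  refine Finset.sum_congr rfl fun k _ => ?_
  rw [linForm_basis, X, monomial_mul, one_mul]
  rfl

lemma cons_comp_succAbove_succ {i : ℕ} {α : Type*} (v : α) (e : Fin (i + 1) → α) (k : Fin (i + 1)) :
    (fun j => (Fin.cons v e : Fin (i + 2) → α) (k.succ.succAbove j)) =
      Fin.cons v fun j => e (k.succAbove j) := by
  ext j
  refine Fin.cases ?_ (fun j => ?_) j
  · simp
  · simp

lemma sub_single_add_single {a : κ →₀ ℕ} {v : κ} (hv : v ∈ a.support) :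
    a - Finsupp.single v 1 + Finsupp.single v 1 = a := by
  refine tsub_add_cancel_of_le ?_
  rw [Finsupp.single_le_iff]
  exact Nat.one_le_iff_ne_zero.2 (Finsupp.mem_support_iff.1 hv)

/-- Any product s · x with a variable x is the differential of s ⊗ x, so only the constant term
survives in degree 0. -/
lemma exists_koszul_zero_eq (b : Module.Basis κ ℤ A) (s : MvPolynomial κ ℤ) (v : Fin 0 → A) :
    ∃ w, koszul b 0 w = (s - C (constantCoeff s)) ⊗ₜ exteriorPower.ιMulti ℤ 0 v := by
  induction s using MvPolynomial.induction_on with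
  | C a => exact ⟨0, by simp⟩
  | add s t hs ht =>
    obtain ⟨w, hw⟩ := hs
    obtain ⟨w', hw'⟩ := ht
    refine ⟨w + w', ?_⟩
    rw [map_add, hw, hw', ← TensorProduct.add_tmul, map_add, map_add, add_sub_add_comm]
  | mul_X s x _ =>
    refine ⟨s ⊗ₜ exteriorPower.ιMulti ℤ 1 fun _ => b x, ?_⟩
    rw [koszul_apply, Fin.sum_univ_one, linForm_basis, Fin.val_zero, pow_zero, one_smul, map_mul,
      constantCoeff_X, mul_zero, map_zero, sub_zero, Subsingleton.elim v]

variable [LinearOrder κ]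

/-- The basis of `Λ^i(A)` formed by the wedges of increasing sequences of basis elements. -/
def wedgeBasis (b : Module.Basis κ ℤ A) (i : ℕ) : Module.Basis (Fin i ↪o κ) ℤ (⋀[ℤ]^i A) :=
  (b.exteriorPower i).reindex Set.powersetCard.ofFinEmbEquiv.symm

lemma wedgeBasis_apply (b : Module.Basis κ ℤ A) {i : ℕ} (e : Fin i ↪o κ) :
    wedgeBasis b i e = exteriorPower.ιMulti ℤ i fun j => b (e j) := by
  rw [wedgeBasis, Module.Basis.reindex_apply, exteriorPower.basis_apply, exteriorPower.ιMulti_family,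
    Equiv.symm_symm, Equiv.symm_apply_apply]
  rfl

/-- The basis of `S ⊗ Λ^i(A)` over `ℤ`. -/
def koszulBasis (b : Module.Basis κ ℤ A) (i : ℕ) :
    Module.Basis ((κ →₀ ℕ) × (Fin i ↪o κ)) ℤ (MvPolynomial κ ℤ ⊗[ℤ] ⋀[ℤ]^i A) :=
  (basisMonomials κ ℤ).tensorProduct (wedgeBasis b i)

lemma koszulBasis_apply (b : Module.Basis κ ℤ A) {i : ℕ} (q : (κ →₀ ℕ) × (Fin i ↪o κ)) :
    koszulBasis b i q = koszulMonomial b q.1 q.2 := by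
  refine ((basisMonomials κ ℤ).tensorProduct_apply (wedgeBasis b i) q.1 q.2).trans ?_
  rw [wedgeBasis_apply, coe_basisMonomials]
  rfl

/-- The element `v` is the least one occurring in `x^a ⊗ e`, and it occurs only in `x^a`. -/
def IsPivot {i : ℕ} (a : κ →₀ ℕ) (e : Fin i → κ) (v : κ) : Prop :=
  v ∈ a.support ∧ (∀ w ∈ a.support, v ≤ w) ∧ ∀ j, v < e j

lemma IsPivot.unique {i : ℕ} {a : κ →₀ ℕ} {e : Fin i → κ} {v w : κ} (hv : IsPivot a e v)
    (hw : IsPivot a e w) : v = w :=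
  le_antisymm (hv.2.1 w hw.1) (hw.2.1 v hv.1)

lemma exists_isPivot {i : ℕ} {a : κ →₀ ℕ} {e : Fin i → κ} (ha : a.support.Nonempty)
    (h : ∀ j, ∃ w ∈ a.support, w < e j) : ∃ v, IsPivot a e v := by
  refine ⟨a.support.min' ha, Finset.min'_mem _ _, fun w hw => Finset.min'_le _ _ hw, fun j => ?_⟩
  obtain ⟨w, hw, hwj⟩ := h j
  exact (Finset.min'_le _ _ hw).trans_lt hwj

open Classical in
/-- The contracting homotopy of the Koszul complex, on basis elements. -/
def koszulHomotopyFun (b : Module.Basis κ ℤ A) {i : ℕ} (a : κ →₀ ℕ) (e : Fin i → κ) :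
    MvPolynomial κ ℤ ⊗[ℤ] ⋀[ℤ]^(i + 1) A :=
  if h : ∃ v, IsPivot a e v then
    koszulMonomial b (a - Finsupp.single h.choose 1) (Fin.cons h.choose e : Fin (i + 1) → κ)
  else 0

lemma koszulHomotopyFun_of_isPivot (b : Module.Basis κ ℤ A) {i : ℕ} {a : κ →₀ ℕ} {e : Fin i → κ}
    {v : κ} (hv : IsPivot a e v) : koszulHomotopyFun b a e =
      koszulMonomial b (a - Finsupp.single v 1) (Fin.cons v e : Fin (i + 1) → κ) := by
  have h : ∃ v, IsPivot a e v := ⟨v, hv⟩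
  rw [koszulHomotopyFun, dif_pos h, h.choose_spec.unique hv]

lemma koszulHomotopyFun_of_not (b : Module.Basis κ ℤ A) {i : ℕ} {a : κ →₀ ℕ} {e : Fin i → κ}
    (h : ∀ v, ¬ IsPivot a e v) : koszulHomotopyFun b a e = 0 :=
  dif_neg fun ⟨v, hv⟩ => h v hv

/-- The contracting homotopy of the Koszul complex. -/
def koszulHomotopy (b : Module.Basis κ ℤ A) (i : ℕ) :
    MvPolynomial κ ℤ ⊗[ℤ] ⋀[ℤ]^i A →ₗ[ℤ] MvPolynomial κ ℤ ⊗[ℤ] ⋀[ℤ]^(i + 1) A :=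
  (koszulBasis b i).constr ℤ fun q => koszulHomotopyFun b q.1 q.2

lemma koszulHomotopy_koszulMonomial (b : Module.Basis κ ℤ A) {i : ℕ} (a : κ →₀ ℕ)
    (e : Fin i ↪o κ) : koszulHomotopy b i (koszulMonomial b a e) = koszulHomotopyFun b a e := by
  have h := (koszulBasis b i).constr_basis ℤ (fun q => koszulHomotopyFun b q.1 q.2) (a, e)
  rwa [koszulBasis_apply] at h

lemma koszul_koszulHomotopyFun (b : Module.Basis κ ℤ A) {i : ℕ} {a : κ →₀ ℕ} {e : Fin i → κ}
    {v : κ} (hv : IsPivot a e v) : koszul b i (koszulHomotopyFun b a e) =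
      koszulMonomial b a e + ∑ k : Fin i, (-1 : ℤ) ^ ((k : ℕ) + 1) •
        koszulMonomial b (a - Finsupp.single v 1 + Finsupp.single (e k) 1)
          fun j => (Fin.cons v e : Fin (i + 1) → κ) (k.succ.succAbove j) := by
  rw [koszulHomotopyFun_of_isPivot b hv, koszul_koszulMonomial, Fin.sum_univ_succ]
  simp [sub_single_add_single hv.1]

/-- The homotopy moves the pivot, the least variable, from the monomial to the front of the wedge.
If there is a pivot v, the leading term of ∂h is the given element, and since v stays the pivot
after any contraction, the other terms of ∂h cancel against h∂. If there is none, h vanishes and the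
given element comes back from h∂. -/
lemma koszul_koszulHomotopy (b : Module.Basis κ ℤ A) (i : ℕ)
    (z : MvPolynomial κ ℤ ⊗[ℤ] ⋀[ℤ]^(i + 1) A) :
    koszul b (i + 1) (koszulHomotopy b (i + 1) z) + koszulHomotopy b i (koszul b i z) = z := by
  suffices h : ((koszul b (i + 1)).restrictScalars ℤ).comp (koszulHomotopy b (i + 1)) +
      (koszulHomotopy b i).comp ((koszul b i).restrictScalars ℤ) = LinearMap.id from
    congrArg (fun f => f z) h
  refine (koszulBasis b (i + 1)).ext fun ⟨a, e⟩ => ?_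
  rw [koszulBasis_apply]
  change koszul b (i + 1) (koszulHomotopy b (i + 1) (koszulMonomial b a e)) +
    koszulHomotopy b i (koszul b i (koszulMonomial b a e)) = koszulMonomial b a e
  have hsum : koszulHomotopy b i (koszul b i (koszulMonomial b a e)) =
      ∑ k : Fin (i + 1), (-1 : ℤ) ^ (k : ℕ) • koszulHomotopyFun b
        (a + Finsupp.single (e k) 1) fun j => e (k.succAbove j) := by
    rw [koszul_koszulMonomial, map_sum]
    refine Finset.sum_congr rfl fun k _ => ?_
    rw [map_smul]
    exact congrArg _ (koszulHomotopy_koszulMonomial b _ ((Fin.succAboveOrderEmb k).trans e))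
  rw [hsum, koszulHomotopy_koszulMonomial]
  by_cases hp : ∃ v, IsPivot a e v
  · obtain ⟨v, hv⟩ := hp
    rw [koszul_koszulHomotopyFun b hv, add_assoc, ← Finset.sum_add_distrib]
    refine (congrArg _ (Finset.sum_eq_zero fun k _ => ?_)).trans (add_zero _)
    have hk : IsPivot (a + Finsupp.single (e k) 1) (fun j => e (k.succAbove j)) v := by
      refine ⟨?_, fun w hw => ?_, fun j => hv.2.2 _⟩
      · have := hv.1
        simp only [Finsupp.mem_support_iff, Finsupp.add_apply] at this ⊢
        omega
      · rcases Finset.mem_union.1 (Finsupp.support_add hw) with h | h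
        · exact hv.2.1 w h
        · rw [Finset.mem_singleton.1 (Finsupp.support_single_subset h)]
          exact (hv.2.2 k).le
    rw [koszulHomotopyFun_of_isPivot b hk, cons_comp_succAbove_succ, pow_succ, mul_neg_one,
      neg_smul, neg_add_eq_zero]
    congr 2
    rw [← tsub_add_eq_add_tsub]
    rw [Finsupp.single_le_iff]
    exact Nat.one_le_iff_ne_zero.2 (Finsupp.mem_support_iff.1 hv.1)
  -- Without a pivot the least variable is e 0. Contracting e 0 makes it the pivot, so h restores
  -- it; after any other contraction e 0 is still in the wedge and no variable of the monomial is
  -- smaller, so h gives 0.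
  · have hmin : ∀ w ∈ a.support, e 0 ≤ w := by
      intro w hw
      by_contra! hlt
      exact hp (exists_isPivot ⟨w, hw⟩ fun j =>
        ⟨w, hw, hlt.trans_le (e.monotone (Fin.zero_le j))⟩)
    rw [koszulHomotopyFun_of_not b (fun v hv => hp ⟨v, hv⟩), map_zero, zero_add,
      Fin.sum_univ_succ, Finset.sum_eq_zero, add_zero]
    · have h0 : IsPivot (a + Finsupp.single (e 0) 1) (fun j => e (Fin.succAbove 0 j)) (e 0) := by
        refine ⟨by simp, fun w hw => ?_, fun j => ?_⟩
        · rcases Finset.mem_union.1 (Finsupp.support_add hw) with h | h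
          · exact hmin w h
          · rw [Finset.mem_singleton.1 (Finsupp.support_single_subset h)]
        · simp
      rw [koszulHomotopyFun_of_isPivot b h0, add_tsub_cancel_right, Fin.val_zero, pow_zero, one_smul]
      congr 1
      ext j
      refine Fin.cases ?_ (fun j => ?_) j
      · simp
      · simp
    · intro k _
      rw [koszulHomotopyFun_of_not, smul_zero]
      intro v hv
      cases i with
      | zero => exact k.elim0
      | succ i =>
        have h0 : v < e 0 := by simpa using hv.2.2 0
        rcases Finset.mem_union.1 (Finsupp.support_add hv.1) with h | h
        · exact (hmin v h).not_gt h0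
        · rw [Finset.mem_singleton.1 (Finsupp.support_single_subset h)] at h0
          exact h0.not_ge (e.monotone (Fin.zero_le _))

/-- The Koszul complex is exact in positive degrees. -/
lemma exists_koszul_eq (b : Module.Basis κ ℤ A) (i : ℕ)
    {z : MvPolynomial κ ℤ ⊗[ℤ] ⋀[ℤ]^(i + 1) A} (hz : koszul b i z = 0) :
    ∃ w, koszul b (i + 1) w = z :=
  ⟨koszulHomotopy b (i + 1) z, by
    have h := koszul_koszulHomotopy b i z
    rwa [hz, map_zero, add_zero] at h⟩

end Koszul

/-! ### A polynomial model of the simplicial symmetric algebra, contractible for q = 1. -/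

section Model

open MvPolynomial

variable {κ : Type u}

variable (κ) in
/-- The polynomial ring over `S = ℤ[κ]` in `i` further families of variables. -/
abbrev PolyLevel (i : ℕ) : Type u := MvPolynomial (Fin i × κ) (MvPolynomial κ ℤ)

/-- The variables of `PolyLevel κ i`: those of level `0` are the multiples by `q` of the variables
of `S`, those of level `b` with `1 ≤ b ≤ i` are the new ones, and those of higher level are `0`. -/
def levelVar (q : ℤ) (i b : ℕ) (x : κ) : PolyLevel κ i :=
  if b = 0 then C (q • X x) else if h : b - 1 < i then X (⟨b - 1, h⟩, x) else 0

@[simp]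
lemma levelVar_zero (q : ℤ) (i : ℕ) (x : κ) : levelVar q i 0 x = C (q • X x) :=
  if_pos rfl

lemma levelVar_succ (q : ℤ) {i : ℕ} (j : Fin i) (x : κ) : levelVar q i (j + 1) x = X (j, x) := by
  rw [levelVar, if_neg (Nat.succ_ne_zero _), dif_pos (by simp)]
  rfl

lemma levelVar_of_lt (q : ℤ) {i b : ℕ} (h : i < b) (x : κ) : levelVar q i b x = 0 := by
  rw [levelVar, if_neg (by omega), dif_neg (by omega)]

/-- The faces of the simplicial ring `PolyLevel κ`. -/
def polyFace (q : ℤ) (i k : ℕ) : PolyLevel κ (i + 1) →ₐ[MvPolynomial κ ℤ] PolyLevel κ i :=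
  aeval fun v => levelVar q i (if (v.1 : ℕ) + 1 ≤ k then v.1 + 1 else v.1) v.2

/-- The conventions for extreme levels make this uniform: face 0 takes level 1 to level 0, which is
q times a variable of S, and the last face takes the top level out of range, to 0. -/
lemma polyFace_levelVar (q : ℤ) (i k b : ℕ) (x : κ) :
    polyFace q i k (levelVar q (i + 1) b x) = levelVar q i (if b ≤ k then b else b - 1) x := by
  rcases Nat.eq_zero_or_pos b with rfl | hb
  · simp only [levelVar_zero, Nat.zero_le, if_true]
    exact (polyFace q i k).commutes _
  · obtain ⟨b, rfl⟩ := Nat.exists_eq_add_of_lt hb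
    rw [zero_add]
    rcases Nat.lt_or_ge b (i + 1) with h | h
    · rw [levelVar_succ q (⟨b, h⟩ : Fin (i + 1)), polyFace, aeval_X]
      rfl
    · rw [levelVar_of_lt q (by omega), map_zero, levelVar_of_lt]
      split_ifs <;> omega

/-- The alternating sum of the faces. -/
def polyD (q : ℤ) (i : ℕ) : PolyLevel κ (i + 1) →ₗ[MvPolynomial κ ℤ] PolyLevel κ i :=
  ∑ k : Fin (i + 2), (-1 : ℤ) ^ (k : ℕ) • (polyFace q i k).toLinearMap

lemma polyD_apply (q : ℤ) (i : ℕ) (z : PolyLevel κ (i + 1)) :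
    polyD q i z = ∑ k : Fin (i + 2), (-1 : ℤ) ^ (k : ℕ) • polyFace q i k z := by
  rw [polyD, LinearMap.sum_apply]
  rfl

/-- For q = 1 the level variables generate the ring, since those of level 0 are then the variables
of S themselves. -/
lemma polyLevel_ringHom_ext {T : Type*} [CommRing T] {i : ℕ} {f g : PolyLevel κ i →+* T}
    (h : ∀ b x, f (levelVar 1 i b x) = g (levelVar 1 i b x)) : f = g := by
  refine MvPolynomial.ringHom_ext (fun s => ?_) fun v => ?_
  · refine congrArg (fun φ : MvPolynomial κ ℤ →+* T => φ s)
      (MvPolynomial.ringHom_ext (f := f.comp C) (g := g.comp C) (fun n => by simp) fun x => ?_)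
    simpa using h 0 x
  · simpa [levelVar_succ] using h (v.1 + 1) v.2

/-- The extra degeneracy. -/
def extraDegeneracy (i : ℕ) : PolyLevel κ i →+* PolyLevel κ (i + 1) :=
  eval₂Hom (eval₂Hom (Int.castRingHom _) fun x => X (0, x)) fun v => X (v.1.succ, v.2)

/-- All levels go up by one, level 0 included; therefore the extra degeneracy is a ring homomorphism
but not S-linear. -/
lemma extraDegeneracy_levelVar (i b : ℕ) (x : κ) :
    extraDegeneracy i (levelVar 1 i b x) = levelVar 1 (i + 1) (b + 1) x := by
  rcases Nat.eq_zero_or_pos b with rfl | hb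
  · refine Eq.trans ?_ (levelVar_succ 1 (0 : Fin (i + 1)) x).symm
    rw [levelVar_zero, one_smul, extraDegeneracy, coe_eval₂Hom,
      eval₂_C, coe_eval₂Hom, eval₂_X]
  · obtain ⟨b, rfl⟩ := Nat.exists_eq_add_of_lt hb
    rw [zero_add]
    rcases Nat.lt_or_ge b i with h | h
    · rw [levelVar_succ 1 (⟨b, h⟩ : Fin i), extraDegeneracy, coe_eval₂Hom, eval₂_X]
      exact (levelVar_succ 1 (⟨b + 1, by omega⟩ : Fin (i + 1)) x).symm
    · rw [levelVar_of_lt 1 (by omega), map_zero, levelVar_of_lt 1 (by omega)]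

lemma polyFace_zero_extraDegeneracy (i : ℕ) (z : PolyLevel κ i) :
    polyFace 1 i 0 (extraDegeneracy i z) = z := by
  refine congrArg (fun φ : _ →+* _ => φ z) (polyLevel_ringHom_ext
    (f := (polyFace 1 i 0).toRingHom.comp (extraDegeneracy i)) (g := RingHom.id _) fun b x => ?_)
  change polyFace 1 i 0 (extraDegeneracy i (levelVar 1 i b x)) = _
  rw [extraDegeneracy_levelVar, polyFace_levelVar, if_neg (by omega)]
  rfl

lemma polyFace_succ_extraDegeneracy (i k : ℕ) (z : PolyLevel κ (i + 1)) :
    polyFace 1 (i + 1) (k + 1) (extraDegeneracy (i + 1) z) =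
      extraDegeneracy i (polyFace 1 i k z) := by
  refine congrArg (fun φ : _ →+* _ => φ z) (polyLevel_ringHom_ext
    (f := (polyFace 1 (i + 1) (k + 1)).toRingHom.comp (extraDegeneracy (i + 1)))
    (g := (extraDegeneracy i).comp (polyFace 1 i k).toRingHom) fun b x => ?_)
  change polyFace 1 (i + 1) (k + 1) (extraDegeneracy (i + 1) (levelVar 1 (i + 1) b x)) =
    extraDegeneracy i (polyFace 1 i k (levelVar 1 (i + 1) b x))
  rw [extraDegeneracy_levelVar, polyFace_levelVar, polyFace_levelVar,
    extraDegeneracy_levelVar]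
  congr 1
  split_ifs <;> omega

/-- With s the extra degeneracy, d_0 s = id and d_{k+1} s = s d_k, so the alternating sums
telescope. This needs q = 1. -/
lemma polyD_extraDegeneracy (i : ℕ) (z : PolyLevel κ (i + 1)) :
    polyD 1 (i + 1) (extraDegeneracy (i + 1) z) + extraDegeneracy i (polyD 1 i z) = z := by
  rw [polyD_apply, Fin.sum_univ_succ, polyD_apply, map_sum, add_assoc, ← Finset.sum_add_distrib,
    Finset.sum_eq_zero, add_zero]
  · simp only [Fin.val_zero, pow_zero, one_smul]
    exact polyFace_zero_extraDegeneracy _ z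
  · intro k _
    rw [map_zsmul, Fin.val_succ, polyFace_succ_extraDegeneracy, pow_succ, mul_neg_one,
      neg_smul, neg_add_cancel]

/-- At the bottom d_1 s sends every variable to an out-of-range level, hence leaves only the
constant term. -/
lemma polyD_extraDegeneracy_zero (z : PolyLevel κ 0) :
    polyD 1 0 (extraDegeneracy 0 z) = z - C (C (constantCoeff (constantCoeff z))) := by
  have h : polyFace 1 0 1 (extraDegeneracy 0 z) = C (C (constantCoeff (constantCoeff z))) := by
    refine congrArg (fun φ : _ →+* _ => φ z) (polyLevel_ringHom_ext
      (f := (polyFace 1 0 1).toRingHom.comp (extraDegeneracy 0))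
      (g := ((C.comp C).comp constantCoeff).comp constantCoeff) fun b x => ?_)
    change polyFace 1 0 1 (extraDegeneracy 0 (levelVar 1 0 b x)) =
      C (C (constantCoeff (constantCoeff (levelVar 1 0 b x))))
    rw [extraDegeneracy_levelVar, polyFace_levelVar, levelVar_of_lt 1
      (by split_ifs <;> omega)]
    rcases Nat.eq_zero_or_pos b with rfl | hb
    · simp
    · rw [levelVar_of_lt 1 hb]
      simp
  rw [polyD_apply, Fin.sum_univ_two]
  simp [polyFace_zero_extraDegeneracy, h, sub_eq_add_neg]

/-- The S-span of the image of s contains 1 and is stable under the new variables, because those lie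
in the image of the ring homomorphism s. -/
lemma linearMap_ext_extraDegeneracy {N : Type*} [AddCommGroup N] [Module (MvPolynomial κ ℤ) N]
    {i : ℕ} {f : PolyLevel κ (i + 1) →ₗ[MvPolynomial κ ℤ] N}
    (h : ∀ z, f (extraDegeneracy i z) = 0) (z : PolyLevel κ (i + 1)) : f z = 0 := by
  have hz : z ∈ Submodule.span (MvPolynomial κ ℤ) (Set.range (extraDegeneracy (κ := κ) i)) := by
    induction z using MvPolynomial.induction_on with
    | C s =>
      rw [← mul_one (C s), ← smul_eq_C_mul, ← map_one (extraDegeneracy i)]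
      exact Submodule.smul_mem _ _ (Submodule.subset_span ⟨1, rfl⟩)
    | add z w hz hw => exact Submodule.add_mem _ hz hw
    | mul_X z v hz =>
      have hv : extraDegeneracy i (levelVar 1 i v.1 v.2) = X v := by
        rw [extraDegeneracy_levelVar, levelVar_succ]
      induction hz using Submodule.span_induction with
      | mem z hz =>
        obtain ⟨z, rfl⟩ := hz
        rw [← hv, ← map_mul]
        exact Submodule.subset_span ⟨_, rfl⟩
      | zero => rw [zero_mul]; exact Submodule.zero_mem _
      | add z w _ _ hz hw => rw [add_mul]; exact Submodule.add_mem _ hz hw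
      | smul s z _ hz => rw [smul_mul_assoc]; exact Submodule.smul_mem _ _ hz
  have hle : Submodule.span (MvPolynomial κ ℤ) (Set.range (extraDegeneracy (κ := κ) i)) ≤
      LinearMap.ker f := Submodule.span_le.2 (by rintro _ ⟨z, rfl⟩; exact h z)
  exact hle hz

lemma constantCoeff_polyD_zero (z : PolyLevel κ 1) :
    constantCoeff (constantCoeff (polyD 1 0 z)) = 0 := by
  have h : ((constantCoeff.comp constantCoeff).comp (polyFace 1 0 0).toRingHom :
      PolyLevel κ 1 →+* ℤ) = (constantCoeff.comp constantCoeff).comp (polyFace 1 0 1).toRingHom := by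
    refine polyLevel_ringHom_ext fun b x => ?_
    change constantCoeff (constantCoeff (polyFace 1 0 0 (levelVar 1 1 b x))) =
      constantCoeff (constantCoeff (polyFace 1 0 1 (levelVar 1 1 b x)))
    have h0 (c : ℕ) : constantCoeff (constantCoeff (levelVar 1 0 c x)) = 0 := by
      rcases Nat.eq_zero_or_pos c with rfl | hc
      · simp
      · rw [levelVar_of_lt 1 hc]
        simp
    rw [polyFace_levelVar, polyFace_levelVar, h0, h0]
  have hz : constantCoeff (constantCoeff (polyFace 1 0 0 z)) =
      constantCoeff (constantCoeff (polyFace 1 0 1 z)) := congrArg (fun φ : _ →+* _ => φ z) h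
  rw [polyD_apply, Fin.sum_univ_two]
  simp [hz]

/-- By S-linearity it suffices to treat sz, where D(sz) = z − s(Dz) gives DD(sz) = s(DDz), which
vanishes by induction. No simplicial identities are used. -/
lemma polyD_polyD (i : ℕ) (z : PolyLevel κ (i + 2)) : polyD 1 i (polyD 1 (i + 1) z) = 0 := by
  induction i with
  | zero =>
    refine linearMap_ext_extraDegeneracy (f := (polyD 1 0).comp (polyD 1 1)) (fun z => ?_) z
    change polyD 1 0 (polyD 1 1 (extraDegeneracy 1 z)) = 0
    have h := polyD_extraDegeneracy 0 z
    rw [eq_sub_of_add_eq h, map_sub, polyD_extraDegeneracy_zero, constantCoeff_polyD_zero]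
    simp
  | succ i ih =>
    refine linearMap_ext_extraDegeneracy (f := (polyD 1 (i + 1)).comp (polyD 1 (i + 2)))
      (fun z => ?_) z
    change polyD 1 (i + 1) (polyD 1 (i + 2) (extraDegeneracy (i + 2) z)) = 0
    have h := polyD_extraDegeneracy (i + 1) z
    have h' := polyD_extraDegeneracy i (polyD 1 (i + 1) z)
    rw [eq_sub_of_add_eq h, map_sub, eq_sub_of_add_eq h', ih, map_zero, sub_zero, sub_self]

end Model

/-! ### Contractions of complexes of free modules and their base change. -/

section Homotopy

/-- One step in the construction of a contraction of an exact complex of projective modules. -/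
lemma exists_homotopy_of_exact {S : Type*} [CommRing S] {M₀ M₁ M₂ : Type*} [AddCommGroup M₀]
    [AddCommGroup M₁] [AddCommGroup M₂] [Module S M₀] [Module S M₁] [Module S M₂]
    [Module.Projective S M₁] (d : M₂ →ₗ[S] M₁) (e : M₁ →ₗ[S] M₀) (hex : ∀ z, e z = 0 → ∃ w, d w = z)
    (g : M₀ →ₗ[S] M₁) (hg : ∀ z, e (g (e z)) = e z) :
    ∃ g' : M₁ →ₗ[S] M₂, ∀ z, d (g' z) + g (e z) = z := by
  -- As e g e = e, the map id − g e lands in ker e, which is contained in im d; projectivity lifts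
  -- it through d.
  obtain ⟨g', hg'⟩ := Module.projective_lifting_property d.rangeRestrict
    ((LinearMap.id - g.comp e).codRestrict (LinearMap.range d) fun z => hex _ (by simp [hg]))
    d.surjective_rangeRestrict
  refine ⟨g', fun z => ?_⟩
  have h : d (g' z) = z - g (e z) := congrArg Subtype.val (congrArg (fun f => f z) hg')
  rw [h, sub_add_cancel]

/-- Transfer of a contraction along a change of rings that respects bases. -/
lemma exists_homotopy_of_semilinear {S : Type*} [CommRing S] {φ : S →+* S} {M₀ M₁ M₂ : Type*}
    [AddCommGroup M₀] [AddCommGroup M₁] [AddCommGroup M₂] [Module S M₀] [Module S M₁] [Module S M₂]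
    {ι₀ ι₁ : Type*} (b₀ : Module.Basis ι₀ S M₀) (b₁ : Module.Basis ι₁ S M₁)
    {T₀ : M₀ →ₛₗ[φ] M₀} {T₁ : M₁ →ₛₗ[φ] M₁} {T₂ : M₂ →ₛₗ[φ] M₂}
    (h₀ : ∀ x, T₀ (b₀ x) = b₀ x) (h₁ : ∀ x, T₁ (b₁ x) = b₁ x)
    {d d' : M₂ →ₗ[S] M₁} {e e' : M₁ →ₗ[S] M₀} (hd : ∀ z, d' (T₂ z) = T₁ (d z))
    (he : ∀ z, e' (T₁ z) = T₀ (e z)) {g : M₀ →ₗ[S] M₁} {g' : M₁ →ₗ[S] M₂}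
    (h : ∀ z, d (g' z) + g (e z) = z) :
    ∃ (k : M₀ →ₗ[S] M₁) (k' : M₁ →ₗ[S] M₂), ∀ z, d' (k' z) + k (e' z) = z := by
  let k : M₀ →ₗ[S] M₁ := b₀.constr S fun x => T₁ (g (b₀ x))
  let k' : M₁ →ₗ[S] M₂ := b₁.constr S fun x => T₂ (g' (b₁ x))
  -- Both sides are semilinear and agree on a basis fixed by T₀. For k' no such identity is needed,
  -- as it is only evaluated at basis vectors.
  have hk : k.comp T₀ = T₁.comp g := b₀.ext fun x => by
    rw [LinearMap.comp_apply, h₀, LinearMap.comp_apply]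
    exact b₀.constr_basis S _ x
  refine ⟨k, k', fun z => ?_⟩
  suffices hs : d'.comp k' + k.comp e' = LinearMap.id from congrArg (fun f => f z) hs
  refine b₁.ext fun x => ?_
  have hk₀ : k (T₀ (e (b₁ x))) = T₁ (g (e (b₁ x))) := congrArg (fun f => f (e (b₁ x))) hk
  have hk' : k' (b₁ x) = T₂ (g' (b₁ x)) := b₁.constr_basis S _ x
  change d' (k' (b₁ x)) + k (e' (b₁ x)) = b₁ x
  nth_rewrite 2 [← h₁ x]
  rw [hk', hd, he, hk₀, ← map_add, h, h₁]

end Homotopy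

/-! ### The chain map from the Koszul complex to the polynomial model. -/

section Comparison

open MvPolynomial

variable {A : Type u} [AddCommGroup A] {κ : Type u} (b : Module.Basis κ ℤ A)

/-- The linear form in the variables of level `j` attached to an element of `A`. -/
def levelForm (q : ℤ) (i j : ℕ) : A →ₗ[ℤ] PolyLevel κ i :=
  b.constr ℤ fun x => levelVar q i j x

lemma levelForm_basis (q : ℤ) (i j : ℕ) (x : κ) : levelForm b q i j (b x) = levelVar q i j x :=
  b.constr_basis ℤ _ x

lemma levelForm_zero (q : ℤ) (i : ℕ) (a : A) : levelForm b q i 0 a = C (q • linForm b a) := by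
  let f : MvPolynomial κ ℤ →+* PolyLevel κ i := C
  suffices h : levelForm b q i 0 = (f.toAddMonoidHom.toIntLinearMap).comp (q • linForm b) from
    congrArg (fun g => g a) h
  refine b.ext fun x => ?_
  rw [levelForm_basis, levelVar_zero, ← linForm_basis b]
  rfl

lemma levelForm_of_lt (q : ℤ) {i j : ℕ} (h : i < j) (a : A) : levelForm b q i j a = 0 := by
  suffices h : levelForm b q i j = 0 from congrArg (fun g => g a) h
  refine b.ext fun x => ?_
  rw [levelForm_basis, levelVar_of_lt q h]
  rfl

lemma levelForm_succ (q q' : ℤ) {i j : ℕ} (a : A) :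
    levelForm b q i (j + 1) a = levelForm b q' i (j + 1) a := by
  suffices h : levelForm b q i (j + 1) = levelForm b q' i (j + 1) from congrArg (fun g => g a) h
  refine b.ext fun x => ?_
  rw [levelForm_basis, levelForm_basis, levelVar, levelVar, if_neg (by omega), if_neg (by omega)]

lemma polyFace_levelForm (q : ℤ) (i k j : ℕ) (a : A) :
    polyFace q i k (levelForm b q (i + 1) j a) =
      levelForm b q i (if j ≤ k then j else j - 1) a := by
  let f : PolyLevel κ (i + 1) →+* PolyLevel κ i := (polyFace q i k).toRingHom
  suffices h : (f.toAddMonoidHom.toIntLinearMap).comp (levelForm b q (i + 1) j) =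
      levelForm b q i (if j ≤ k then j else j - 1) from congrArg (fun g => g a) h
  refine b.ext fun x => ?_
  rw [levelForm_basis, ← polyFace_levelVar, ← levelForm_basis b]
  rfl

/-- The determinant of the linear forms of levels `1, …, i`, as an alternating map. -/
def formDet (i : ℕ) : A [⋀^Fin i]→ₗ[ℤ] PolyLevel κ i :=
  AlternatingMap.compLinearMap
    { (Matrix.detRowAlternating (n := Fin i) (R := PolyLevel κ i)).toMultilinearMap.restrictScalars ℤ
        with map_eq_zero_of_eq' := fun v _ _ h hjk =>
          (Matrix.detRowAlternating (n := Fin i) (R := PolyLevel κ i)).map_eq_zero_of_eq v h hjk }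
    (LinearMap.pi fun j : Fin i => levelForm b 1 i (j + 1))

lemma formDet_apply (i : ℕ) (v : Fin i → A) :
    formDet b i v = (Matrix.of fun k j : Fin i => levelForm b 1 i (j + 1) (v k)).det :=
  rfl

/-- The comparison map `S ⊗ Λ^i(A) → PolyLevel κ i`. -/
def koszulToPoly (i : ℕ) :
    MvPolynomial κ ℤ ⊗[ℤ] ⋀[ℤ]^i A →ₗ[MvPolynomial κ ℤ] PolyLevel κ i :=
  LinearMap.liftBaseChange (MvPolynomial κ ℤ)
    (exteriorPower.alternatingMapLinearEquiv (R := ℤ) (M := A) (formDet b i))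

lemma koszulToPoly_apply (i : ℕ) (s : MvPolynomial κ ℤ) (v : Fin i → A) :
    koszulToPoly b i (s ⊗ₜ exteriorPower.ιMulti ℤ i v) = s • formDet b i v := by
  rw [koszulToPoly, LinearMap.liftBaseChange_tmul,
    exteriorPower.alternatingMapLinearEquiv_apply_ιMulti]

/-- Laplace expansion along the column of level 0: composing with ∂ adds that column to the
determinant. -/
lemma koszulToPoly_koszul (i : ℕ) (s : MvPolynomial κ ℤ) (v : Fin (i + 1) → A) :
    koszulToPoly b i (koszul b i (s ⊗ₜ exteriorPower.ιMulti ℤ (i + 1) v)) =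
      s • (Matrix.of fun k j : Fin (i + 1) => levelForm b 1 i j (v k)).det := by
  rw [koszul_apply, map_sum, Matrix.det_succ_column_zero, Finset.smul_sum]
  refine Finset.sum_congr rfl fun k _ => ?_
  rw [map_zsmul, koszulToPoly_apply, formDet_apply, Matrix.of_apply, Fin.val_zero, levelForm_zero,
    one_smul, mul_smul, mul_assoc, ← smul_eq_C_mul, zsmul_eq_mul]
  push_cast
  rw [mul_smul_comm]
  rfl

/-- A middle face makes two adjacent columns of the determinant equal and the last face makes a
column zero. Only face 0 survives; it lowers all levels by one, and its first column carries the
factor q. So the source must be given the differential q∂. -/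
lemma polyD_koszulToPoly (q : ℤ) (i : ℕ) (z : MvPolynomial κ ℤ ⊗[ℤ] ⋀[ℤ]^(i + 1) A) :
    polyD q i (koszulToPoly b (i + 1) z) = q • koszulToPoly b i (koszul b i z) := by
  refine congrArg (fun f : _ →+ _ => f z) (koszul_hom_ext
    (f := ((polyD q i).comp (koszulToPoly b (i + 1))).toAddMonoidHom)
    (g := (q • (koszulToPoly b i).comp (koszul b i)).toAddMonoidHom) fun s v => ?_)
  change polyD q i (koszulToPoly b (i + 1) (s ⊗ₜ exteriorPower.ιMulti ℤ (i + 1) v)) =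
    q • koszulToPoly b i (koszul b i (s ⊗ₜ exteriorPower.ιMulti ℤ (i + 1) v))
  rw [koszulToPoly_apply, koszulToPoly_koszul, map_smul, smul_comm q]
  congr 1
  have hface (k : ℕ) : polyFace q i k (formDet b (i + 1) v) = (Matrix.of fun l j : Fin (i + 1) =>
      levelForm b q i (if (j : ℕ) + 1 ≤ k then j + 1 else j) (v l)).det := by
    rw [formDet_apply, AlgHom.map_det]
    congr 1
    ext1 l j
    change polyFace q i k (levelForm b 1 (i + 1) (j + 1) (v l)) = _
    rw [levelForm_succ b 1 q, polyFace_levelForm]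
    rfl
  rw [polyD_apply, Fin.sum_univ_succ, Finset.sum_eq_zero, add_zero, Fin.val_zero, pow_zero, one_smul,
    hface]
  · have h : (Matrix.of fun l j : Fin (i + 1) =>
        levelForm b q i (if (j : ℕ) + 1 ≤ 0 then j + 1 else j) (v l)) =
        (Matrix.of fun l j : Fin (i + 1) => levelForm b 1 i j (v l)).updateCol 0
          ((q : PolyLevel κ i) • fun l => levelForm b 1 i 0 (v l)) := by
      ext1 l j
      rw [Matrix.updateCol_apply]
      refine Fin.cases ?_ (fun j => ?_) j
      · simp [levelForm_zero]
      · simp [levelForm_succ b q 1]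
    rw [h, Matrix.det_updateCol_smul, zsmul_eq_mul]
    congr 2
    exact Matrix.updateCol_eq_self _ _
  · intro k _
    rw [hface]
    refine (congrArg _ ?_).trans (smul_zero _)
    refine Fin.lastCases ?_ (fun k => ?_) k
    · refine Matrix.det_eq_zero_of_column_eq_zero (Fin.last i) fun l => ?_
      simp [levelForm_of_lt]
    · refine Matrix.det_zero_of_column_eq (i := k.castSucc) (j := k.succ)
        (Fin.castSucc_lt_succ).ne fun l => ?_
      simp

end Comparison

/-! ### The cone of the comparison map: contraction for q = 1, transfer to every q. -/

section Cone

open MvPolynomial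

variable {A : Type u} [AddCommGroup A] {κ : Type u} (b : Module.Basis κ ℤ A)

/-- Multiplication of the variables of `S` by `q`. -/
def scaleVar (κ : Type u) (q : ℤ) : MvPolynomial κ ℤ →+* MvPolynomial κ ℤ :=
  (aeval fun x => q • X x : MvPolynomial κ ℤ →ₐ[ℤ] MvPolynomial κ ℤ).toRingHom

lemma scaleVar_X (q : ℤ) (x : κ) : scaleVar κ q (X x) = q • X x :=
  aeval_X _ x

lemma scaleVar_linForm (q : ℤ) (a : A) : scaleVar κ q (linForm b a) = q • linForm b a := by
  suffices h : ((scaleVar κ q).toAddMonoidHom.toIntLinearMap).comp (linForm b) = q • linForm b from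
    congrArg (fun f => f a) h
  refine b.ext fun x => ?_
  rw [LinearMap.comp_apply, LinearMap.smul_apply, linForm_basis]
  exact scaleVar_X q x

/-- The map induced by `scaleVar` on `PolyLevel κ i`, fixing the new variables. -/
def scalePoly (q : ℤ) (i : ℕ) : PolyLevel κ i →ₛₗ[scaleVar κ q] PolyLevel κ i where
  toFun := MvPolynomial.map (scaleVar κ q)
  map_add' := map_add _
  map_smul' s z := by rw [smul_eq_C_mul, map_mul, map_C, smul_eq_C_mul]

lemma scalePoly_levelVar (q : ℤ) (i j : ℕ) (x : κ) :
    scalePoly q i (levelVar 1 i j x) = levelVar q i j x := by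
  change MvPolynomial.map (scaleVar κ q) _ = _
  rcases Nat.eq_zero_or_pos j with rfl | hj
  · rw [levelVar_zero, map_C, one_smul, scaleVar_X, levelVar_zero]
  · obtain ⟨j, rfl⟩ := Nat.exists_eq_add_of_lt hj
    rw [zero_add]
    rcases Nat.lt_or_ge j i with h | h
    · rw [levelVar_succ 1 (⟨j, h⟩ : Fin i), levelVar_succ q (⟨j, h⟩ : Fin i), map_X]
    · rw [levelVar_of_lt 1 (by omega), levelVar_of_lt q (by omega), map_zero]

lemma scalePoly_polyD (q : ℤ) (i : ℕ) (z : PolyLevel κ (i + 1)) :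
    scalePoly q i (polyD 1 i z) = polyD q i (scalePoly q (i + 1) z) := by
  have hface (k : ℕ) : scalePoly q i (polyFace 1 i k z) =
      polyFace q i k (scalePoly q (i + 1) z) := by
    refine congrArg (fun f : _ →+* _ => f z) (polyLevel_ringHom_ext
      (f := (MvPolynomial.map (scaleVar κ q)).comp (polyFace 1 i k).toRingHom)
      (g := (polyFace q i k).toRingHom.comp (MvPolynomial.map (scaleVar κ q))) fun j x => ?_)
    change scalePoly q i (polyFace 1 i k (levelVar 1 (i + 1) j x)) =
      polyFace q i k (scalePoly q (i + 1) (levelVar 1 (i + 1) j x))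
    rw [scalePoly_levelVar, polyFace_levelVar, polyFace_levelVar, scalePoly_levelVar]
  rw [polyD_apply, polyD_apply, map_sum]
  refine Finset.sum_congr rfl fun k _ => ?_
  rw [map_zsmul, hface]

/-- The map induced by `scaleVar` on `S ⊗ Λ^i(A)`. -/
def scaleKoszul (A : Type u) [AddCommGroup A] (κ : Type u) (q : ℤ) (i : ℕ) :
    MvPolynomial κ ℤ ⊗[ℤ] ⋀[ℤ]^i A →ₛₗ[scaleVar κ q] MvPolynomial κ ℤ ⊗[ℤ] ⋀[ℤ]^i A where
  toFun := LinearMap.rTensor _ (scaleVar κ q).toAddMonoidHom.toIntLinearMap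
  map_add' := map_add _
  map_smul' s z := by
    induction z with
    | zero => simp
    | add z w hz hw => rw [smul_add, map_add, hz, hw, map_add, smul_add]
    | tmul t w =>
      rw [TensorProduct.smul_tmul', LinearMap.rTensor_tmul, LinearMap.rTensor_tmul,
        TensorProduct.smul_tmul']
      exact congrArg (fun r => r ⊗ₜ[ℤ] w) (map_mul (scaleVar κ q) s t)

lemma scaleKoszul_tmul (q : ℤ) (i : ℕ) (s : MvPolynomial κ ℤ) (w : ⋀[ℤ]^i A) :
    scaleKoszul A κ q i (s ⊗ₜ w) = scaleVar κ q s ⊗ₜ w :=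
  rfl

/-- Scaling multiplies each linear form by q, so the base change of ∂ is q∂, the differential used
in the cone. -/
lemma scaleKoszul_koszul (q : ℤ) (i : ℕ) (z : MvPolynomial κ ℤ ⊗[ℤ] ⋀[ℤ]^(i + 1) A) :
    scaleKoszul A κ q i (koszul b i z) = q • koszul b i (scaleKoszul A κ q (i + 1) z) := by
  refine congrArg (fun f : _ →+ _ => f z) (koszul_hom_ext
    (f := ((scaleKoszul A κ q i).comp (koszul b i)).toAddMonoidHom)
    (g := ((q • koszul b i).comp (scaleKoszul A κ q (i + 1))).toAddMonoidHom) fun s v => ?_)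
  change scaleKoszul A κ q i (koszul b i (s ⊗ₜ exteriorPower.ιMulti ℤ (i + 1) v)) =
    q • koszul b i (scaleKoszul A κ q (i + 1) (s ⊗ₜ exteriorPower.ιMulti ℤ (i + 1) v))
  rw [scaleKoszul_tmul, koszul_apply, koszul_apply, map_sum, Finset.smul_sum]
  refine Finset.sum_congr rfl fun k _ => ?_
  rw [map_zsmul, scaleKoszul_tmul, map_mul, scaleVar_linForm, mul_smul_comm, smul_comm q]
  rfl

lemma koszulToPoly_scaleKoszul (q : ℤ) (i : ℕ) (z : MvPolynomial κ ℤ ⊗[ℤ] ⋀[ℤ]^i A) :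
    scalePoly q i (koszulToPoly b i z) = koszulToPoly b i (scaleKoszul A κ q i z) := by
  refine congrArg (fun f : _ →+ _ => f z) (koszul_hom_ext
    (f := ((scalePoly q i).comp (koszulToPoly b i)).toAddMonoidHom)
    (g := ((koszulToPoly b i).comp (scaleKoszul A κ q i)).toAddMonoidHom) fun s v => ?_)
  change scalePoly q i (koszulToPoly b i (s ⊗ₜ exteriorPower.ιMulti ℤ i v)) =
    koszulToPoly b i (scaleKoszul A κ q i (s ⊗ₜ exteriorPower.ιMulti ℤ i v))
  rw [scaleKoszul_tmul, koszulToPoly_apply, koszulToPoly_apply, map_smulₛₗ, formDet_apply]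
  congr 1
  refine ((MvPolynomial.map (scaleVar κ q)).map_det _).trans (congrArg _ ?_)
  ext1 k j
  let f : PolyLevel κ i →+* PolyLevel κ i := MvPolynomial.map (scaleVar κ q)
  suffices h : (f.toAddMonoidHom.toIntLinearMap).comp (levelForm b 1 i (j + 1)) =
      levelForm b 1 i (j + 1) from congrArg (fun g => g (v k)) h
  refine b.ext fun x => ?_
  rw [LinearMap.comp_apply, levelForm_basis, levelVar_succ]
  exact map_X _ _

variable (κ) in
/-- The terms of the cone of the comparison map. -/
abbrev Cone (A : Type u) [AddCommGroup A] (i : ℕ) : Type u :=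
  PolyLevel κ (i + 1) × (MvPolynomial κ ℤ ⊗[ℤ] ⋀[ℤ]^i A)

/-- The augmentation of the cone. -/
def coneAug (q : ℤ) : Cone κ A 0 →ₗ[MvPolynomial κ ℤ] PolyLevel κ 0 :=
  (polyD q 0).comp (LinearMap.fst _ _ _) - (koszulToPoly b 0).comp (LinearMap.snd _ _ _)

/-- The differential of the cone. -/
def coneD (q : ℤ) (i : ℕ) : Cone κ A (i + 1) →ₗ[MvPolynomial κ ℤ] Cone κ A i :=
  LinearMap.prod
    ((polyD q (i + 1)).comp (LinearMap.fst _ _ _) - (koszulToPoly b (i + 1)).comp (LinearMap.snd _ _ _))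
    (-(q • (koszul b i).comp (LinearMap.snd _ _ _)))

lemma coneAug_apply (q : ℤ) (z : Cone κ A 0) :
    coneAug b q z = polyD q 0 z.1 - koszulToPoly b 0 z.2 :=
  rfl

lemma coneD_apply (q : ℤ) (i : ℕ) (z : Cone κ A (i + 1)) :
    coneD b q i z = (polyD q (i + 1) z.1 - koszulToPoly b (i + 1) z.2, -(q • koszul b i z.2)) :=
  rfl

lemma coneD_coneD (i : ℕ) (z : Cone κ A (i + 2)) : coneD b 1 i (coneD b 1 (i + 1) z) = 0 := by
  rw [coneD_apply, coneD_apply]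
  dsimp only
  rw [map_sub, polyD_polyD, polyD_koszulToPoly, map_neg, map_neg, one_smul, one_smul,
    koszul_koszul]
  simp

lemma coneAug_coneD (z : Cone κ A 1) : coneAug b 1 (coneD b 1 0 z) = 0 := by
  rw [coneD_apply, coneAug_apply]
  dsimp only
  rw [map_sub, polyD_polyD, polyD_koszulToPoly, map_neg, one_smul, one_smul]
  simp

lemma exists_polyD_eq (i : ℕ) {z : PolyLevel κ (i + 1)} (hz : polyD 1 i z = 0) :
    ∃ w, polyD 1 (i + 1) w = z :=
  ⟨extraDegeneracy (i + 1) z, by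
    have h := polyD_extraDegeneracy i z
    rwa [hz, map_zero, add_zero] at h⟩

/-- `Λ^0(A) = ℤ`, in the form needed for `S ⊗ Λ^0(A)`. -/
lemma exists_tmul_zero (z : MvPolynomial κ ℤ ⊗[ℤ] ⋀[ℤ]^0 A) :
    ∃ s : MvPolynomial κ ℤ, z = s ⊗ₜ exteriorPower.ιMulti ℤ 0 (Fin.elim0 : Fin 0 → A) := by
  induction z with
  | zero => exact ⟨0, by simp⟩
  | add z w hz hw =>
    obtain ⟨s, rfl⟩ := hz
    obtain ⟨t, rfl⟩ := hw
    exact ⟨s + t, (TensorProduct.add_tmul _ _ _).symm⟩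
  | tmul s w =>
    obtain ⟨c, hc⟩ : ∃ c : ℤ, c • exteriorPower.ιMulti ℤ 0 (Fin.elim0 : Fin 0 → A) = w := by
      have hw : w ∈ Submodule.span ℤ (Set.range (exteriorPower.ιMulti ℤ 0 (M := A))) := by
        rw [exteriorPower.ιMulti_span]; trivial
      rw [Set.range_unique, Submodule.mem_span_singleton] at hw
      obtain ⟨c, hc⟩ := hw
      exact ⟨c, by rw [← hc]; congr 2⟩
    refine ⟨c • s, ?_⟩
    rw [← hc, TensorProduct.tmul_smul, TensorProduct.smul_tmul']

/-- Images under D have no constant term, so the Koszul component is a Koszul boundary; correcting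
by it leaves a cycle of the contractible polynomial model. -/
lemma exists_coneD_zero_eq {z : Cone κ A 0} (hz : coneAug b 1 z = 0) :
    ∃ w, coneD b 1 0 w = z := by
  obtain ⟨z, k⟩ := z
  rw [coneAug_apply, sub_eq_zero] at hz
  obtain ⟨s, rfl⟩ := exists_tmul_zero k
  have hs : constantCoeff s = 0 := by
    rw [← constantCoeff_polyD_zero z, hz, koszulToPoly_apply, formDet_apply]
    simp
  obtain ⟨k', hk'⟩ := exists_koszul_zero_eq b s Fin.elim0
  rw [hs, map_zero, sub_zero] at hk'
  rw [← hk'] at hz ⊢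
  have h : polyD 1 0 (z - koszulToPoly b 1 k') = 0 := by
    rw [map_sub, polyD_koszulToPoly, one_smul, hz, sub_self]
  obtain ⟨u, hu⟩ := exists_polyD_eq 0 h
  refine ⟨(u, -k'), ?_⟩
  rw [coneD_apply]
  dsimp only
  rw [hu, map_neg, map_neg, one_smul, neg_neg, sub_neg_eq_add, sub_add_cancel]

/-- The map induced by `scaleVar` on the cone. -/
def scaleCone (A : Type u) [AddCommGroup A] (κ : Type u) (q : ℤ) (i : ℕ) :
    Cone κ A i →ₛₗ[scaleVar κ q] Cone κ A i where
  toFun z := (scalePoly q (i + 1) z.1, scaleKoszul A κ q i z.2)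
  map_add' z w := by simp
  map_smul' s z := by simp

lemma scaleCone_coneD (q : ℤ) (i : ℕ) (z : Cone κ A (i + 1)) :
    coneD b q i (scaleCone A κ q (i + 1) z) = scaleCone A κ q i (coneD b 1 i z) := by
  refine Prod.ext ?_ ?_
  · change _ = scalePoly q (i + 1) (polyD 1 (i + 1) z.1 - koszulToPoly b (i + 1) z.2)
    rw [map_sub, scalePoly_polyD, koszulToPoly_scaleKoszul]
    rfl
  · change _ = scaleKoszul A κ q i (-((1 : ℤ) • koszul b i z.2))
    rw [one_smul, map_neg, scaleKoszul_koszul]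
    rfl

lemma scaleCone_coneAug (q : ℤ) (z : Cone κ A 0) :
    coneAug b q (scaleCone A κ q 0 z) = scalePoly q 0 (coneAug b 1 z) := by
  change _ = scalePoly q 0 (polyD 1 0 z.1 - koszulToPoly b 0 z.2)
  rw [map_sub, scalePoly_polyD, koszulToPoly_scaleKoszul]
  rfl

variable [LinearOrder κ]

/-- For q = 1 both complexes are exact here: the Koszul component is bounded first, then the
corrected polynomial component. -/
lemma exists_coneD_eq (i : ℕ) {z : Cone κ A (i + 1)} (hz : coneD b 1 i z = 0) :
    ∃ w, coneD b 1 (i + 1) w = z := by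
  obtain ⟨z, k⟩ := z
  rw [coneD_apply, Prod.mk_eq_zero, one_smul, neg_eq_zero] at hz
  obtain ⟨k', rfl⟩ := exists_koszul_eq b i hz.2
  have h : polyD 1 (i + 1) (z - koszulToPoly b (i + 2) k') = 0 := by
    rw [map_sub, polyD_koszulToPoly, one_smul, hz.1]
  obtain ⟨u, hu⟩ := exists_polyD_eq (i + 1) h
  refine ⟨(u, -k'), ?_⟩
  rw [coneD_apply]
  dsimp only
  rw [hu, map_neg, map_neg, one_smul, neg_neg, sub_neg_eq_add, sub_add_cancel]

/-- The basis of the cone over `S`. -/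
def coneBasis (i : ℕ) :
    Module.Basis ((Fin (i + 1) × κ →₀ ℕ) ⊕ (Fin i ↪o κ)) (MvPolynomial κ ℤ) (Cone κ A i) :=
  (basisMonomials (Fin (i + 1) × κ) (MvPolynomial κ ℤ)).prod
    (Algebra.TensorProduct.basis (MvPolynomial κ ℤ) (wedgeBasis b i))

/-- The basis consists of monomials in the new variables and wedges, with no variable of S as
coefficient; this exhibits the cone for q as a base change of the cone for 1. -/
lemma scaleCone_coneBasis (q : ℤ) (i : ℕ) (x) :
    scaleCone A κ q i (coneBasis b i x) = coneBasis b i x := by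
  have h1 (a) : scalePoly q (i + 1) (monomial a (1 : MvPolynomial κ ℤ)) = monomial a 1 :=
    (map_monomial _ _ _).trans (by rw [map_one])
  rcases x with a | e
  · refine Prod.ext ?_ ?_
    · simpa [coneBasis, scaleCone] using h1 a
    · simp [coneBasis, scaleCone]
  · refine Prod.ext ?_ ?_
    · simp [coneBasis, scaleCone]
    · simp [coneBasis, scaleCone, scaleKoszul_tmul]

/-- In degree 0 the comparison is the isomorphism S ⊗ Λ^0(A) ≅ S, whose inverse, up to sign, splits
the augmentation and starts the contraction. -/
lemma exists_coneAug_homotopy :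
    ∃ (g : PolyLevel κ 0 →ₗ[MvPolynomial κ ℤ] Cone κ A 0)
      (g' : Cone κ A 0 →ₗ[MvPolynomial κ ℤ] Cone κ A 1),
      ∀ z, coneD b 1 0 (g' z) + g (coneAug b 1 z) = z := by
  have := Module.Free.of_basis (coneBasis b 0)
  let f : PolyLevel κ 0 →ₗ[MvPolynomial κ ℤ] MvPolynomial κ ℤ :=
    (isEmptyAlgEquiv (MvPolynomial κ ℤ) (Fin 0 × κ)).toLinearMap
  let g : PolyLevel κ 0 →ₗ[MvPolynomial κ ℤ] Cone κ A 0 :=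
    LinearMap.prod 0 (-(LinearMap.toSpanSingleton (MvPolynomial κ ℤ)
      (MvPolynomial κ ℤ ⊗[ℤ] ⋀[ℤ]^0 A) (1 ⊗ₜ exteriorPower.ιMulti ℤ 0 (Fin.elim0 : Fin 0 → A))).comp f)
  have hg (z) : coneAug b 1 (g z) = z := by
    rw [coneAug_apply]
    change polyD 1 0 0 - koszulToPoly b 0
      (-(f z • (1 ⊗ₜ exteriorPower.ιMulti ℤ 0 (Fin.elim0 : Fin 0 → A)))) = z
    rw [map_zero, map_neg, map_smul, koszulToPoly_apply, formDet_apply, Matrix.det_isEmpty, one_smul,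
      zero_sub, neg_neg, smul_eq_C_mul, mul_one]
    exact (isEmptyAlgEquiv (MvPolynomial κ ℤ) (Fin 0 × κ)).symm_apply_apply z
  exact ⟨g, exists_homotopy_of_exact _ _ (fun z hz => exists_coneD_zero_eq b hz) g fun z => hg _⟩

lemma exists_coneD_homotopy (i : ℕ) :
    ∃ (g : Cone κ A i →ₗ[MvPolynomial κ ℤ] Cone κ A (i + 1))
      (g' : Cone κ A (i + 1) →ₗ[MvPolynomial κ ℤ] Cone κ A (i + 2)),
      ∀ z, coneD b 1 (i + 1) (g' z) + g (coneD b 1 i z) = z := by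
  have := Module.Free.of_basis (coneBasis b (i + 1))
  induction i with
  | zero =>
    obtain ⟨g, g', h⟩ := exists_coneAug_homotopy b
    refine ⟨g', exists_homotopy_of_exact _ _ (fun z hz => exists_coneD_eq b 0 hz) g' fun z => ?_⟩
    have h' := h (coneD b 1 0 z)
    rwa [coneAug_coneD, map_zero, add_zero] at h'
  | succ i ih =>
    obtain ⟨g, g', h⟩ := ih (Module.Free.of_basis (coneBasis b (i + 1)))
    refine ⟨g', exists_homotopy_of_exact _ _ (fun z hz => exists_coneD_eq b (i + 1) hz) g'
      fun z => ?_⟩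
    have h' := h (coneD b 1 (i + 1) z)
    rwa [coneD_coneD, map_zero, add_zero] at h'

/-- A chain of `PolyLevel κ` whose boundary is the image of a Koszul boundary is, up to a boundary,
the image of a Koszul chain. -/
lemma exists_eq_koszulToPoly_add_polyD (q : ℤ) {i : ℕ} {z : PolyLevel κ (i + 1)}
    {t : MvPolynomial κ ℤ ⊗[ℤ] ⋀[ℤ]^(i + 1) A}
    (hz : polyD q i z = koszulToPoly b i (koszul b i t)) :
    ∃ (w : MvPolynomial κ ℤ ⊗[ℤ] ⋀[ℤ]^(i + 1) A) (u : PolyLevel κ (i + 2)),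
      z = koszulToPoly b (i + 1) w + polyD q (i + 1) u ∧ koszul b i t = q • koszul b i w := by
  -- The pair is a cycle of the cone for q, and the contraction transferred from q = 1 bounds it.
  -- For i = 0 being a cycle is tested by the augmentation.
  have key : ∃ w, coneD b q i w = (z, koszul b i t) := by
    cases i with
    | zero =>
      obtain ⟨g, g', h⟩ := exists_coneAug_homotopy (A := A) b
      obtain ⟨g, g', h⟩ := exists_homotopy_of_semilinear
        (basisMonomials (Fin 0 × κ) (MvPolynomial κ ℤ)) (coneBasis b 0)
        (T₀ := scalePoly q 0) (fun x => (map_monomial _ _ _).trans (by simp))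
        (scaleCone_coneBasis b q 0) (scaleCone_coneD b q 0) (scaleCone_coneAug b q) h
      have h' := h (z, koszul b 0 t)
      rw [coneAug_apply, hz, sub_self, map_zero, add_zero] at h'
      exact ⟨_, h'⟩
    | succ i =>
      obtain ⟨g, g', h⟩ := exists_coneD_homotopy (A := A) b i
      obtain ⟨g, g', h⟩ := exists_homotopy_of_semilinear (coneBasis b i) (coneBasis b (i + 1))
        (scaleCone_coneBasis b q i) (scaleCone_coneBasis b q (i + 1)) (scaleCone_coneD b q (i + 1))
        (scaleCone_coneD b q i) h
      have h' := h (z, koszul b (i + 1) t)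
      have h0 : coneD b q i (z, koszul b (i + 1) t) = 0 := by
        rw [coneD_apply]
        dsimp only
        rw [hz, sub_self, koszul_koszul, smul_zero, neg_zero]
        rfl
      rw [h0, map_zero, add_zero] at h'
      exact ⟨_, h'⟩
  obtain ⟨⟨u, w⟩, h⟩ := key
  rw [coneD_apply, Prod.mk.injEq] at h
  -- The sign of w undoes the minus signs of the Koszul component in the cone differential.
  refine ⟨-w, u, ?_, ?_⟩
  · rw [map_neg, neg_add_eq_sub]
    exact h.1.symm
  · rw [map_neg, smul_neg]
    exact h.2.symm

end Cone

/-! ### The simplicial module of a two-term complex: one copy of C_0 and i copies of C_1 in degree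
i. -/

section DoldKanLevel

open Opposite AlgebraicTopology.DoldKan Simplicial SimplicialObject

lemma cut_apply (i b : ℕ) (j : Fin (i + 1)) :
    (cut i b).toOrderHom j = if (j : ℕ) < b then 0 else 1 :=
  rfl

instance epi_cut (i : ℕ) (j : Fin i) : Epi (cut i (j + 1)) := by
  rw [SimplexCategory.epi_iff_surjective]
  intro t
  change Fin 2 at t
  refine Fin.cases ⟨0, ?_⟩ (fun t => ⟨Fin.last i, ?_⟩) t
  · rw [cut_apply, if_pos (by simp)]
  · rw [cut_apply, if_neg (by simp), Subsingleton.elim t 0]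
    rfl

lemma fin_two_eq_zero {t : Fin 2} (h : ¬ t = 1) : t = 0 := by
  omega

lemma fin_two_eq_one {t : Fin 2} (h : 1 ≤ t) : t = 1 := by
  omega

/-- A monotone surjection onto [1] is determined by the first index where it takes the value 1,
which is positive because 0 is also attained. -/
lemma exists_eq_cut {i : ℕ} (f : ⦋i⦌ ⟶ ⦋1⦌) (hf : Epi f) : ∃ j : Fin i, f = cut i (j + 1) := by
  rw [SimplexCategory.epi_iff_surjective] at hf
  obtain ⟨l, hl⟩ := hf 1
  obtain ⟨l', hl'⟩ := hf 0
  change Fin (i + 1) at l l'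
  have hex : ∃ b : ℕ, ∃ h : b < i + 1, f.toOrderHom ⟨b, h⟩ = 1 := ⟨l, l.2, hl⟩
  classical
  obtain ⟨hb, hb1⟩ := Nat.find_spec hex
  have hmin : ∀ j : Fin (i + 1), f.toOrderHom j = if (j : ℕ) < Nat.find hex then 0 else 1 := by
    intro j
    split_ifs with h
    · have h' := Nat.find_min hex h
      rw [not_exists] at h'
      have h'' := h' j.2
      exact fin_two_eq_zero h''
    · have hle : (f.toOrderHom ⟨Nat.find hex, hb⟩ : Fin 2) ≤ f.toOrderHom j :=
        f.toOrderHom.monotone (Fin.mk_le_of_le_val (not_lt.1 h))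
      rw [hb1] at hle
      exact fin_two_eq_one hle
  have hpos : 0 < Nat.find hex := by
    rcases Nat.eq_zero_or_pos (Nat.find hex) with h | h
    · have := hmin l'
      rw [h, if_neg (by omega), hl'] at this
      exact absurd this (by decide)
    · exact h
  refine ⟨⟨Nat.find hex - 1, by omega⟩, ?_⟩
  ext j
  rw [hmin j, cut_apply]
  simp only [Nat.sub_add_cancel hpos]

lemma cut_injective {i : ℕ} {j k : Fin i} (h : cut i (j + 1) = cut i (k + 1)) : j = k := by
  have hlt {j k : Fin i} (h : cut i (j + 1) = cut i (k + 1)) : k ≤ j := by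
    have hj : (cut i (j + 1)).toOrderHom j.succ = (cut i (k + 1)).toOrderHom j.succ := by rw [h]
    rw [cut_apply, cut_apply, if_neg (by simp)] at hj
    by_contra! hjk
    rw [if_pos (by simpa using hjk)] at hj
    exact absurd hj (by decide)
  exact le_antisymm (hlt h.symm) (hlt h)

variable {R : Type} [CommRing R] {C : ChainComplex (ModuleCat.{u} R) ℕ}

/-- For a complex concentrated in degrees `0` and `1`, a map out of `(K C)_i` is determined by its
restrictions along the degeneracies of `C_0` and `C_1`. -/
lemma level_hom_ext (hC : ∀ k, Limits.IsZero (C.X (k + 2))) {i : ℕ} {Z : ModuleCat.{u} R}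
    {f g : Γ₀.obj C _⦋i⦌ ⟶ Z} (h₀ : degZero C i ≫ f = degZero C i ≫ g)
    (h₁ : ∀ j : Fin i, degOne C i (j + 1) ≫ f = degOne C i (j + 1) ≫ g) : f = g := by
  refine (Γ₀.splitting C).hom_ext' f g fun B => ?_
  obtain ⟨⟨⟨k⟩⟩, α, hα⟩ := B
  match k with
  | 0 =>
    have : α = SimplexCategory.const ⦋i⦌ ⦋0⦌ 0 := Subsingleton.elim _ _
    subst this
    exact h₀
  | 1 =>
    obtain ⟨j, rfl⟩ := exists_eq_cut α hα
    exact h₁ j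
  | k + 2 => exact (hC k).eq_of_src _ _

open Classical in
/-- The component of `levelDesc` on the summand of an epimorphism `[i] → [k]`. -/
def levelDescFun {i : ℕ} {Z : ModuleCat.{u} R} (f₀ : C.X 0 ⟶ Z) (f₁ : Fin i → (C.X 1 ⟶ Z)) :
    (k : ℕ) → (⦋i⦌ ⟶ ⦋k⦌) → (C.X k ⟶ Z) := fun k => match k with
  | 0 => fun _ => f₀
  | 1 => fun α => if h : ∃ j : Fin i, α = cut i (j + 1) then f₁ h.choose else 0
  | _ + 2 => fun _ => 0

/-- The map out of `(K C)_i` with prescribed restrictions along the degeneracies of `C_0` and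
`C_1`. -/
def levelDesc {i : ℕ} {Z : ModuleCat.{u} R} (f₀ : C.X 0 ⟶ Z) (f₁ : Fin i → (C.X 1 ⟶ Z)) :
    Γ₀.obj C _⦋i⦌ ⟶ Z :=
  (Γ₀.splitting C).desc (op ⦋i⦌) fun B => levelDescFun f₀ f₁ B.1.unop.len B.e

lemma degZero_levelDesc {i : ℕ} {Z : ModuleCat.{u} R} (f₀ : C.X 0 ⟶ Z) (f₁ : Fin i → (C.X 1 ⟶ Z)) :
    degZero C i ≫ levelDesc f₀ f₁ = f₀ := by
  have : Epi (SimplexCategory.const ⦋i⦌ ⦋0⦌ 0) := by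
    rw [SimplexCategory.epi_iff_surjective]
    exact fun t => ⟨0, Subsingleton.elim (α := Fin 1) _ _⟩
  exact (Γ₀.splitting C).ι_desc (op ⦋i⦌) (fun B => levelDescFun f₀ f₁ B.1.unop.len B.e)
    (Splitting.IndexSet.mk (SimplexCategory.const ⦋i⦌ ⦋0⦌ 0))

lemma degOne_levelDesc {i : ℕ} {Z : ModuleCat.{u} R} (f₀ : C.X 0 ⟶ Z) (f₁ : Fin i → (C.X 1 ⟶ Z))
    (j : Fin i) : degOne C i (j + 1) ≫ levelDesc f₀ f₁ = f₁ j := by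
  refine ((Γ₀.splitting C).ι_desc (op ⦋i⦌) (fun B => levelDescFun f₀ f₁ B.1.unop.len B.e)
    (Splitting.IndexSet.mk (cut i (j + 1)))).trans ?_
  have h : ∃ k : Fin i, cut i (j + 1) = cut i (k + 1) := ⟨j, rfl⟩
  refine (dif_pos h).trans ?_
  exact congrArg f₁ (cut_injective h.choose_spec).symm

end DoldKanLevel

/-! ### The weight grading of the symmetric algebra. -/

section Weight

variable {R : Type} [CommRing R] {M N : Type u} [AddCommGroup M] [Module R M] [AddCommGroup N]
  [Module R N]

/-- The map of algebras recording the weight as the exponent of an extra variable. -/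
def weightMap (R : Type) [CommRing R] (M : Type u) [AddCommGroup M] [Module R M] :
    SymmetricAlgebra R M →ₐ[R] Polynomial (SymmetricAlgebra R M) :=
  SymmetricAlgebra.lift ((LinearMap.restrictScalars R
    (Polynomial.monomial (R := SymmetricAlgebra R M) 1)).comp (SymmetricAlgebra.ι R M))

lemma weightMap_ι (x : M) : weightMap R M (SymmetricAlgebra.ι R M x) =
    Polynomial.monomial 1 (SymmetricAlgebra.ι R M x) :=
  SymmetricAlgebra.lift_ι_apply _ x

/-- The projection of the symmetric algebra onto its part of degree `m`. -/
def weightProj (m : ℕ) : SymmetricAlgebra R M →ₗ[R] SymmetricAlgebra R M :=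
  (LinearMap.restrictScalars R (Polynomial.lcoeff (SymmetricAlgebra R M) m)).comp
    (weightMap R M).toLinearMap

lemma weightProj_apply (m : ℕ) (z : SymmetricAlgebra R M) :
    weightProj m z = (weightMap R M z).coeff m :=
  rfl

lemma weightMap_of_mem {n : ℕ} {z : SymmetricAlgebra R M} (hz : z ∈ symPow R n M) :
    weightMap R M z = Polynomial.monomial n z := by
  induction n generalizing z with
  | zero =>
    obtain ⟨r, rfl⟩ := Submodule.mem_one.1 hz
    rw [AlgHom.commutes]
    rfl
  | succ n ih =>
    rw [symPow, pow_succ] at hz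
    induction hz using Submodule.mul_induction_on' with
    | mem_mul_mem a ha c hc =>
      obtain ⟨x, rfl⟩ := hc
      rw [map_mul, ih ha, weightMap_ι, Polynomial.monomial_mul_monomial]
    | add a _ c _ ha hc => rw [map_add, ha, hc, map_add]

lemma weightProj_of_mem {n : ℕ} {z : SymmetricAlgebra R M} (hz : z ∈ symPow R n M) :
    weightProj n z = z := by
  rw [weightProj_apply, weightMap_of_mem hz, Polynomial.coeff_monomial_same]

lemma weightProj_of_mem_of_ne {m n : ℕ} (hmn : n ≠ m) {z : SymmetricAlgebra R M}
    (hz : z ∈ symPow R n M) : weightProj m z = 0 := by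
  rw [weightProj_apply, weightMap_of_mem hz, Polynomial.coeff_monomial_of_ne _ hmn.symm]

lemma weightProj_mem (m : ℕ) (z : SymmetricAlgebra R M) : weightProj m z ∈ symPow R m M := by
  rw [weightProj_apply]
  induction z using SymmetricAlgebra.induction generalizing m with
  | algebraMap r =>
    rw [AlgHom.commutes, Polynomial.algebraMap_apply, Polynomial.coeff_C]
    split_ifs with h
    · rw [h]; exact Submodule.mem_one.2 ⟨r, rfl⟩
    · exact Submodule.zero_mem _
  | ι x =>
    rw [weightMap_ι, Polynomial.coeff_monomial]
    split_ifs with h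
    · rw [← h, symPow, pow_one]; exact ⟨x, rfl⟩
    · exact Submodule.zero_mem _
  | mul a c ha hc =>
    rw [map_mul, Polynomial.coeff_mul]
    refine Submodule.sum_mem _ fun q hq => ?_
    rw [← Finset.HasAntidiagonal.mem_antidiagonal.1 hq, symPow, pow_add]
    exact Submodule.mul_mem_mul (ha _) (hc _)
  | add a c ha hc =>
    rw [map_add, Polynomial.coeff_add]
    exact Submodule.add_mem _ (ha _) (hc _)

/-- Induced maps preserve weights. Applied to the faces, this lets chains built in the full
symmetric algebra be cut down to SP^m. -/
lemma weightProj_symMap (m : ℕ) (f : M →ₗ[R] N) (z : SymmetricAlgebra R M) :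
    weightProj m (symMap f z) = symMap f (weightProj m z) := by
  have h : (weightMap R N).comp (symMap f) =
      (Polynomial.mapAlgHom (symMap f)).comp (weightMap R M) := by
    refine SymmetricAlgebra.algHom_ext (LinearMap.ext fun x => ?_)
    change weightMap R N (symMap f (SymmetricAlgebra.ι R M x)) =
      Polynomial.map (symMap f : SymmetricAlgebra R M →+* SymmetricAlgebra R N)
        (weightMap R M (SymmetricAlgebra.ι R M x))
    rw [symMap_ι, weightMap_ι, weightMap_ι, Polynomial.map_monomial]
    exact congrArg _ (symMap_ι f x).symm
  have hz : weightMap R N (symMap f z) =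
      Polynomial.map (symMap f : SymmetricAlgebra R M →+* SymmetricAlgebra R N)
        (weightMap R M z) := congrArg (fun φ => φ z) h
  rw [weightProj_apply, hz, Polynomial.coeff_map]
  rfl

end Weight

/-! ### The symmetric algebra of K(A → A) as the polynomial model. -/

section SymPoly

open Opposite AlgebraicTopology.DoldKan Simplicial SimplicialObject

variable {A : Type u} [AddCommGroup A] {κ : Type u} (b : Module.Basis κ ℤ A) (p : ℕ)

/-- The modules of the simplicial module `K(A → A)`. -/
abbrev Level (A : Type u) [AddCommGroup A] (p i : ℕ) : Type u :=
  (Γ₀.obj (mulComplex A p) _⦋i⦌ : ModuleCat.{u} ℤ)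

/-- The degeneracies of `A` in degree `0`, as linear maps. -/
def baseVec (A : Type u) [AddCommGroup A] (p i : ℕ) : A →ₗ[ℤ] Level A p i :=
  (degZero (mulComplex A p) i).hom

/-- The degeneracies of `A` in degree `1`, as linear maps. -/
def edgeVec (A : Type u) [AddCommGroup A] (p i c : ℕ) : A →ₗ[ℤ] Level A p i :=
  (degOne (mulComplex A p) i c).hom

lemma isZero_mulComplex (k : ℕ) : Limits.IsZero ((mulComplex A p).X (k + 2)) :=
  ModuleCat.isZero_of_subsingleton (ModuleCat.of ℤ PUnit.{u + 1})

variable {p}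

lemma level_linearMap_ext {i : ℕ} {Z : Type u} [AddCommGroup Z] {f g : Level A p i →ₗ[ℤ] Z}
    (h₀ : ∀ a, f (baseVec A p i a) = g (baseVec A p i a))
    (h₁ : ∀ (j : Fin i) a, f (edgeVec A p i (j + 1) a) = g (edgeVec A p i (j + 1) a)) : f = g := by
  have h : ModuleCat.ofHom f = (ModuleCat.ofHom g : _ ⟶ ModuleCat.of ℤ Z) :=
    level_hom_ext (C := mulComplex A p) (isZero_mulComplex p)
      (ModuleCat.hom_ext (LinearMap.ext h₀)) fun j => ModuleCat.hom_ext (LinearMap.ext (h₁ j))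
  exact congrArg ModuleCat.Hom.hom h

lemma edgeVec_zero (i : ℕ) (a : A) : edgeVec A p i 0 a = baseVec A p i ((p : ℤ) • a) := by
  rw [← mulComplex_d]
  exact congrArg (fun f => f.hom a) (degOne_zero (C := mulComplex A p) i)

lemma edgeVec_last (i : ℕ) (a : A) : edgeVec A p i (i + 1) a = 0 :=
  congrArg (fun f => f.hom a) (degOne_last (C := mulComplex A p) i)

variable (p) in
/-- The linear map from `Level A p i` underlying the comparison with polynomials. -/
def levelToPoly (i : ℕ) : Level A p i →ₗ[ℤ] PolyLevel κ i :=
  (levelDesc (C := mulComplex A p) (i := i) (Z := ModuleCat.of ℤ (PolyLevel κ i))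
    (ModuleCat.ofHom (X := A) (levelForm b 1 i 0))
    fun j => ModuleCat.ofHom (X := A) (levelForm b 1 i (j + 1))).hom

lemma levelToPoly_baseVec (i : ℕ) (a : A) :
    levelToPoly b p i (baseVec A p i a) = levelForm b 1 i 0 a :=
  congrArg (fun f => f.hom a) (degZero_levelDesc (C := mulComplex A p) (i := i)
    (Z := ModuleCat.of ℤ (PolyLevel κ i)) (ModuleCat.ofHom (X := A) (levelForm b 1 i 0))
    fun j => ModuleCat.ofHom (X := A) (levelForm b 1 i (j + 1)))

lemma levelToPoly_edgeVec_succ (i : ℕ) (j : Fin i) (a : A) :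
    levelToPoly b p i (edgeVec A p i (j + 1) a) = levelForm b 1 i (j + 1) a :=
  congrArg (fun f => f.hom a) (degOne_levelDesc (C := mulComplex A p) (i := i)
    (Z := ModuleCat.of ℤ (PolyLevel κ i)) (ModuleCat.ofHom (X := A) (levelForm b 1 i 0))
    (fun j => ModuleCat.ofHom (X := A) (levelForm b 1 i (j + 1))) j)

/-- Here p enters as the parameter of the model: the edge vector of index 0 is ∂, hence p times a
base vector. The bound on c allows the other extreme index i + 1, where both sides vanish. -/
lemma levelToPoly_edgeVec (i : ℕ) {c : ℕ} (hc : c ≤ i + 1) (a : A) :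
    levelToPoly b p i (edgeVec A p i c a) = levelForm b p i c a := by
  rcases Nat.eq_zero_or_pos c with rfl | hpos
  · rw [edgeVec_zero, levelToPoly_baseVec, levelForm_zero, levelForm_zero, one_smul, map_smul]
  · obtain ⟨c, rfl⟩ := Nat.exists_eq_add_of_lt hpos
    rw [zero_add] at hc ⊢
    rcases Nat.lt_or_ge c i with h | h
    · rw [levelForm_succ b p 1]
      exact levelToPoly_edgeVec_succ b i ⟨c, h⟩ a
    · obtain rfl : c = i := by omega
      rw [edgeVec_last, map_zero, levelForm_of_lt b p (by omega)]

variable (p) in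
/-- The comparison of the symmetric algebra of `Level A p i` with a polynomial ring. -/
def symToPoly (i : ℕ) : SymmetricAlgebra ℤ (Level A p i) →ₐ[ℤ] PolyLevel κ i :=
  SymmetricAlgebra.lift (levelToPoly b p i)

lemma symToPoly_ι (i : ℕ) (v : Level A p i) :
    symToPoly b p i (SymmetricAlgebra.ι ℤ _ v) = levelToPoly b p i v :=
  SymmetricAlgebra.lift_ι_apply _ v

variable (p) in
/-- The inverse of `symToPoly`. -/
def polyToSym (i : ℕ) : PolyLevel κ i →+* SymmetricAlgebra ℤ (Level A p i) :=
  MvPolynomial.eval₂Hom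
    (MvPolynomial.eval₂Hom (Int.castRingHom _)
      fun x => SymmetricAlgebra.ι ℤ _ (baseVec A p i (b x)))
    fun v => SymmetricAlgebra.ι ℤ _ (edgeVec A p i (v.1 + 1) (b v.2))

lemma polyToSym_levelVar_zero (i : ℕ) (x : κ) : polyToSym b p i (levelVar 1 i 0 x) =
    SymmetricAlgebra.ι ℤ _ (baseVec A p i (b x)) := by
  rw [levelVar_zero, one_smul, polyToSym, MvPolynomial.coe_eval₂Hom, MvPolynomial.eval₂_C,
    MvPolynomial.coe_eval₂Hom, MvPolynomial.eval₂_X]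

lemma polyToSym_levelVar_succ (i : ℕ) (j : Fin i) (x : κ) :
    polyToSym b p i (levelVar 1 i (j + 1) x) =
      SymmetricAlgebra.ι ℤ _ (edgeVec A p i (j + 1) (b x)) := by
  rw [levelVar_succ, polyToSym, MvPolynomial.coe_eval₂Hom, MvPolynomial.eval₂_X]

lemma symToPoly_polyToSym (i : ℕ) (z : PolyLevel κ i) :
    symToPoly b p i (polyToSym b p i z) = z := by
  refine congrArg (fun f : _ →+* _ => f z) (polyLevel_ringHom_ext
    (f := (symToPoly b p i).toRingHom.comp (polyToSym b p i)) (g := RingHom.id _) fun j x => ?_)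
  change symToPoly b p i (polyToSym b p i (levelVar 1 i j x)) = levelVar 1 i j x
  rcases Nat.eq_zero_or_pos j with rfl | hj
  · rw [polyToSym_levelVar_zero, symToPoly_ι, levelToPoly_baseVec, levelForm_basis]
  · obtain ⟨j, rfl⟩ := Nat.exists_eq_add_of_lt hj
    rw [zero_add]
    rcases Nat.lt_or_ge j i with h | h
    · have h' := polyToSym_levelVar_succ (p := p) b i ⟨j, h⟩ x
      dsimp only at h'
      rw [h', symToPoly_ι, levelToPoly_edgeVec b i (by omega), levelForm_basis, levelVar_succ p
        (⟨j, h⟩ : Fin i), levelVar_succ 1 (⟨j, h⟩ : Fin i)]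
    · rw [levelVar_of_lt 1 (by omega), map_zero, map_zero]

lemma polyToSym_levelForm_zero (i : ℕ) (a : A) :
    polyToSym b p i (levelForm b 1 i 0 a) = SymmetricAlgebra.ι ℤ _ (baseVec A p i a) := by
  suffices h : ((polyToSym b p i).toAddMonoidHom.toIntLinearMap).comp (levelForm b 1 i 0) =
      (SymmetricAlgebra.ι ℤ _).comp (baseVec A p i) from congrArg (fun g => g a) h
  refine b.ext fun x => ?_
  rw [LinearMap.comp_apply, levelForm_basis]
  exact polyToSym_levelVar_zero b i x

lemma polyToSym_levelForm_succ (i : ℕ) (j : Fin i) (a : A) :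
    polyToSym b p i (levelForm b 1 i (j + 1) a) =
      SymmetricAlgebra.ι ℤ _ (edgeVec A p i (j + 1) a) := by
  suffices h : ((polyToSym b p i).toAddMonoidHom.toIntLinearMap).comp (levelForm b 1 i (j + 1)) =
      (SymmetricAlgebra.ι ℤ _).comp (edgeVec A p i (j + 1)) from congrArg (fun g => g a) h
  refine b.ext fun x => ?_
  rw [LinearMap.comp_apply, levelForm_basis]
  exact polyToSym_levelVar_succ b i j x

lemma polyToSym_symToPoly (i : ℕ) (z : SymmetricAlgebra ℤ (Level A p i)) :
    polyToSym b p i (symToPoly b p i z) = z := by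
  let F : SymmetricAlgebra ℤ (Level A p i) →ₐ[ℤ] SymmetricAlgebra ℤ (Level A p i) :=
    ((polyToSym b p i).comp (symToPoly b p i).toRingHom).toIntAlgHom
  have h : F = AlgHom.id ℤ _ := by
    refine SymmetricAlgebra.algHom_ext (level_linearMap_ext (fun a => ?_) fun j a => ?_)
    · change polyToSym b p i (symToPoly b p i (SymmetricAlgebra.ι ℤ _ (baseVec A p i a))) = _
      rw [symToPoly_ι, levelToPoly_baseVec, polyToSym_levelForm_zero]
      rfl
    · change polyToSym b p i (symToPoly b p i (SymmetricAlgebra.ι ℤ _ (edgeVec A p i (j + 1) a))) = _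
      rw [symToPoly_ι, levelToPoly_edgeVec_succ, polyToSym_levelForm_succ]
      rfl
  exact congrArg (fun f => f z) h

lemma symToPoly_injective (i : ℕ) : Function.Injective (symToPoly b p i) :=
  Function.LeftInverse.injective (polyToSym_symToPoly b i)

/-- Identifies the Dold–Puppe faces with those of the model for q = p, by comparing them on base and
edge vectors. -/
lemma symToPoly_symMap (i : ℕ) (k : Fin (i + 2)) (z : SymmetricAlgebra ℤ (Level A p (i + 1))) :
    symToPoly b p i (symMap ((Γ₀.obj (mulComplex A p)).δ k).hom z) =
      polyFace p i k (symToPoly b p (i + 1) z) := by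
  have h : (symToPoly b p i).comp (symMap ((Γ₀.obj (mulComplex A p)).δ k).hom) =
      ((polyFace (p : ℤ) i k).restrictScalars ℤ).comp (symToPoly b p (i + 1)) := by
    refine SymmetricAlgebra.algHom_ext (level_linearMap_ext (fun a => ?_) fun j a => ?_)
    · change symToPoly b p i (symMap ((Γ₀.obj (mulComplex A p)).δ k).hom
          (SymmetricAlgebra.ι ℤ _ (baseVec A p (i + 1) a))) =
        polyFace p i k (symToPoly b p (i + 1) (SymmetricAlgebra.ι ℤ _ (baseVec A p (i + 1) a)))
      have hf : ((Γ₀.obj (mulComplex A p)).δ k).hom (baseVec A p (i + 1) a) = baseVec A p i a :=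
        congrArg (fun f => f.hom a) (degZero_face (C := mulComplex A p) i k)
      rw [symMap_ι, symToPoly_ι, hf, symToPoly_ι, levelToPoly_baseVec, levelToPoly_baseVec,
        levelForm_zero, levelForm_zero]
      exact ((polyFace (p : ℤ) i k).commutes _).symm
    · change symToPoly b p i (symMap ((Γ₀.obj (mulComplex A p)).δ k).hom
          (SymmetricAlgebra.ι ℤ _ (edgeVec A p (i + 1) (j + 1) a))) =
        polyFace p i k (symToPoly b p (i + 1) (SymmetricAlgebra.ι ℤ _ (edgeVec A p (i + 1) (j + 1) a)))
      have hf : ((Γ₀.obj (mulComplex A p)).δ k).hom (edgeVec A p (i + 1) (j + 1) a) =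
          edgeVec A p i (if (j : ℕ) + 1 ≤ k then j + 1 else j + 1 - 1) a :=
        congrArg (fun f => f.hom a) (degOne_face (C := mulComplex A p) i (j + 1) k)
      rw [symMap_ι, symToPoly_ι, hf, symToPoly_ι, levelToPoly_edgeVec b i (by split_ifs <;> omega),
        levelToPoly_edgeVec b (i + 1) (by omega), polyFace_levelForm]
  exact congrArg (fun f => f z) h

end SymPoly

/-! ### Symmetric multilinear maps as linear maps on polynomials. -/

section SymmetricMultilinear

open MvPolynomial

variable {A : Type u} [AddCommGroup A] {κ : Type u}

/-- Equal exponents mean that the fibres of the two families have equal cardinalities; bijections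
between the fibres assemble to a permutation. -/
lemma exists_perm_of_sum_single_eq {r : ℕ} {c c' : Fin r → κ}
    (h : ∑ j, Finsupp.single (c j) (1 : ℕ) = ∑ j, Finsupp.single (c' j) 1) :
    ∃ σ : Equiv.Perm (Fin r), c' ∘ σ = c := by
  classical
  have hcard (d : Fin r → κ) (x : κ) :
      (∑ j, Finsupp.single (d j) (1 : ℕ)) x = Fintype.card {j // d j = x} := by
    rw [Finsupp.finsetSum_apply, Fintype.card_subtype, Finset.card_filter]
    exact Finset.sum_congr rfl fun j _ => Finsupp.single_apply
  have he (x : κ) : Nonempty ({j // c j = x} ≃ {j // c' j = x}) :=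
    ⟨Fintype.equivOfCardEq (by rw [← hcard, ← hcard, h])⟩
  exact ⟨Equiv.ofFiberEquiv fun x => (he x).some,
    funext fun j => Equiv.ofFiberEquiv_map (fun x => (he x).some) j⟩

lemma prod_X_eq_monomial {r : ℕ} (c : Fin r → κ) :
    ∏ j, (X (c j) : MvPolynomial κ ℤ) = monomial (∑ j, Finsupp.single (c j) 1) 1 := by
  rw [monomial_sum_one]
  rfl

variable (b : Module.Basis κ ℤ A)

/-- The product of linear forms, as a multilinear map. -/
def linFormProd (r : ℕ) : MultilinearMap ℤ (fun _ : Fin r => A) (MvPolynomial κ ℤ) :=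
  (MultilinearMap.mkPiAlgebra ℤ (Fin r) (MvPolynomial κ ℤ)).compLinearMap fun _ => linForm b

lemma linFormProd_apply {r : ℕ} (y : Fin r → A) : linFormProd b r y = ∏ j, linForm b (y j) :=
  rfl

lemma linFormProd_basis {r : ℕ} (c : Fin r → κ) :
    linFormProd b r (fun j => b (c j)) = monomial (∑ j, Finsupp.single (c j) 1) 1 := by
  rw [linFormProd_apply, ← prod_X_eq_monomial]
  exact Finset.prod_congr rfl fun j _ => linForm_basis b _

lemma linFormProd_isHomogeneous {r : ℕ} (y : Fin r → A) :
    (linFormProd b r y).IsHomogeneous r := by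
  have h1 (a : A) : (linForm b a).IsHomogeneous 1 := by
    have h : linForm b a ∈ homogeneousSubmodule κ ℤ 1 := by
      rw [← b.linearCombination_repr a, Finsupp.linearCombination_apply, Finsupp.sum, map_sum]
      refine Submodule.sum_mem _ fun x _ => ?_
      rw [map_smul, linForm_basis]
      exact Submodule.smul_mem _ _ (isHomogeneous_X ℤ x)
    exact h
  rw [linFormProd_apply]
  simpa using IsHomogeneous.prod Finset.univ (fun j => linForm b (y j)) (fun _ => 1) fun j _ => h1 _

open Classical in
/-- The linear map on polynomials defined by a symmetric multilinear map. -/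
def ofSymmetric {N : Type*} [AddCommGroup N] {r : ℕ} (F : MultilinearMap ℤ (fun _ : Fin r => A) N) :
    MvPolynomial κ ℤ →ₗ[ℤ] N :=
  (basisMonomials κ ℤ).constr ℤ fun a =>
    if h : ∃ c : Fin r → κ, ∑ j, Finsupp.single (c j) 1 = a then F fun j => b (h.choose j) else 0

lemma ofSymmetric_monomial {N : Type*} [AddCommGroup N] {r : ℕ}
    (F : MultilinearMap ℤ (fun _ : Fin r => A) N) (a : κ →₀ ℕ) :
    ofSymmetric b F (monomial a 1) = open Classical in
      if h : ∃ c : Fin r → κ, ∑ j, Finsupp.single (c j) 1 = a then F fun j => b (h.choose j)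
      else 0 := by
  have h := (basisMonomials κ ℤ).constr_basis ℤ (fun a => open Classical in
    if h : ∃ c : Fin r → κ, ∑ j, Finsupp.single (c j) 1 = a then F fun j => b (h.choose j) else 0) a
  rwa [coe_basisMonomials] at h

/-- By multilinearity it suffices to test basis vectors, where symmetry makes the chosen ordering of
the variables of a monomial irrelevant. -/
lemma ofSymmetric_linFormProd {N : Type*} [AddCommGroup N] {r : ℕ}
    (F : MultilinearMap ℤ (fun _ : Fin r => A) N)
    (hF : ∀ (y : Fin r → A) (σ : Equiv.Perm (Fin r)), F (y ∘ σ) = F y) (y : Fin r → A) :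
    ofSymmetric b F (linFormProd b r y) = F y := by
  suffices h : (ofSymmetric b F).compMultilinearMap (linFormProd b r) = F from
    congrArg (fun f => f y) h
  refine Module.Basis.ext_multilinear (fun _ => b) fun c => ?_
  rw [LinearMap.compMultilinearMap_apply, linFormProd_basis, ofSymmetric_monomial]
  have h : ∃ c' : Fin r → κ, ∑ j, Finsupp.single (c' j) (1 : ℕ) = ∑ j, Finsupp.single (c j) 1 :=
    ⟨c, rfl⟩
  rw [dif_pos h]
  obtain ⟨σ, hσ⟩ := exists_perm_of_sum_single_eq h.choose_spec
  have h' := hF (fun j => b (c j)) σ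
  rw [← h', ← hσ]
  rfl

lemma ofSymmetric_linFormProd_of_ne {N : Type*} [AddCommGroup N] {r d : ℕ} (hd : d ≠ r)
    (F : MultilinearMap ℤ (fun _ : Fin r => A) N) (y : Fin d → A) :
    ofSymmetric b F (linFormProd b d y) = 0 := by
  suffices h : (ofSymmetric b F).compMultilinearMap (linFormProd b d) = 0 from
    congrArg (fun f => f y) h
  refine Module.Basis.ext_multilinear (fun _ => b) fun c => ?_
  rw [LinearMap.compMultilinearMap_apply, linFormProd_basis, ofSymmetric_monomial, dif_neg]
  · rfl
  · rintro ⟨c', hc'⟩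
    have h := congrArg Finsupp.degree hc'
    simp only [map_sum, Finsupp.degree_single, Finset.sum_const, Finset.card_univ, Fintype.card_fin,
      smul_eq_mul, mul_one] at h
    exact hd h.symm

/-- The tensor of a product of linear forms and a wedge. -/
def formTmul {r i : ℕ} (x : Fin i → A) (y : Fin r → A) : MvPolynomial κ ℤ ⊗[ℤ] ⋀[ℤ]^i A :=
  linFormProd b r y ⊗ₜ exteriorPower.ιMulti ℤ i x

lemma polynomial_hom_ext {N : Type*} [AddCommGroup N] {f g : MvPolynomial κ ℤ →+ N}
    (h : ∀ (r : ℕ) (y : Fin r → A), f (linFormProd b r y) = g (linFormProd b r y)) : f = g := by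
  have hs : f.toIntLinearMap = g.toIntLinearMap := by
    refine (basisMonomials κ ℤ).ext fun a => ?_
    rw [coe_basisMonomials]
    change f (monomial a 1) = g (monomial a 1)
    have ha : ∃ (r : ℕ) (c : Fin r → κ), ∑ j, Finsupp.single (c j) 1 = a := by
      induction a using Finsupp.induction_linear with
      | zero => exact ⟨0, Fin.elim0, by simp⟩
      | add a a' ha ha' =>
        obtain ⟨r, c, rfl⟩ := ha
        obtain ⟨r', c', rfl⟩ := ha'
        exact ⟨r + r', Fin.append c c', by simp [Fin.sum_univ_add]⟩
      | single x n => exact ⟨n, fun _ => x, by simp⟩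
    obtain ⟨r, c, rfl⟩ := ha
    rw [← linFormProd_basis b]
    exact h r _
  exact AddMonoidHom.ext fun z => congrArg (fun φ => φ z) hs

/-- Additive maps on `S ⊗ Λ^i(A)` agree if they agree on tensors of products of linear forms and
wedges. -/
lemma formTmul_hom_ext {N : Type*} [AddCommGroup N] {i : ℕ}
    {f g : MvPolynomial κ ℤ ⊗[ℤ] ⋀[ℤ]^i A →+ N}
    (h : ∀ (r : ℕ) (x : Fin i → A) (y : Fin r → A), f (formTmul b x y) = g (formTmul b x y)) :
    f = g := by
  refine koszul_hom_ext fun s v => ?_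
  let T : MvPolynomial κ ℤ →+ MvPolynomial κ ℤ ⊗[ℤ] ⋀[ℤ]^i A :=
    ((TensorProduct.mk ℤ (MvPolynomial κ ℤ) (⋀[ℤ]^i A)).flip
      (exteriorPower.ιMulti ℤ i v)).toAddMonoidHom
  exact congrArg (fun φ : _ →+ _ => φ s) (polynomial_hom_ext b (f := f.comp T) (g := g.comp T)
    fun r y => h r v y)

/-- The Koszul differential moves one x_k from the wedge into the product, which is exactly the
shape of the Jacobi relation for η. -/
lemma koszul_formTmul {r i : ℕ} (x : Fin (i + 1) → A) (y : Fin r → A) :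
    koszul b i (formTmul b x y) = ∑ k : Fin (i + 1), (-1 : ℤ) ^ (k : ℕ) •
      formTmul b (fun j => x (k.succAbove j)) (Fin.cons (x k) y : Fin (r + 1) → A) := by
  rw [formTmul, koszul_apply]
  refine Finset.sum_congr rfl fun k _ => ?_
  rw [formTmul, linFormProd_apply, linFormProd_apply, Fin.prod_univ_succ, mul_comm]
  simp

/-- A multilinear map changes by a multiple of `p` when its arguments do. -/
lemma multilinear_sub_eq_smul {N : Type*} [AddCommGroup N] {r : ℕ} (p : ℤ)
    (F : MultilinearMap ℤ (fun _ : Fin r => A) N) {x x' : Fin r → A}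
    (h : ∀ k, ∃ a, x' k = x k + p • a) : ∃ n, F x' = F x + p • n := by
  classical
  choose a ha using h
  -- The arguments are changed one at a time, along the finite set s of those already changed.
  have key (s : Finset (Fin r)) : ∃ n, F (s.piecewise x' x) = F x + p • n := by
    induction s using Finset.induction_on with
    | empty => exact ⟨0, by simp⟩
    | insert k s hk ih =>
      obtain ⟨n, hn⟩ := ih
      refine ⟨n + F (Function.update (s.piecewise x' x) k (a k)), ?_⟩
      rw [Finset.piecewise_insert, ha, F.map_update_add, F.map_update_smul, smul_add, ← add_assoc,
        ← hn]
      congr 2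
      rw [Function.update_eq_self_iff, Finset.piecewise_eq_of_notMem _ _ _ hk]
  obtain ⟨n, hn⟩ := key Finset.univ
  exact ⟨n, by rw [← hn, Finset.piecewise_univ]⟩

lemma exists_formTmul_eq_add {r i : ℕ} (p : ℤ) {x x' : Fin i → A} {y y' : Fin r → A}
    (hx : ∀ k, ∃ a, x' k = x k + p • a) (hy : ∀ k, ∃ a, y' k = y k + p • a) :
    ∃ t, formTmul b x' y' = formTmul b x y + p • t := by
  obtain ⟨v, hv⟩ := multilinear_sub_eq_smul p (exteriorPower.ιMulti ℤ i).toMultilinearMap hx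
  obtain ⟨s, hs⟩ := multilinear_sub_eq_smul p (linFormProd b r) hy
  change exteriorPower.ιMulti ℤ i x' = exteriorPower.ιMulti ℤ i x + p • v at hv
  refine ⟨s ⊗ₜ exteriorPower.ιMulti ℤ i x' + linFormProd b r y ⊗ₜ v, ?_⟩
  have h1 : formTmul b x' y' = linFormProd b r y ⊗ₜ exteriorPower.ιMulti ℤ i x' +
      p • (s ⊗ₜ exteriorPower.ιMulti ℤ i x') := by
    rw [formTmul, hs, TensorProduct.add_tmul, ← TensorProduct.smul_tmul']
  have h2 : linFormProd b r y ⊗ₜ exteriorPower.ιMulti ℤ i x' =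
      formTmul b x y + p • (linFormProd b r y ⊗ₜ[ℤ] v) := by
    rw [formTmul, hv, TensorProduct.tmul_add, TensorProduct.tmul_smul]
  rw [h1, h2, smul_add, add_assoc, add_comm (p • (linFormProd b r y ⊗ₜ[ℤ] v))]

end SymmetricMultilinear

/-! ### From alternating-symmetric data to maps on S ⊗ Λ. -/

section Extension

variable {A : Type u} [AddCommGroup A] {κ : Type u} (b : Module.Basis κ ℤ A)

/-- A function of `x` and `y` that is multilinear, alternating in `x` and symmetric in `y` extends to
`S ⊗ Λ^i(A)`, and vanishes in the other degrees. -/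
lemma exists_formTmul_hom {N : Type u} [AddCommGroup N] {i r : ℕ}
    (F : (Fin i → A) → (Fin r → A) → N)
    (hx : ∀ x y k a c, F (Function.update x k (a + c)) y =
      F (Function.update x k a) y + F (Function.update x k c) y)
    (hy : ∀ x y k a c, F x (Function.update y k (a + c)) =
      F x (Function.update y k a) + F x (Function.update y k c))
    (halt : ∀ x y k l, x k = x l → k ≠ l → F x y = 0)
    (hperm : ∀ x y (σ : Equiv.Perm (Fin r)), F x (y ∘ σ) = F x y) :
    ∃ G : MvPolynomial κ ℤ ⊗[ℤ] ⋀[ℤ]^i A →+ N, (∀ x y, G (formTmul b x y) = F x y) ∧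
      ∀ (d : ℕ) (x : Fin i → A) (y : Fin d → A), d ≠ r → G (formTmul b x y) = 0 := by
  let Fx (y : Fin r → A) : A [⋀^Fin i]→ₗ[ℤ] N :=
    { toFun := fun x => F x y
      map_update_add' := fun {inst} x k a c => by
        -- The multilinear map structure quantifies over decidability instances; they all agree with
        -- the standard one appearing in the hypotheses.
        obtain rfl : inst = instDecidableEqFin i := Subsingleton.elim _ _
        exact hx x y k a c
      map_update_smul' := fun {inst} x k c a => by
        obtain rfl : inst = instDecidableEqFin i := Subsingleton.elim _ _
        exact map_zsmul (AddMonoidHom.mk' (fun a => F (Function.update x k a) y) (hx x y k)) c a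
      map_eq_zero_of_eq' := fun x k l h hne => halt x y k l h hne }
  let Fy : MultilinearMap ℤ (fun _ : Fin r => A) (A [⋀^Fin i]→ₗ[ℤ] N) :=
    { toFun := Fx
      map_update_add' := fun {inst} y k a c => by
        obtain rfl : inst = instDecidableEqFin r := Subsingleton.elim _ _
        exact AlternatingMap.ext fun x => hy x y k a c
      map_update_smul' := fun {inst} y k c a => by
        obtain rfl : inst = instDecidableEqFin r := Subsingleton.elim _ _
        exact AlternatingMap.ext fun x =>
          map_zsmul (AddMonoidHom.mk' (fun a => F x (Function.update y k a)) (hy x y k)) c a }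
  let G : MvPolynomial κ ℤ ⊗[ℤ] ⋀[ℤ]^i A →ₗ[ℤ] N := TensorProduct.lift
    ((exteriorPower.alternatingMapLinearEquiv (R := ℤ) (M := A) (N := N) (n := i)).toLinearMap.comp
      (ofSymmetric b Fy))
  have hG {d : ℕ} (x : Fin i → A) (y : Fin d → A) :
      G (formTmul b x y) = ofSymmetric b Fy (linFormProd b d y) x :=
    exteriorPower.alternatingMapLinearEquiv_apply_ιMulti _ _
  refine ⟨G.toAddMonoidHom, fun x y => (hG x y).trans ?_, fun d x y hd => (hG x y).trans ?_⟩
  · rw [ofSymmetric_linFormProd b Fy fun y σ => AlternatingMap.ext fun x => hperm x y σ]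
    rfl
  · rw [ofSymmetric_linFormProd_of_ne b hd]
    rfl

end Extension

/-! ### The homomorphism defined by the classes of η. -/

section EtaHom

variable {A : Type u} [AddCommGroup A] [Module.Free ℤ A] {κ : Type u} (b : Module.Basis κ ℤ A)
  {p n m i r : ℕ} (hp : p.Prime) (hn : n = p * m) (h : m = i + 1 + r)

lemma exists_etaHom : ∃ G : MvPolynomial κ ℤ ⊗[ℤ] ⋀[ℤ]^(i + 1) A →+ (dualDeRham ℤ A n).homology i,
    (∀ x y, G (formTmul b x y) = etaClass hp hn h x y) ∧
      ∀ (d : ℕ) (x : Fin (i + 1) → A) (y : Fin d → A), d ≠ r → G (formTmul b x y) = 0 :=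
  exists_formTmul_hom b (etaClass hp hn h) (etaClass_update_add_left hp hn h)
    (etaClass_update_add_right hp hn h)
    (fun x y _ _ hkl hne => etaClass_eq_zero_of_eq hp hn h x y hkl hne)
    (etaClass_comp_perm hp hn h)

/-- The map `S ⊗ Λ^{i+1}(A) → H_i C^n(A)` defined by the classes of the elements `eta`. -/
def etaHom : MvPolynomial κ ℤ ⊗[ℤ] ⋀[ℤ]^(i + 1) A →+ (dualDeRham ℤ A n).homology i :=
  (exists_etaHom b hp hn h).choose

lemma etaHom_formTmul (x : Fin (i + 1) → A) (y : Fin r → A) :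
    etaHom b hp hn h (formTmul b x y) = etaClass hp hn h x y :=
  (exists_etaHom b hp hn h).choose_spec.1 x y

lemma etaHom_formTmul_of_ne {d : ℕ} (x : Fin (i + 1) → A) (y : Fin d → A) (hd : d ≠ r) :
    etaHom b hp hn h (formTmul b x y) = 0 :=
  (exists_etaHom b hp hn h).choose_spec.2 d x y hd

lemma etaHom_smul (t : MvPolynomial κ ℤ ⊗[ℤ] ⋀[ℤ]^(i + 1) A) :
    etaHom b hp hn h ((p : ℤ) • t) = 0 := by
  refine congrArg (fun f : _ →+ _ => f t) (formTmul_hom_ext b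
    (f := (etaHom b hp hn h).comp (DistribSMul.toAddMonoidHom _ (p : ℤ))) (g := 0) fun d x y => ?_)
  change etaHom b hp hn h ((p : ℤ) • formTmul b x y) = 0
  rw [map_zsmul]
  by_cases hd : d = r
  · subst hd
    rw [etaHom_formTmul]
    exact smul_etaClass hp hn h x y
  · rw [etaHom_formTmul_of_ne b hp hn h x y hd]
    exact zsmul_zero _

/-- On a tensor of forms and a wedge of the right degree this is the Jacobi relation; in other
degrees every term is zero by the choice of the extension. -/
lemma etaHom_koszul (t : MvPolynomial κ ℤ ⊗[ℤ] ⋀[ℤ]^(i + 2) A) :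
    etaHom b hp hn h (koszul b (i + 1) t) = 0 := by
  refine congrArg (fun f : _ →+ _ => f t) (formTmul_hom_ext b
    (f := (etaHom b hp hn h).comp (koszul b (i + 1)).toAddMonoidHom) (g := 0) fun d x y => ?_)
  change etaHom b hp hn h (koszul b (i + 1) (formTmul b x y)) = 0
  rw [koszul_formTmul, map_sum]
  by_cases hd : d + 1 = r
  · subst hd
    refine Eq.trans (Finset.sum_congr rfl fun k _ => ?_)
      (etaClass_jacobi hp hn (show m = i + 2 + d by omega) x y)
    rw [map_zsmul, etaHom_formTmul]
  · refine Finset.sum_eq_zero fun k _ => ?_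
    rw [map_zsmul, etaHom_formTmul_of_ne b hp hn h _ _ hd]
    exact zsmul_zero _

end EtaHom

/-! ### The homomorphism defined by the symbols β_p, and its surjectivity. -/

section BetaHom

open Opposite AlgebraicTopology.DoldKan Simplicial SimplicialObject

variable {A : Type u} [AddCommGroup A] {κ : Type u} (b : Module.Basis κ ℤ A) {p : ℕ}

lemma alternating_sum_apply {R : Type} [CommRing R] {M N : ModuleCat.{u} R} {n : ℕ}
    (f : Fin n → (M ⟶ N)) (z : M) : (∑ k : Fin n, (-1 : ℤ) ^ (k : ℕ) • f k).hom z =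
      ∑ k : Fin n, (-1 : ℤ) ^ (k : ℕ) • (f k).hom z := by
  rw [ModuleCat.hom_sum, LinearMap.sum_apply]
  refine Finset.sum_congr rfl fun k _ => ?_
  rw [ModuleCat.hom_zsmul, LinearMap.smul_apply]

lemma doldPuppe_d_coe {R : Type} [CommRing R] (C : ChainComplex (ModuleCat.{u} R) ℕ) (m i : ℕ)
    (w : symPow R m (Γ₀.obj C _⦋i + 1⦌)) :
    (((doldPuppe (SP R m) C).d (i + 1) i).hom w : symPow R m (Γ₀.obj C _⦋i⦌)).1 =
      ∑ k : Fin (i + 2), (-1 : ℤ) ^ (k : ℕ) • symMap ((Γ₀.obj C).δ k).hom w.1 := by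
  have hd : (doldPuppe (SP R m) C).d (i + 1) i = _ :=
    AlgebraicTopology.alternatingFaceMapComplex_obj_d _ i
  refine (congrArg (fun g => (g.hom w : symPow R m (Γ₀.obj C _⦋i⦌)).1) hd).trans ?_
  refine (congrArg (fun z : symPow R m (Γ₀.obj C _⦋i⦌) => z.1) (alternating_sum_apply
    (fun k : Fin (i + 2) => (((SimplicialObject.whiskering _ _).obj (SP R m)).obj (Γ₀.obj C)).δ k)
    w)).trans ?_
  exact AddSubmonoidClass.coe_finsetSum _ _

lemma symToPoly_sum_symMap (i : ℕ) (z : SymmetricAlgebra ℤ (Level A p (i + 1))) :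
    symToPoly b p i (∑ k : Fin (i + 2), (-1 : ℤ) ^ (k : ℕ) •
      symMap ((Γ₀.obj (mulComplex A p)).δ k).hom z) = polyD p i (symToPoly b p (i + 1) z) := by
  rw [map_sum, polyD_apply]
  refine Finset.sum_congr rfl fun k _ => ?_
  rw [map_zsmul, symToPoly_symMap]

lemma sum_symMap_weightProj (m i : ℕ) (z : SymmetricAlgebra ℤ (Level A p (i + 1))) :
    ∑ k : Fin (i + 2), (-1 : ℤ) ^ (k : ℕ) •
      symMap ((Γ₀.obj (mulComplex A p)).δ k).hom (weightProj m z) =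
    weightProj m (∑ k : Fin (i + 2), (-1 : ℤ) ^ (k : ℕ) •
      symMap ((Γ₀.obj (mulComplex A p)).δ k).hom z) := by
  rw [map_sum]
  refine Finset.sum_congr rfl fun k _ => ?_
  rw [map_zsmul, weightProj_symMap]

variable (p) in
/-- The element of the symmetric algebra attached to a Koszul chain. -/
def koszulToSym (i : ℕ) (t : MvPolynomial κ ℤ ⊗[ℤ] ⋀[ℤ]^(i + 1) A) :
    SymmetricAlgebra ℤ (Level A p i) :=
  polyToSym b p i (koszulToPoly b i (koszul b i t))

lemma symToPoly_koszulToSym (i : ℕ) (t : MvPolynomial κ ℤ ⊗[ℤ] ⋀[ℤ]^(i + 1) A) :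
    symToPoly b p i (koszulToSym b p i t) = koszulToPoly b i (koszul b i t) :=
  symToPoly_polyToSym b i _

lemma koszulToSym_add (i : ℕ) (t t' : MvPolynomial κ ℤ ⊗[ℤ] ⋀[ℤ]^(i + 1) A) :
    koszulToSym b p i (t + t') = koszulToSym b p i t + koszulToSym b p i t' := by
  simp only [koszulToSym, map_add]

/-- The symmetric algebra element attached to a tensor of linear forms and a wedge represents the
symbol `β_p`. -/
lemma koszulToSym_formTmul {m i r : ℕ} (h : m = i + 1 + r) (x : Fin (i + 1) → A) (y : Fin r → A) :
    koszulToSym b p i (formTmul b x y) =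
      (show symPow ℤ m (Level A p i) from betaChain (C := mulComplex A p) h x x y).1 := by
  refine symToPoly_injective b i ((symToPoly_koszulToSym b i _).trans ?_)
  change _ = symToPoly b p i ((betaMatrix (C := mulComplex A p) x x).det *
    ∏ j, SymmetricAlgebra.ι ℤ (Level A p i) (baseVec A p i (y j)))
  rw [formTmul, koszulToPoly_koszul, map_mul, AlgHom.map_det, map_prod, MvPolynomial.smul_eq_C_mul,
    mul_comm]
  congr 1
  · congr 1
    ext1 k j
    refine Fin.cases ?_ (fun j => ?_) j
    · change levelForm b 1 i 0 (x k) =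
        symToPoly b p i (SymmetricAlgebra.ι ℤ _ (baseVec A p i (x k)))
      rw [symToPoly_ι, levelToPoly_baseVec]
    · change levelForm b 1 i (j + 1) (x k) =
        symToPoly b p i (SymmetricAlgebra.ι ℤ _ (edgeVec A p i (j + 1) (x k)))
      rw [symToPoly_ι, levelToPoly_edgeVec_succ]
  · rw [linFormProd_apply, map_prod]
    refine Finset.prod_congr rfl fun j _ => ?_
    rw [symToPoly_ι, levelToPoly_baseVec, levelForm_zero, one_smul]

lemma koszulToSym_formTmul_mem {i r : ℕ} (x : Fin (i + 1) → A) (y : Fin r → A) :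
    koszulToSym b p i (formTmul b x y) ∈ symPow ℤ (i + 1 + r) (Level A p i) := by
  rw [koszulToSym_formTmul b rfl]
  exact Subtype.property _

lemma sum_symMap_koszulToSym (i : ℕ) (t : MvPolynomial κ ℤ ⊗[ℤ] ⋀[ℤ]^(i + 2) A) :
    ∑ k : Fin (i + 2), (-1 : ℤ) ^ (k : ℕ) •
      symMap ((Γ₀.obj (mulComplex A p)).δ k).hom (koszulToSym b p (i + 1) t) = 0 := by
  refine symToPoly_injective b i ?_
  rw [symToPoly_sum_symMap, symToPoly_koszulToSym, polyD_koszulToPoly, koszul_koszul, map_zero,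
    smul_zero, map_zero]

variable (p) in
/-- The chain of degree `m` attached to a Koszul chain. -/
def koszulChain (m i : ℕ) (t : MvPolynomial κ ℤ ⊗[ℤ] ⋀[ℤ]^(i + 1) A) :
    (doldPuppe (SP ℤ m) (mulComplex A p)).X i :=
  show symPow ℤ m (Level A p i) from
    ⟨weightProj m (koszulToSym b p i t), weightProj_mem m _⟩

lemma koszulChain_mem (m i : ℕ) (t : MvPolynomial κ ℤ ⊗[ℤ] ⋀[ℤ]^(i + 1) A) :
    koszulChain b p m i t ∈ cycleSubmodule (doldPuppe (SP ℤ m) (mulComplex A p)) i := by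
  refine mem_cycleSubmodule.2 fun j => ?_
  by_cases hij : j + 1 = i
  · subst hij
    refine Subtype.ext ((doldPuppe_d_coe (mulComplex A p) m j _).trans ?_)
    refine (sum_symMap_weightProj m j _).trans ?_
    rw [sum_symMap_koszulToSym, map_zero]
    rfl
  · rw [(doldPuppe (SP ℤ m) (mulComplex A p)).shape i j hij]
    rfl

variable (p) in
/-- The map `S ⊗ Λ^{i+1}(A) → L_i SP^m(A ⊗ ℤ/p)` defined by the symbols `β_p`. -/
def betaHom (m i : ℕ) : MvPolynomial κ ℤ ⊗[ℤ] ⋀[ℤ]^(i + 1) A →+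
    (doldPuppe (SP ℤ m) (mulComplex A p)).homology i :=
  (classMap (doldPuppe (SP ℤ m) (mulComplex A p)) i).toAddMonoidHom.comp
    (AddMonoidHom.mk' (fun t => ⟨koszulChain b p m i t, koszulChain_mem b m i t⟩) fun t t' =>
      Subtype.ext (Subtype.ext (by
        change weightProj m _ = weightProj m _ + weightProj m _
        rw [koszulToSym_add, map_add])))

lemma betaHom_apply (m i : ℕ) (t : MvPolynomial κ ℤ ⊗[ℤ] ⋀[ℤ]^(i + 1) A) :
    betaHom b p m i t = classMap (doldPuppe (SP ℤ m) (mulComplex A p)) i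
      ⟨koszulChain b p m i t, koszulChain_mem b m i t⟩ :=
  rfl

lemma betaHom_formTmul [Module.Free ℤ A] [NeZero p] {m i r : ℕ} (h : m = i + 1 + r)
    (x : Fin (i + 1) → A) (y : Fin r → A) :
    betaHom b p m i (formTmul b x y) = betaClass p h x y := by
  refine (congrArg (classMap (doldPuppe (SP ℤ m) (mulComplex A p)) i)
    (Subtype.ext (Subtype.ext ?_))).trans (classMap_apply
      (betaChain (C := mulComplex A p) h x x y)
      (betaChain_cycle (C := mulComplex A p) h x x y (p : ℤ) fun k => mulComplex_d (x k)))
  change weightProj m (koszulToSym b p i (formTmul b x y)) = _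
  rw [koszulToSym_formTmul b h]
  exact weightProj_of_mem (Subtype.property _)

lemma betaHom_formTmul_of_ne {m i r : ℕ} (h : m ≠ i + 1 + r) (x : Fin (i + 1) → A)
    (y : Fin r → A) : betaHom b p m i (formTmul b x y) = 0 := by
  refine (congrArg (classMap (doldPuppe (SP ℤ m) (mulComplex A p)) i)
    (Subtype.ext (Subtype.ext ?_))).trans (map_zero _)
  exact weightProj_of_mem_of_ne h.symm (koszulToSym_formTmul_mem b x y)

lemma betaHom_eq_zero_iff (m i : ℕ) (t : MvPolynomial κ ℤ ⊗[ℤ] ⋀[ℤ]^(i + 1) A) :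
    betaHom b p m i t = 0 ↔ ∃ w ∈ symPow ℤ m (Level A p (i + 1)),
      polyD p i (symToPoly b p (i + 1) w) = symToPoly b p i (weightProj m (koszulToSym b p i t)) := by
  rw [betaHom_apply, classMap_eq_zero_iff]
  constructor
  · rintro ⟨w, hw⟩
    change symPow ℤ m (Level A p (i + 1)) at w
    refine ⟨w.1, w.2, ?_⟩
    rw [← symToPoly_sum_symMap]
    exact congrArg (symToPoly b p i) ((doldPuppe_d_coe (mulComplex A p) m i w).symm.trans
      (congrArg (fun z : symPow ℤ m (Level A p i) => z.1) hw))
  · rintro ⟨w, hw, h⟩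
    refine ⟨(⟨w, hw⟩ : symPow ℤ m (Level A p (i + 1))), Subtype.ext ?_⟩
    refine (doldPuppe_d_coe (mulComplex A p) m i ⟨w, hw⟩).trans (symToPoly_injective b i ?_)
    rw [symToPoly_sum_symMap, h]
    rfl

/-- p times the image of ∂t is the boundary of the image of t, by `polyD_koszulToPoly`; projecting
to weight m gives the bounding chain. -/
lemma betaHom_smul (m i : ℕ) (t : MvPolynomial κ ℤ ⊗[ℤ] ⋀[ℤ]^(i + 1) A) :
    betaHom b p m i ((p : ℤ) • t) = 0 := by
  rw [betaHom_eq_zero_iff]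
  refine ⟨weightProj m (polyToSym b p (i + 1) (koszulToPoly b (i + 1) t)), weightProj_mem _ _, ?_⟩
  rw [← symToPoly_sum_symMap, sum_symMap_weightProj]
  congr 2
  refine symToPoly_injective b i ?_
  rw [symToPoly_sum_symMap, symToPoly_polyToSym, polyD_koszulToPoly, symToPoly_koszulToSym, map_zsmul,
    map_zsmul]

variable [LinearOrder κ]

lemma koszul_eq_zero_of_smul (b : Module.Basis κ ℤ A) {q : ℤ} (hq : q ≠ 0) {i : ℕ}
    {t : MvPolynomial κ ℤ ⊗[ℤ] ⋀[ℤ]^i A} (h : q • t = 0) : t = 0 := by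
  have hr : q • (koszulBasis b i).repr t = 0 := by
    rw [← map_zsmul, h, map_zero]
  exact (koszulBasis b i).repr.map_eq_zero_iff.1 ((smul_eq_zero.1 hr).resolve_left hq)

/-- The comparison replaces a cycle by the image of some w with p∂w = 0. Torsion-freeness gives ∂w =
0 and Koszul exactness gives w = ∂t. In degree 0 a constant is left over, which has weight 0 and
disappears because m > 0. -/
lemma betaHom_surjective [NeZero p] {m : ℕ} (hm : 0 < m) (i : ℕ) :
    Function.Surjective (betaHom (A := A) b p m i) := by
  intro z
  obtain ⟨⟨z, hz⟩, rfl⟩ := classMap_surjective i z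
  change symPow ℤ m (Level A p i) at z
  -- The constant c is used only for i = 0, where the Koszul complex is exact up to constants; in
  -- positive degrees it is 0.
  have key : ∃ (t : MvPolynomial κ ℤ ⊗[ℤ] ⋀[ℤ]^(i + 1) A) (c : ℤ) (u : PolyLevel κ (i + 1)),
      symToPoly b p i z.1 = koszulToPoly b i (koszul b i t) + algebraMap ℤ _ c + polyD p i u := by
    cases i with
    | zero =>
      have hs : koszulToPoly b 0 ((MvPolynomial.isEmptyAlgEquiv (MvPolynomial κ ℤ) (Fin 0 × κ)
          (symToPoly b p 0 z.1)) ⊗ₜ exteriorPower.ιMulti ℤ 0 (Fin.elim0 : Fin 0 → A)) =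
          symToPoly b p 0 z.1 := by
        rw [koszulToPoly_apply, formDet_apply, Matrix.det_isEmpty, MvPolynomial.smul_eq_C_mul, mul_one]
        exact (MvPolynomial.isEmptyAlgEquiv (MvPolynomial κ ℤ) (Fin 0 × κ)).symm_apply_apply _
      obtain ⟨t, ht⟩ := exists_koszul_zero_eq b (MvPolynomial.isEmptyAlgEquiv (MvPolynomial κ ℤ)
        (Fin 0 × κ) (symToPoly b p 0 z.1)) (Fin.elim0 : Fin 0 → A)
      refine ⟨t, MvPolynomial.constantCoeff (MvPolynomial.isEmptyAlgEquiv (MvPolynomial κ ℤ)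
        (Fin 0 × κ) (symToPoly b p 0 z.1)), 0, ?_⟩
      rw [ht, TensorProduct.sub_tmul, map_sub, hs, koszulToPoly_apply, formDet_apply,
        Matrix.det_isEmpty, MvPolynomial.smul_eq_C_mul, mul_one, map_zero, add_zero]
      exact (sub_add_cancel _ _).symm
    | succ i =>
      have hz' : polyD p i (symToPoly b p (i + 1) z.1) = koszulToPoly b i (koszul b i 0) := by
        rw [map_zero, map_zero, ← symToPoly_sum_symMap, ← map_zero (symToPoly b p i)]
        exact congrArg (symToPoly b p i) ((doldPuppe_d_coe (mulComplex A p) m i z).symm.trans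
          (congrArg (fun z : symPow ℤ m (Level A p i) => z.1) (mem_cycleSubmodule.1 hz i)))
      obtain ⟨w, u, hw, hk⟩ := exists_eq_koszulToPoly_add_polyD b p hz'
      rw [map_zero] at hk
      obtain ⟨t, rfl⟩ := exists_koszul_eq b i (koszul_eq_zero_of_smul b
        (by exact_mod_cast NeZero.ne p) hk.symm)
      exact ⟨t, 0, u, by rw [hw, map_zero, add_zero]⟩
  obtain ⟨t, c, u, h⟩ := key
  refine ⟨t, ?_⟩
  rw [betaHom_apply, ← sub_eq_zero, ← map_sub, ← neg_eq_zero, ← map_neg, classMap_eq_zero_iff]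
  refine ⟨(⟨weightProj m (polyToSym b p (i + 1) u), weightProj_mem _ _⟩ :
    symPow ℤ m (Level A p (i + 1))), Subtype.ext ?_⟩
  refine (doldPuppe_d_coe (mulComplex A p) m i _).trans ?_
  change _ = -(weightProj m (koszulToSym b p i t) - z.1)
  have hz1 : z.1 = koszulToSym b p i t + algebraMap ℤ _ c +
      ∑ k : Fin (i + 2), (-1 : ℤ) ^ (k : ℕ) •
        symMap ((Γ₀.obj (mulComplex A p)).δ k).hom (polyToSym b p (i + 1) u) := by
    refine symToPoly_injective b i ?_
    rw [map_add, map_add, symToPoly_sum_symMap, symToPoly_koszulToSym, symToPoly_polyToSym, h,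
      AlgHom.commutes]
  have hc : weightProj m (algebraMap ℤ (SymmetricAlgebra ℤ (Level A p i)) c) = 0 :=
    weightProj_of_mem_of_ne hm.ne (Submodule.mem_one.2 ⟨c, rfl⟩)
  have hz2 := congrArg (weightProj m) hz1
  rw [weightProj_of_mem z.2, map_add, map_add, hc, add_zero] at hz2
  rw [sum_symMap_weightProj, hz2, neg_sub, add_sub_cancel_left]

end BetaHom

/-! ### The kernel of the β-homomorphism and the factorisation. -/

section Main

open MvPolynomial

variable {A : Type u} [AddCommGroup A] {κ : Type u} (b : Module.Basis κ ℤ A) {p : ℕ}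

/-- The projection of `S ⊗ Λ^i(A)` onto its part of polynomial degree `r`. -/
def koszulDegree (A : Type u) [AddCommGroup A] (κ : Type u) (r i : ℕ) :
    MvPolynomial κ ℤ ⊗[ℤ] ⋀[ℤ]^i A →+ MvPolynomial κ ℤ ⊗[ℤ] ⋀[ℤ]^i A :=
  (LinearMap.rTensor (⋀[ℤ]^i A)
    ((homogeneousComponent r : MvPolynomial κ ℤ →ₗ[ℤ] _).toAddMonoidHom.toIntLinearMap)).toAddMonoidHom

lemma koszulDegree_formTmul {r d i : ℕ} (x : Fin i → A) (y : Fin d → A) :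
    koszulDegree A κ r i (formTmul b x y) = if d = r then formTmul b x y else 0 := by
  change homogeneousComponent r (linFormProd b d y) ⊗ₜ[ℤ] exteriorPower.ιMulti ℤ i x = _
  rw [homogeneousComponent_of_mem (linFormProd_isHomogeneous b y)]
  simp only [eq_comm (a := d)]
  split_ifs
  · rfl
  · rw [TensorProduct.zero_tmul]

/-- The determinant contributes weight i + 1, so weight m corresponds to polynomial degree r; the
projection can be made on the Koszul side. -/
lemma weightProj_koszulToSym {m i r : ℕ} (h : m = i + 1 + r)
    (t : MvPolynomial κ ℤ ⊗[ℤ] ⋀[ℤ]^(i + 1) A) :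
    weightProj m (koszulToSym b p i t) = koszulToSym b p i (koszulDegree A κ r (i + 1) t) := by
  let K : MvPolynomial κ ℤ ⊗[ℤ] ⋀[ℤ]^(i + 1) A →+ SymmetricAlgebra ℤ (Level A p i) :=
    AddMonoidHom.mk' (koszulToSym b p i) (koszulToSym_add b i)
  refine congrArg (fun f : _ →+ _ => f t) (formTmul_hom_ext b
    (f := (weightProj m).toAddMonoidHom.comp K) (g := K.comp (koszulDegree A κ r (i + 1)))
    fun d x y => ?_)
  change weightProj m (koszulToSym b p i (formTmul b x y)) =
    K (koszulDegree A κ r (i + 1) (formTmul b x y))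
  rw [koszulDegree_formTmul]
  have hmem := koszulToSym_formTmul_mem (p := p) b x y
  split_ifs with hd
  · subst hd h
    exact weightProj_of_mem hmem
  · rw [map_zero]
    exact weightProj_of_mem_of_ne (by omega) hmem

section

variable [Module.Free ℤ A] {n m i r : ℕ} (hp : p.Prime) (hn : n = p * m) (h : m = i + 1 + r)

lemma etaHom_koszulDegree (t : MvPolynomial κ ℤ ⊗[ℤ] ⋀[ℤ]^(i + 1) A) :
    etaHom b hp hn h (koszulDegree A κ r (i + 1) t) = etaHom b hp hn h t := by
  refine congrArg (fun f : _ →+ _ => f t) (formTmul_hom_ext b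
    (f := (etaHom b hp hn h).comp (koszulDegree A κ r (i + 1))) (g := etaHom b hp hn h)
    fun d x y => ?_)
  change etaHom b hp hn h (koszulDegree A κ r (i + 1) (formTmul b x y)) = _
  rw [koszulDegree_formTmul]
  split_ifs with hd
  · rfl
  · rw [map_zero, etaHom_formTmul_of_ne b hp hn h x y hd]

/-- The comparison gives ∂t' = p∂v for the degree r part t' of t; by exactness t' − pv is a Koszul
boundary. Thus t' is a sum of two elements killed by `etaHom`, which ignores the other degrees. -/
lemma etaHom_eq_zero_of_betaHom_eq_zero [LinearOrder κ]
    {t : MvPolynomial κ ℤ ⊗[ℤ] ⋀[ℤ]^(i + 1) A} (ht : betaHom b p m i t = 0) :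
    etaHom b hp hn h t = 0 := by
  obtain ⟨w, -, hw⟩ := (betaHom_eq_zero_iff b m i t).1 ht
  rw [weightProj_koszulToSym b h, symToPoly_koszulToSym] at hw
  obtain ⟨v, u, -, hv⟩ := exists_eq_koszulToPoly_add_polyD b p hw
  have hk : koszul b i (koszulDegree A κ r (i + 1) t - (p : ℤ) • v) = 0 := by
    rw [map_sub, map_zsmul, hv, sub_self]
  obtain ⟨v', hv'⟩ := exists_koszul_eq b i hk
  rw [← etaHom_koszulDegree, ← sub_add_cancel (koszulDegree A κ r (i + 1) t) ((p : ℤ) • v), map_add,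
    etaHom_smul, add_zero, ← hv', etaHom_koszul]

end

lemma exists_eq_add_of_red_eq {x x' : A} (h : red A p x = red A p x') :
    ∃ a, x = x' + (p : ℤ) • a := by
  obtain ⟨a, ha⟩ := (red_eq_zero_iff (p := p) (x - x')).1 (by rw [map_sub, h, sub_self])
  exact ⟨a, by rw [ha, add_sub_cancel]⟩

/-- The symbols `β_p` depend only on the classes modulo `p`. -/
lemma betaClass_eq_of_red_eq [Module.Free ℤ A] [NeZero p] {m i r : ℕ} (h : m = i + 1 + r)
    {x x' : Fin (i + 1) → A} {y y' : Fin r → A} (hx : ∀ k, red A p (x k) = red A p (x' k))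
    (hy : ∀ k, red A p (y k) = red A p (y' k)) : betaClass p h x y = betaClass p h x' y' := by
  let b := Module.Free.chooseBasis ℤ A
  obtain ⟨t, ht⟩ := exists_formTmul_eq_add b p (fun k => exists_eq_add_of_red_eq (hx k))
    fun k => exists_eq_add_of_red_eq (hy k)
  rw [← betaHom_formTmul b, ← betaHom_formTmul b, ht, map_add, betaHom_smul, add_zero]

/-- The classes of the elements `eta` depend only on the classes modulo `p`. -/
lemma etaClass_eq_of_red_eq [Module.Free ℤ A] {n m i r : ℕ} (hp : p.Prime) (hn : n = p * m)
    (h : m = i + 1 + r) {x x' : Fin (i + 1) → A} {y y' : Fin r → A}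
    (hx : ∀ k, red A p (x k) = red A p (x' k)) (hy : ∀ k, red A p (y k) = red A p (y' k)) :
    etaClass hp hn h x y = etaClass hp hn h x' y' := by
  let b := Module.Free.chooseBasis ℤ A
  obtain ⟨t, ht⟩ := exists_formTmul_eq_add b p (fun k => exists_eq_add_of_red_eq (hx k))
    fun k => exists_eq_add_of_red_eq (hy k)
  rw [← etaHom_formTmul b, ← etaHom_formTmul b, ht, map_add, etaHom_smul, add_zero]

/-- The symbols generate the derived functor. -/
lemma linearMap_eq_of_betaClass [Module.Free ℤ A] [NeZero p] {m i : ℕ} (hm : 0 < m)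
    {N : ModuleCat.{u} ℤ} {f g : derived (SP ℤ m) (resolution A p) i →ₗ[ℤ] N}
    (hfg : ∀ (r : ℕ) (h : m = i + 1 + r) (x : Fin (i + 1) → A) (y : Fin r → A),
      f (betaClass p h x y) = g (betaClass p h x y)) : f = g := by
  classical
  let b := Module.Free.chooseBasis ℤ A
  -- Any total order on the basis serves; it is needed for the wedge basis and for pivots.
  let _ : LinearOrder (Module.Free.ChooseBasisIndex ℤ A) := linearOrderOfSTO WellOrderingRel
  have h : f.toAddMonoidHom.comp (betaHom b p m i) = g.toAddMonoidHom.comp (betaHom b p m i) := by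
    refine formTmul_hom_ext b fun r x y => ?_
    change f (betaHom b p m i (formTmul b x y)) = g (betaHom b p m i (formTmul b x y))
    by_cases hr : m = i + 1 + r
    · rw [betaHom_formTmul b hr]
      exact hfg r hr x y
    · rw [betaHom_formTmul_of_ne b hr]
      exact (map_zero f).trans (map_zero g).symm
  refine LinearMap.ext fun z => ?_
  obtain ⟨t, rfl⟩ := betaHom_surjective b hm i z
  exact congrArg (fun φ : _ →+ _ => φ t) h

/-- The homomorphism sending the symbols to the classes of the elements `eta`. -/
lemma exists_linearMap_betaClass [Module.Free ℤ A] [NeZero p] {n m i r : ℕ} (hp : p.Prime)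
    (hn : n = p * m) (hm : 0 < m) (h : m = i + 1 + r) :
    ∃ f : derived (SP ℤ m) (resolution A p) i →ₗ[ℤ] (dualDeRham ℤ A n).homology i,
      ∀ (x : Fin (i + 1) → A) (y : Fin r → A),
        f (betaClass p h x y) = etaClass hp hn h x y := by
  classical
  let b := Module.Free.chooseBasis ℤ A
  let _ : LinearOrder (Module.Free.ChooseBasisIndex ℤ A) := linearOrderOfSTO WellOrderingRel
  let F : (doldPuppe (SP ℤ m) (mulComplex A p)).homology i →+ (dualDeRham ℤ A n).homology i :=
    (betaHom b p m i).liftOfSurjective (betaHom_surjective b hm i)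
      ⟨etaHom b hp hn h, fun t ht => etaHom_eq_zero_of_betaHom_eq_zero b hp hn h ht⟩
  refine ⟨{ toFun := F, map_add' := F.map_add, map_smul' := fun c z => map_intCast_smul F ℤ ℤ c z },
    fun x y => ?_⟩
  change F (betaClass p h x y) = _
  rw [← betaHom_formTmul b, ← etaHom_formTmul b]
  exact (betaHom b p m i).liftOfRightInverse_comp_apply _ _ _ _

end Main

end

end DualDeRham

open DualDeRham

theorem mainTheorem3 (A : Type u) [AddCommGroup A] [Module.Free ℤ A] (p : ℕ) [hp : Fact p.Prime]
    (n m i : ℕ) (hn : n = p * m) (hm : 0 < m) :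
    -- the symbols `β_p(x̄) ⊗ ȳ` depend only on the classes modulo `p`
    (∀ (r : ℕ) (h : m = i + 1 + r) (x x' : Fin (i + 1) → A) (y y' : Fin r → A),
      (∀ k, red A p (x k) = red A p (x' k)) → (∀ k, red A p (y k) = red A p (y' k)) →
        betaClass p h x y = betaClass p h x' y') ∧
    -- the elements `η_i` are cycles
    ∃ hη : ∀ (r : ℕ) (h : m = i + 1 + r) (x : Fin (i + 1) → A) (y : Fin r → A) (j : ℕ),
        ((dualDeRham ℤ A n).d i j).hom (eta hp.out.pos hn h x y) = 0,
      -- modulo boundaries they depend only on the classes modulo `p`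
      (∀ (r : ℕ) (h : m = i + 1 + r) (x x' : Fin (i + 1) → A) (y y' : Fin r → A),
        (∀ k, red A p (x k) = red A p (x' k)) → (∀ k, red A p (y k) = red A p (y' k)) →
          ∃ w : (dualDeRham ℤ A n).X (i + 1),
            ((dualDeRham ℤ A n).d (i + 1) i).hom w =
              eta hp.out.pos hn h x y - eta hp.out.pos hn h x' y') ∧
      -- the Jacobi-type combinations vanish
      (∀ (r : ℕ) (h : m = i + 2 + r) (x : Fin (i + 2) → A) (y : Fin r → A),
        ∑ k : Fin (i + 2), (-1 : ℤ) ^ ((k : ℕ) + 1) •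
          eta (R := ℤ) hp.out.pos hn (show m = i + 1 + (r + 1) by omega)
            (fun j => x (k.succAbove j)) (Fin.cons (x k) y : Fin (r + 1) → A) = 0) ∧
      -- the assignment extends to a unique homomorphism
      ∃! f : derived (SP ℤ m) (resolution A p) i →ₗ[ℤ] (dualDeRham ℤ A n).homology i,
        ∀ (r : ℕ) (h : m = i + 1 + r) (x : Fin (i + 1) → A) (y : Fin r → A),
          f (betaClass p h x y) =
            homologyClass (dualDeRham ℤ A n) (eta hp.out.pos hn h x y) (hη r h x y) := by
  refine ⟨fun r h x x' y y' hx hy => betaClass_eq_of_red_eq h hx hy,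
    fun r h x y j => eta_cycle hp.out.pos hn h x y j, fun r h x x' y y' hx hy => ?_,
    fun r h x y => eta_jacobi hp.out.pos hn h x y, ?_⟩
  · have hxy := etaClass_eq_of_red_eq hp.out hn h hx hy
    rw [← homologyClass_eta hp.out hn h x y (eta_cycle hp.out.pos hn h x y),
      ← homologyClass_eta hp.out hn h x' y' (eta_cycle hp.out.pos hn h x' y'), ← classMap_apply,
      ← classMap_apply, ← sub_eq_zero, ← map_sub, classMap_eq_zero_iff] at hxy
    exact hxy
  · by_cases hr : ∃ r, m = i + 1 + r
    · obtain ⟨r, h⟩ := hr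
      obtain ⟨f, hf⟩ := exists_linearMap_betaClass (A := A) hp.out hn hm h
      have hf' : ∀ (r : ℕ) (h : m = i + 1 + r) (x : Fin (i + 1) → A) (y : Fin r → A),
          f (betaClass p h x y) = homologyClass (dualDeRham ℤ A n) (eta hp.out.pos hn h x y)
            (eta_cycle hp.out.pos hn h x y) := by
        intro r' h' x y
        obtain rfl : r' = r := by omega
        exact (hf x y).trans (homologyClass_eta hp.out hn h' x y _).symm
      exact ⟨f, hf', fun g hg => linearMap_eq_of_betaClass hm fun r h x y =>
        (hg r h x y).trans (hf' r h x y).symm⟩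
    -- Here i ≥ m and there are no symbols; since symbols generate, every homomorphism equals zero.
    · exact ⟨0, fun r h => absurd ⟨r, h⟩ hr, fun g _ => linearMap_eq_of_betaClass hm
        fun r h => absurd ⟨r, h⟩ hr⟩
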